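/- **Problem $Qm|\mathrm{cap}|C_{\max}$.** Fix the number $m\ge 1$ of machines. An instance consists of $n\ge 1$ jobs with processing times $p_1,\dots,p_n\in\mathbb N$ (where $0\in\mathbb N$), and for every machine $i\in\{1,\dots,m\}$ a positive rational speed $q_i$ (given by numerator and denominator) and a capacity $b_i\in\mathbb N$. Job $j$ takes time $p_j/q_i$ on machine $i$. A schedule is a map $\sigma:\{1,\dots,n\}\to\{1,\dots,m\}$; it is feasible if $|\sigma^{-1}(i)|\le b_i$ for every $i$, and its makespan is $C_{\max}(\sigma)=\max_i\sum_{j\in\sigma^{-1}(i)}p_j/q_i$. The task is to compute a feasible schedule of minimum makespan, or to report that no feasible schedule exists. Let $p_{\max}=\max_j p_j$. **Theorem.** For every fixed $m\ge 1$, the problem $Qm|\mathrm{cap}|C_{\max}$ can be solved in $\widetilde O(p_{\max}^{4m+2}+n)$ time. That is, for every $m\ge 1$ there are a deterministic word-RAM program and constants $c,k,e\in\mathbb N$, depending only on $m$, such that on every instance the program computes a correct answer in at most $c\cdot f\cdot(1+\lfloor\log_2 f\rfloor)^k$ steps, where $f=p_{\max}^{4m+2}+n$. Here the basic operations on words (sum,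 truncated difference, product, integer quotient, comparison, reading and writing memory) have unit cost, and words hold numbers below $(N+2)^{e+1}$, where $N$ is the largest number in the input (including $n$), so that words have $O(\log N)$ bits. -/

import Mathlib

/-! ### A unit-cost word RAM

Programs are structured programs over finitely many word-sized variables `0, 1, 2, …` and finitely
many arrays of words `0, 1, 2, …`. Every variable and array cell holds a natural number below the
word bound `B`; a program that computes a number `≥ B` has no execution. Each assignment, array
access and test costs one step. -/

namespace WordRAM

/-- The contents of the variables and of the arrays. -/
structure State where
  var : ℕ → ℕ
  arr : ℕ → ℕ → ℕ

/-- Assign the value `v` to the variable `x`. -/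
def State.setVar (s : State) (x v : ℕ) : State :=
  { s with var := Function.update s.var x v }

/-- Write the value `v` into the cell with index `i` of the array `a`. -/
def State.setArr (s : State) (a i v : ℕ) : State :=
  { s with arr := Function.update s.arr a (Function.update (s.arr a) i v) }

/-- The arithmetic operations: sum, truncated difference, product, integer quotient. -/
inductive Op where
  | plus
  | minus
  | times
  | quot

def Op.eval : Op → ℕ → ℕ → ℕ
  | .plus, a, b => a + b
  | .minus, a, b => a - b
  | .times, a, b => a * b
  | .quot, a, b => a / b

/-- Programs. All arguments of type `ℕ` are names of variables or arrays that are fixed in the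
program text, except for the constant `v` in `const x v`. -/
inductive Prog where
  /-- do nothing -/
  | skip
  /-- `x := v` -/
  | const (x v : ℕ)
  /-- `x := y o z` -/
  | arith (o : Op) (x y z : ℕ)
  /-- `x := a[y]` -/
  | load (x a y : ℕ)
  /-- `a[x] := y` -/
  | store (a x y : ℕ)
  /-- run the first program, then the second -/
  | seq (P Q : Prog)
  /-- `if x < y then P else Q` -/
  | ifLt (x y : ℕ) (P Q : Prog)
  /-- `while x < y do P` -/
  | whileLt (x y : ℕ) (P : Prog)

/-- `Exec B P s t s'`: with words bounded by `B`, the program `P` started in the state `s` halts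
after exactly `t` steps in the state `s'`, and every number computed on the way is below `B`. -/
inductive Exec (B : ℕ) : Prog → State → ℕ → State → Prop where
  | skip (s : State) : Exec B .skip s 1 s
  | const (s : State) (x v : ℕ) (h : v < B) :
      Exec B (.const x v) s 1 (s.setVar x v)
  | arith (s : State) (o : Op) (x y z : ℕ) (h : o.eval (s.var y) (s.var z) < B) :
      Exec B (.arith o x y z) s 1 (s.setVar x (o.eval (s.var y) (s.var z)))
  | load (s : State) (x a y : ℕ) :
      Exec B (.load x a y) s 1 (s.setVar x (s.arr a (s.var y)))
  | store (s : State) (a x y : ℕ) :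
      Exec B (.store a x y) s 1 (s.setArr a (s.var x) (s.var y))
  | seq {P Q : Prog} {s s' s'' : State} {t t' : ℕ}
      (hP : Exec B P s t s') (hQ : Exec B Q s' t' s'') :
      Exec B (.seq P Q) s (t + t') s''
  | ifTrue {x y : ℕ} {P Q : Prog} {s s' : State} {t : ℕ} (h : s.var x < s.var y)
      (hP : Exec B P s t s') : Exec B (.ifLt x y P Q) s (t + 1) s'
  | ifFalse {x y : ℕ} {P Q : Prog} {s s' : State} {t : ℕ} (h : ¬ s.var x < s.var y)
      (hQ : Exec B Q s t s') : Exec B (.ifLt x y P Q) s (t + 1) s'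
  | whileTrue {x y : ℕ} {P : Prog} {s s' s'' : State} {t t' : ℕ} (h : s.var x < s.var y)
      (hP : Exec B P s t s') (hW : Exec B (.whileLt x y P) s' t' s'') :
      Exec B (.whileLt x y P) s (t + t' + 1) s''
  | whileFalse {x y : ℕ} {P : Prog} {s : State} (h : ¬ s.var x < s.var y) :
      Exec B (.whileLt x y P) s 1 s

end WordRAM

/-! ### Makespan minimization on related machines with capacities -/

/-- An instance with `m` related machines: `n` jobs with processing times `p j`, machines with
positive rational speeds `speed i` and with capacities `cap i`. -/
structure CapInstance (m : ℕ) where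
  n : ℕ
  p : Fin n → ℕ
  speed : Fin m → ℚ≥0
  speed_pos : ∀ i, 0 < speed i
  cap : Fin m → ℕ

namespace CapInstance

variable {m : ℕ} (I : CapInstance m)

/-- The largest processing time of a job. -/
def pmax : ℕ := Finset.univ.sup I.p

/-- The time at which machine `i` completes its jobs under the schedule `σ`; job `j` takes time
`p j / speed i` on machine `i`. -/
def completion (σ : Fin I.n → Fin m) (i : Fin m) : ℚ≥0 :=
  ∑ j with σ j = i, (I.p j : ℚ≥0) / I.speed i

/-- The makespan: the latest completion time of a machine. -/
def makespan (σ : Fin I.n → Fin m) : ℚ≥0 := Finset.univ.sup (I.completion σ)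

/-- Each machine respects its capacity. -/
def Feasible (σ : Fin I.n → Fin m) : Prop :=
  ∀ i, (Finset.univ.filter fun j => σ j = i).card ≤ I.cap i

/-- `σ` is feasible and has the smallest makespan among the feasible schedules. -/
def IsOptimal (σ : Fin I.n → Fin m) : Prop :=
  I.Feasible σ ∧ ∀ τ, I.Feasible τ → I.makespan σ ≤ I.makespan τ

/-- The largest number in the input. -/
def magnitude : ℕ :=
  I.n ⊔ I.pmax ⊔ Finset.univ.sup I.cap ⊔ Finset.univ.sup (fun i => (I.speed i).num) ⊔
    Finset.univ.sup (fun i => (I.speed i).den)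

/-- Bound on the words of the machine: words have `O(log N)` bits, where `N` is the largest number
in the input (each input number fits into one word). -/
def wordBound (e : ℕ) : ℕ := (I.magnitude + 2) ^ (e + 1)

/-- A list of `k` numbers as the contents of an array, padded with zeros. -/
def toArr {k : ℕ} (f : Fin k → ℕ) (i : ℕ) : ℕ := if h : i < k then f ⟨i, h⟩ else 0

/-- The initial state: variable `0` holds the number of jobs; the arrays `0, 1, 2, 3` hold the
processing times, the capacities, and the numerators and denominators of the speeds; everything
else is zero. -/
def input : WordRAM.State where
  var x := if x = 0 then I.n else 0
  arr a :=
    match a with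
    | 0 => toArr I.p
    | 1 => toArr I.cap
    | 2 => toArr fun i => (I.speed i).num
    | 3 => toArr fun i => (I.speed i).den
    | _ => fun _ => 0

/-- The state `s` holds a correct answer: either variable `0` is `1` and the first `n` cells of the
array `4` are an optimal schedule, or variable `0` is `0` and no schedule is feasible. -/
def Answered (s : WordRAM.State) : Prop :=
  (s.var 0 = 1 ∧ ∃ σ : Fin I.n → Fin m, I.IsOptimal σ ∧ ∀ j : Fin I.n, s.arr 4 j = (σ j : ℕ)) ∨
    (s.var 0 = 0 ∧ ∀ σ : Fin I.n → Fin m, ¬ I.Feasible σ)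

end CapInstance

/-- The bound `c · f · (1 + log f) ^ k`, for constants `c` and `k`: the time `Õ(f)`. -/
def softBound (c k f : ℕ) : ℕ := c * f * (Nat.log 2 f + 1) ^ k

/-!
The program decides by dynamic programming whether there is a schedule whose loads and numbers of
jobs on the machines are bounded by a given target, and it finds the optimum by binary search over
targets.

**Levels.** Only the numbers `cnt p` of jobs of each type `p`, the processing time, matter. The
level `k` has `cnt p / 2 ^ k` jobs of the type `p`. The computation starts with a level that has
no jobs and goes down to the level `0`. The level `k` arises from the level `k + 1` by doubling
the jobs and adding at most one job of each type. Each level has a table. Its cells are the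
vectors of `2 * m` bounds (on the load and on the number of jobs of each machine) in a window
around the target divided by `2 ^ k`. The window is a box with side lengths of order `Q ^ 2` for
the loads and `Q` for the numbers of jobs, where `Q` is the largest processing time plus one.
Feasible cells are flagged and hold a schedule.

**Doubling.** A schedule with an even number of jobs of each type splits into two halves with the
same jobs whose loads differ by `O(Q)` and whose numbers of jobs differ by `O(1)`
(`exists_split`). Indeed, for each type, the machines with an odd number of jobs of this type can
be paired up, and for each pair of machines the odd jobs are given to one half and the other
alternatingly in the order of their types; sums of increasing numbers with alternating signs are
small. Hence both halves are near half the target, and a feasible cell of the doubled level is the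
sum of two feasible cells that differ by one of `O(Q ^ m)` vectors (`exists_pair`). There are
`O(Q ^ (3 * m))` cells, and copying a schedule takes time `O(Q)`, which gives
`O(Q ^ (4 * m + 1))` for the doubling, while the additional jobs, one type after the other, take
time `O(Q ^ (3 * m + 2))`. Each of them moves the cells by at most one unit, for which the
window has room (`exists_add`).

**Search.** The makespan of a schedule is the time that some machine needs for an integral load.
For every machine, binary search finds the least load such that all machines can respect the time
that this load takes (`search_spec`); the best of these loads is optimal (`answered_of_solved`).
The schedule in the table says how many jobs of each type a machine gets, and the jobs are
distributed accordingly (`distribute_spec`). The number of levels and the number of rounds of the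
binary search are logarithmic.

**The machine.** The program is written in a small language with expressions and bounded loops,
which has a denotational semantics `Stmt.run`, a rule for invariants of loops (`Stmt.tri_loop`),
and a cost that only depends on bounds for the numbers of rounds. The compiler to the word RAM is
verified in `Stmt.correct`.
-/

namespace CapScheduling

open WordRAM (State Prog Exec Op)

/-! ### A small language of bounded loops over the word RAM -/

/-- The variables of the program. The first one is the variable `0` of the word RAM, which holds the
number of jobs at the start and the answer at the end. The variables from `jj` on are the counters
of loops. -/
inductive Vr
  | io | jobs | pmax | types | levels | pow | row | size | dsize | unit | lpow | centre | ok
  | mach | lo | query | step | found | bestLoad | bestMach | used | valid | zb | zu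
  | jj | cc | zz | dd | qq | ii | pp | kk | bb | ss
  deriving DecidableEq

/-- The arrays of the program. The first five are those that the word RAM uses for the input and
the output. A table consists of the flags of its cells and of a schedule for each flagged cell, as a
row of the array `wit`; `flag2` and `wit2` hold the table under construction. -/
inductive Ar
  | proc | cap | num | den | out | flag | wit | flag2 | wit2 | unit | str | dstr | base | obase
  | cnt | tgt
  deriving DecidableEq

theorem Vr.ctorIdx_injective : Function.Injective Vr.ctorIdx :=
  Function.LeftInverse.injective (g := Vr.ofNat) Vr.ofNat_ctorIdx

theorem Ar.ctorIdx_injective : Function.Injective Ar.ctorIdx :=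
  Function.LeftInverse.injective (g := Ar.ofNat) Ar.ofNat_ctorIdx

/-- The contents of the named variables and arrays. -/
structure Mem where
  var : Vr → ℕ
  arr : Ar → ℕ → ℕ

namespace Mem

/-- Assign `v` to the variable `x`. -/
def setVar (h : Mem) (x : Vr) (v : ℕ) : Mem :=
  { h with var := fun w => if w = x then v else h.var w }

/-- Write `v` into the cell `i` of the array `a`. -/
def setArr (h : Mem) (a : Ar) (i v : ℕ) : Mem :=
  { h with arr := fun b k => if b = a ∧ k = i then v else h.arr b k }

@[simp] theorem setVar_var (h : Mem) (x : Vr) (v : ℕ) (w : Vr) :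
    (h.setVar x v).var w = if w = x then v else h.var w := rfl

@[simp] theorem setVar_arr (h : Mem) (x : Vr) (v : ℕ) : (h.setVar x v).arr = h.arr := rfl

@[simp] theorem setArr_var (h : Mem) (a : Ar) (i v : ℕ) : (h.setArr a i v).var = h.var := rfl

@[simp] theorem setArr_arr (h : Mem) (a : Ar) (i v : ℕ) (b : Ar) (k : ℕ) :
    (h.setArr a i v).arr b k = if b = a ∧ k = i then v else h.arr b k := rfl

/-- All variables and cells hold numbers at most `V`. -/
def Bounded (V : ℕ) (h : Mem) : Prop := (∀ x, h.var x ≤ V) ∧ ∀ a i, h.arr a i ≤ V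

theorem Bounded.setVar {V : ℕ} {h : Mem} (hb : h.Bounded V) (x : Vr) {v : ℕ} (hv : v ≤ V) :
    (h.setVar x v).Bounded V := by
  refine ⟨fun w => ?_, hb.2⟩
  rw [setVar_var]
  split_ifs
  · exact hv
  · exact hb.1 w

theorem Bounded.setArr {V : ℕ} {h : Mem} (hb : h.Bounded V) (a : Ar) (i : ℕ) {v : ℕ}
    (hv : v ≤ V) : (h.setArr a i v).Bounded V := by
  refine ⟨hb.1, fun b k => ?_⟩
  rw [setArr_arr]
  split_ifs
  · exact hv
  · exact hb.2 b k

end Mem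

/-- The named part of a state of the word RAM. Named variables are the even ones; the odd ones serve
as a stack for evaluating expressions and for running loops. -/
def view (s : State) : Mem where
  var x := s.var (2 * x.ctorIdx)
  arr a := s.arr a.ctorIdx

@[simp] theorem view_setVar_odd (s : State) (d v : ℕ) : view (s.setVar (2 * d + 1) v) = view s := by
  have : (view (s.setVar (2 * d + 1) v)).var = (view s).var := by
    funext x
    simp only [view, State.setVar]
    exact Function.update_of_ne (by omega) _ _
  exact congrArg (fun f => Mem.mk f (view s).arr) this

theorem view_setVar (s : State) (x : Vr) (v : ℕ) :
    view (s.setVar (2 * x.ctorIdx) v) = (view s).setVar x v := by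
  have : (view (s.setVar (2 * x.ctorIdx) v)).var = ((view s).setVar x v).var := by
    funext w
    simp only [view, State.setVar, Mem.setVar_var, Function.update_apply]
    have : 2 * w.ctorIdx = 2 * x.ctorIdx ↔ w = x :=
      ⟨fun h => Vr.ctorIdx_injective (by omega), fun h => by rw [h]⟩
    simp only [this]
  exact congrArg (fun f => Mem.mk f (view s).arr) this

theorem view_setArr (s : State) (a : Ar) (i v : ℕ) :
    view (s.setArr a.ctorIdx i v) = (view s).setArr a i v := by
  have : (view (s.setArr a.ctorIdx i v)).arr = ((view s).setArr a i v).arr := by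
    funext b k
    have hab : b.ctorIdx = a.ctorIdx ↔ b = a :=
      ⟨fun h => Ar.ctorIdx_injective h, fun h => by rw [h]⟩
    simp only [view, State.setArr, Mem.setArr_arr, Function.update_apply, hab]
    by_cases hb : b = a
    · subst hb
      simp [Function.update_apply]
    · simp [hb]
  exact congrArg (fun f => Mem.mk (view s).var f) this

/-- Arithmetic expressions over the named variables and arrays. -/
inductive Exp
  | lit (v : ℕ)
  | var (x : Vr)
  | bin (o : Op) (e f : Exp)
  | get (a : Ar) (e : Exp)

namespace Exp

instance : Coe Vr Exp := ⟨Exp.var⟩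
instance : Add Exp := ⟨Exp.bin .plus⟩
instance : Sub Exp := ⟨Exp.bin .minus⟩
instance : Mul Exp := ⟨Exp.bin .times⟩
instance : Div Exp := ⟨Exp.bin .quot⟩
/-- The remainder, which is not an operation of the word RAM: `e - e / f * f`. -/
instance : Mod Exp := ⟨fun e f => e - e / f * f⟩

/-- The value of an expression. -/
def eval (h : Mem) : Exp → ℕ
  | lit v => v
  | var x => h.var x
  | bin o e f => o.eval (e.eval h) (f.eval h)
  | get a e => h.arr a (e.eval h)

/-- Code that leaves the value of the expression in the stack position `d`. -/
def code : Exp → ℕ → Prog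
  | lit v, d => .const (2 * d + 1) v
  | var x, d => .seq (.const (2 * d + 1) 0) (.arith .plus (2 * d + 1) (2 * x.ctorIdx) (2 * d + 1))
  | bin o e f, d =>
      .seq (e.code d) (.seq (f.code (d + 1)) (.arith o (2 * d + 1) (2 * d + 1) (2 * (d + 1) + 1)))
  | get a e, d => .seq (e.code d) (.load (2 * d + 1) a.ctorIdx (2 * d + 1))

/-- The number of steps of the code. -/
def cost : Exp → ℕ
  | lit _ => 1
  | var _ => 2
  | bin _ e f => e.cost + (f.cost + 1)
  | get _ e => e.cost + 1

/-- If variables and cells hold numbers at most `V ≥ 2`, then all numbers that arise in evaluating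
the expression are at most `V ^ weight`. -/
def weight : Exp → ℕ
  | lit v => v + 1
  | var _ => 1
  | bin _ e f => e.weight + f.weight
  | get _ e => e.weight + 1

section

variable (h : Mem) (e f : Exp)

@[simp] theorem eval_lit (v : ℕ) : (lit v).eval h = v := rfl
@[simp] theorem eval_var (x : Vr) : (var x).eval h = h.var x := rfl
@[simp] theorem eval_get (a : Ar) : (get a e).eval h = h.arr a (e.eval h) := rfl
@[simp] theorem eval_add : (e + f).eval h = e.eval h + f.eval h := rfl
@[simp] theorem eval_sub : (e - f).eval h = e.eval h - f.eval h := rfl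
@[simp] theorem eval_mul : (e * f).eval h = e.eval h * f.eval h := rfl
@[simp] theorem eval_div : (e / f).eval h = e.eval h / f.eval h := rfl
@[simp] theorem eval_mod : (e % f).eval h = e.eval h % f.eval h :=
  (Nat.mod_eq_sub_div_mul).symm

end

theorem weight_pos (e : Exp) : 0 < e.weight := by
  induction e <;> simp [weight]; omega

theorem op_eval_le {V a b i j : ℕ} (hV : 2 ≤ V) (hi : 0 < i) (hj : 0 < j) (ha : a ≤ V ^ i)
    (hb : b ≤ V ^ j) (o : Op) : o.eval a b ≤ V ^ (i + j) := by
  have hle : a ≤ V ^ (i + j) := ha.trans (Nat.pow_le_pow_right (by omega) (by omega))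
  have h2i : 2 ≤ V ^ i := hV.trans (Nat.le_self_pow (by omega) V)
  have h2j : 2 ≤ V ^ j := hV.trans (Nat.le_self_pow (by omega) V)
  cases o with
  | plus =>
    change a + b ≤ _
    rw [pow_add]
    nlinarith
  | minus => exact (Nat.sub_le a b).trans hle
  | times => rw [pow_add]; exact Nat.mul_le_mul ha hb
  | quot => exact (Nat.div_le_self a b).trans hle

theorem eval_le {V : ℕ} (hV : 2 ≤ V) {h : Mem} (hb : h.Bounded V) (e : Exp) :
    e.eval h ≤ V ^ e.weight := by
  induction e with
  | lit v =>
    have hv : v < V ^ v := Nat.lt_pow_self (by omega)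
    exact hv.le.trans (Nat.pow_le_pow_right (by omega) (Nat.le_succ v))
  | var x => simpa [weight, eval] using hb.1 x
  | bin o e f he hf => exact op_eval_le hV e.weight_pos f.weight_pos he hf o
  | get a e he => exact (hb.2 a _).trans (Nat.le_self_pow (by simp [weight]) V)

theorem exec_code {V B : ℕ} (hV : 2 ≤ V) (e : Exp) : ∀ (d : ℕ) (s : State),
    (view s).Bounded V → V ^ e.weight < B →
      ∃ s', Exec B (e.code d) s e.cost s' ∧ view s' = view s ∧
        (∀ i < d, s'.var (2 * i + 1) = s.var (2 * i + 1)) ∧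
        s'.var (2 * d + 1) = e.eval (view s) := by
  induction e with
  | lit v =>
    intro d s hb hB
    refine ⟨_, Exec.const s _ v ?_, by simp, ?_, by simp [State.setVar]⟩
    · exact ((eval_le hV hb (lit v)).trans_lt hB)
    · intro i hi
      exact Function.update_of_ne (by omega) _ _
  | var x =>
    intro d s hb hB
    have hval : (view s).var x < B := (eval_le hV hb (var x)).trans_lt hB
    have hne : 2 * x.ctorIdx ≠ 2 * d + 1 := by omega
    refine ⟨_, (Exec.const s _ 0 (by omega)).seq (Exec.arith _ .plus _ _ _ ?_), ?_, ?_, ?_⟩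
    · simpa [Op.eval, State.setVar, Function.update_apply, view, hne] using hval
    · simp
    · intro i hi
      simp only [State.setVar]
      rw [Function.update_of_ne (by omega), Function.update_of_ne (by omega)]
    · simp [Op.eval, State.setVar, view, hne]
  | bin o e f he hf =>
    intro d s hb hB
    have hBe : V ^ e.weight < B :=
      (Nat.pow_le_pow_right (by omega) (by simp [weight])).trans_lt hB
    have hBf : V ^ f.weight < B :=
      (Nat.pow_le_pow_right (by omega) (by simp [weight])).trans_lt hB
    obtain ⟨s₁, h₁, hv₁, hk₁, hr₁⟩ := he d s hb hBe
    obtain ⟨s₂, h₂, hv₂, hk₂, hr₂⟩ := hf (d + 1) s₁ (hv₁ ▸ hb) hBf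
    have ho : o.eval (s₂.var (2 * d + 1)) (s₂.var (2 * (d + 1) + 1)) =
        (bin o e f).eval (view s) := by
      rw [hk₂ d (by omega), hr₁, hr₂, hv₁, eval]
    refine ⟨_, h₁.seq (h₂.seq (Exec.arith _ o _ _ _ ?_)), ?_, ?_, ?_⟩
    · rw [ho]
      exact (eval_le hV hb (bin o e f)).trans_lt hB
    · rw [view_setVar_odd, hv₂, hv₁]
    · intro i hi
      simp only [State.setVar]
      rw [Function.update_of_ne (by omega), hk₂ i (by omega), hk₁ i hi]
    · rw [← ho]
      simp [State.setVar]
  | get a e he =>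
    intro d s hb hB
    have hBe : V ^ e.weight < B :=
      (Nat.pow_le_pow_right (by omega) (by simp [weight])).trans_lt hB
    obtain ⟨s₁, h₁, hv₁, hk₁, hr₁⟩ := he d s hb hBe
    refine ⟨_, h₁.seq (Exec.load _ _ _ _), ?_, ?_, ?_⟩
    · rw [view_setVar_odd, hv₁]
    · intro i hi
      simp only [State.setVar]
      rw [Function.update_of_ne (by omega), hk₁ i hi]
    · rw [hr₁]
      simp only [State.setVar, Function.update_self, eval]
      rw [← hv₁]
      rfl

end Exp

/-- Statements. In `loop x e P` the number of rounds is the value of `e` at the start, and `x` is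
set to the index of the round at the start of each round. -/
inductive Stmt
  | assign (x : Vr) (e : Exp)
  | put (a : Ar) (e f : Exp)
  | skip
  | seq (P R : Stmt)
  | ite (e f : Exp) (P R : Stmt)
  | loop (x : Vr) (e : Exp) (P : Stmt)

/-- Assignment. -/
infix:60 " ::= " => Stmt.assign
/-- Sequential composition. -/
infixr:50 " ;; " => Stmt.seq

namespace Stmt

/-- The memory after running a statement. -/
def run : Stmt → Mem → Mem
  | assign x e, h => h.setVar x (e.eval h)
  | put a e f, h => h.setArr a (e.eval h) (f.eval h)
  | skip, h => h
  | seq P R, h => R.run (P.run h)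
  | ite e f P R, h => if e.eval h < f.eval h then P.run h else R.run h
  | loop x e P, h => Nat.rec h (fun i g => P.run (g.setVar x i)) (e.eval h)

/-- The statement assigns numbers at most `V` only, and a loop with the counter `x` has at most
`β x` rounds. -/
def Ok (V : ℕ) (β : Vr → ℕ) : Stmt → Mem → Prop
  | assign _ e, h => e.eval h ≤ V
  | put _ _ f, h => f.eval h ≤ V
  | skip, _ => True
  | seq P R, h => P.Ok V β h ∧ R.Ok V β (P.run h)
  | ite e f P R, h => if e.eval h < f.eval h then P.Ok V β h else R.Ok V β h
  | loop x e P, h => e.eval h ≤ β x ∧ ∀ i < e.eval h,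
      P.Ok V β (Mem.setVar (Nat.rec h (fun i g => P.run (g.setVar x i)) i) x i)

/-- A bound on the number of steps of the code, if a loop with the counter `x` has at most `β x`
rounds. -/
def cost (β : Vr → ℕ) : Stmt → ℕ
  | assign _ e => e.cost + 2
  | put _ e f => e.cost + f.cost + 1
  | skip => 1
  | seq P R => P.cost β + R.cost β
  | ite e f P R => e.cost + f.cost + 1 + (P.cost β + R.cost β)
  | loop x e P => e.cost + 2 + β x * (P.cost β + 5)

/-- The largest weight of an expression of the statement. -/
def weight : Stmt → ℕ
  | assign _ e => e.weight
  | put _ e f => e.weight ⊔ f.weight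
  | skip => 0
  | seq P R => P.weight ⊔ R.weight
  | ite e f P R => e.weight ⊔ f.weight ⊔ (P.weight ⊔ R.weight)
  | loop _ e P => e.weight ⊔ P.weight

/-- The code of a statement, which leaves the stack below the position `d` as it is. A loop keeps
the number of rounds in the position `d` and the index of the round in the position `d + 1`. -/
def code : Stmt → ℕ → Prog
  | assign x e, d => .seq (e.code d) (.seq (.const (2 * (d + 1) + 1) 0)
      (.arith .plus (2 * x.ctorIdx) (2 * d + 1) (2 * (d + 1) + 1)))
  | put a e f, d =>
      .seq (e.code d) (.seq (f.code (d + 1)) (.store a.ctorIdx (2 * d + 1) (2 * (d + 1) + 1)))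
  | skip, _ => .skip
  | seq P R, d => .seq (P.code d) (R.code d)
  | ite e f P R, d =>
      .seq (e.code d) (.seq (f.code (d + 1))
        (.ifLt (2 * d + 1) (2 * (d + 1) + 1) (P.code d) (R.code d)))
  | loop x e P, d =>
      .seq (e.code d) (.seq (.const (2 * (d + 1) + 1) 0)
        (.whileLt (2 * (d + 1) + 1) (2 * d + 1)
          (.seq (.const (2 * (d + 2) + 1) 0)
            (.seq (.arith .plus (2 * x.ctorIdx) (2 * (d + 1) + 1) (2 * (d + 2) + 1))
              (.seq (P.code (d + 2))
                (.seq (.const (2 * (d + 2) + 1) 1)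
                  (.arith .plus (2 * (d + 1) + 1) (2 * (d + 1) + 1) (2 * (d + 2) + 1))))))))

section Correctness

variable {V B : ℕ} {β : Vr → ℕ}

/-- `P` runs on the word RAM as `Stmt.run` says, within its cost. -/
def Correct (V B : ℕ) (β : Vr → ℕ) (P : Stmt) : Prop :=
  ∀ (d : ℕ) (s : State), (view s).Bounded V → P.Ok V β (view s) →
    ∃ t s', Exec B (P.code d) s t s' ∧ t ≤ P.cost β ∧ view s' = P.run (view s) ∧
      (P.run (view s)).Bounded V ∧ ∀ i < d, s'.var (2 * i + 1) = s.var (2 * i + 1)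

theorem correct_loop (hV : 2 ≤ V) (hβ : ∀ x, β x < V) {x : Vr} {e : Exp} {P : Stmt}
    (hB : V ^ (loop x e P).weight < B) (hVB : V < B) (hP : Correct V B β P) :
    Correct V B β (loop x e P) := by
  intro d s hb hok
  have hBe : V ^ e.weight < B :=
    (Nat.pow_le_pow_right (by omega) (by simp [weight])).trans_lt hB
  obtain ⟨s₁, h₁, hv₁, hk₁, hr₁⟩ := e.exec_code hV d s hb hBe
  obtain ⟨hn, hok⟩ := hok
  set n := e.eval (view s) with hndef
  set it : ℕ → Mem := fun k => Nat.rec (view s) (fun i g => P.run (g.setVar x i)) k with hit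
  have hVn : n < V := hn.trans_lt (hβ x)
  set body : Prog := .seq (.const (2 * (d + 2) + 1) 0)
    (.seq (.arith .plus (2 * x.ctorIdx) (2 * (d + 1) + 1) (2 * (d + 2) + 1))
      (.seq (P.code (d + 2))
        (.seq (.const (2 * (d + 2) + 1) 1)
          (.arith .plus (2 * (d + 1) + 1) (2 * (d + 1) + 1) (2 * (d + 2) + 1))))) with hbody
  -- `r` rounds are left when the round `i` is about to start
  have key : ∀ r i, i + r = n → ∀ s₂ : State, view s₂ = it i → (it i).Bounded V →
      s₂.var (2 * (d + 1) + 1) = i → s₂.var (2 * d + 1) = n →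
      ∃ t s', Exec B (.whileLt (2 * (d + 1) + 1) (2 * d + 1) body) s₂ t s' ∧
        t ≤ r * (P.cost β + 5) + 1 ∧ view s' = it n ∧ (it n).Bounded V ∧
        ∀ i < d, s'.var (2 * i + 1) = s₂.var (2 * i + 1) := by
    intro r
    induction r with
    | zero =>
      intro i hi s₂ hv hbd hc hn'
      obtain rfl : i = n := by omega
      exact ⟨1, s₂, Exec.whileFalse (by omega), by omega, hv, hbd, fun _ _ => rfl⟩
    | succ r ih =>
      intro i hi s₂ hv hbd hc hn'
      have hin : i < n := by omega
      set s₃ := s₂.setVar (2 * (d + 2) + 1) 0 with hs₃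
      have e₃ : Exec B _ s₂ 1 s₃ := Exec.const s₂ _ 0 (by omega)
      have hx₃ : Op.plus.eval (s₃.var (2 * (d + 1) + 1)) (s₃.var (2 * (d + 2) + 1)) = i := by
        simp [hs₃, State.setVar, Op.eval, hc]
      have e₄ := Exec.arith (B := B) s₃ .plus (2 * x.ctorIdx) (2 * (d + 1) + 1) (2 * (d + 2) + 1)
        (by omega)
      rw [hx₃] at e₄
      set s₄ := s₃.setVar (2 * x.ctorIdx) i with hs₄
      have hv₄ : view s₄ = (it i).setVar x i := by
        rw [hs₄, view_setVar, hs₃, view_setVar_odd, hv]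
      have hodd₄ : ∀ k < d + 2, s₄.var (2 * k + 1) = s₂.var (2 * k + 1) := by
        intro k hk
        simp only [hs₄, hs₃, State.setVar]
        rw [Function.update_of_ne (by omega), Function.update_of_ne (by omega)]
      obtain ⟨t₅, s₅, e₅, ht₅, hv₅, hb₅, hk₅⟩ := hP (d + 2) s₄
        (hv₄ ▸ hbd.setVar x (by omega)) (hv₄ ▸ hok i hin)
      set s₆ := s₅.setVar (2 * (d + 2) + 1) 1 with hs₆
      have e₆ : Exec B _ s₅ 1 s₆ := Exec.const s₅ _ 1 (by omega)
      have hc₅ : s₅.var (2 * (d + 1) + 1) = i := by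
        rw [hk₅ _ (by omega), hodd₄ _ (by omega), hc]
      have hn₅ : s₅.var (2 * d + 1) = n := by
        rw [hk₅ _ (by omega), hodd₄ _ (by omega), hn']
      have hx₆ : Op.plus.eval (s₆.var (2 * (d + 1) + 1)) (s₆.var (2 * (d + 2) + 1)) = i + 1 := by
        simp [hs₆, State.setVar, Op.eval, hc₅]
      have e₇ := Exec.arith (B := B) s₆ .plus (2 * (d + 1) + 1) (2 * (d + 1) + 1)
        (2 * (d + 2) + 1) (by omega)
      rw [hx₆] at e₇
      set s₇ := s₆.setVar (2 * (d + 1) + 1) (i + 1) with hs₇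
      have hv₇ : view s₇ = it (i + 1) := by
        rw [hs₇, view_setVar_odd, hs₆, view_setVar_odd, hv₅, hv₄]
      obtain ⟨t₈, s₈, e₈, ht₈, hv₈, hb₈, hk₈⟩ := ih (i + 1) (by omega) s₇ hv₇
        (by rw [hv₄] at hb₅; exact hb₅)
        (by simp [hs₇, State.setVar])
        (by simpa [hs₇, hs₆, State.setVar, Function.update_apply] using hn₅)
      refine ⟨_, s₈, Exec.whileTrue (by omega) (e₃.seq (e₄.seq (e₅.seq (e₆.seq e₇)))) e₈, ?_,
        hv₈, hb₈, ?_⟩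
      · have : (r + 1) * (P.cost β + 5) = r * (P.cost β + 5) + (P.cost β + 5) := by ring
        omega
      · intro k hk
        rw [hk₈ k hk, ← hodd₄ k (by omega), ← hk₅ k (by omega)]
        simp only [hs₇, hs₆, State.setVar]
        rw [Function.update_of_ne (by omega), Function.update_of_ne (by omega)]
  set s₂ := s₁.setVar (2 * (d + 1) + 1) 0 with hs₂
  have e₂ : Exec B _ s₁ 1 s₂ := Exec.const s₁ _ 0 (by omega)
  obtain ⟨t₃, s₃, e₃, ht₃, hv₃, hb₃, hk₃⟩ := key n 0 (by omega) s₂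
    ((view_setVar_odd _ _ _).trans hv₁) hb (by simp [hs₂, State.setVar])
    (by simpa [hs₂, State.setVar, Function.update_apply] using hr₁)
  refine ⟨_, s₃, h₁.seq (e₂.seq e₃), ?_, hv₃, hb₃, ?_⟩
  · have : n * (P.cost β + 5) ≤ β x * (P.cost β + 5) := Nat.mul_le_mul_right _ hn
    simp only [cost]
    omega
  · intro k hk
    rw [hk₃ k hk, ← hk₁ k hk]
    simp only [hs₂, State.setVar]
    rw [Function.update_of_ne (by omega)]

theorem correct (hV : 2 ≤ V) (hβ : ∀ x, β x < V) (hVB : V < B) (P : Stmt)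
    (hB : V ^ P.weight < B) : Correct V B β P := by
  induction P with
  | assign x e =>
    intro d s hb hok
    obtain ⟨s₁, h₁, hv₁, hk₁, hr₁⟩ := e.exec_code hV d s hb hB
    have hok : e.eval (view s) ≤ V := hok
    have hval : Op.plus.eval ((s₁.setVar (2 * (d + 1) + 1) 0).var (2 * d + 1))
        ((s₁.setVar (2 * (d + 1) + 1) 0).var (2 * (d + 1) + 1)) = e.eval (view s) := by
      simp [State.setVar, Op.eval, hr₁]
    have e₂ := Exec.arith (B := B) (s₁.setVar (2 * (d + 1) + 1) 0) .plus (2 * x.ctorIdx)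
      (2 * d + 1) (2 * (d + 1) + 1) (by omega)
    rw [hval] at e₂
    refine ⟨_, _, h₁.seq ((Exec.const _ _ 0 (by omega)).seq e₂), le_rfl, ?_, hb.setVar x hok, ?_⟩
    · rw [view_setVar, view_setVar_odd, hv₁]
      rfl
    · intro i hi
      simp only [State.setVar]
      rw [Function.update_of_ne (by omega), Function.update_of_ne (by omega), hk₁ i hi]
  | put a e f =>
    intro d s hb hok
    simp only [weight] at hB
    have hBe : V ^ e.weight < B := (Nat.pow_le_pow_right (by omega) (by simp)).trans_lt hB
    have hBf : V ^ f.weight < B := (Nat.pow_le_pow_right (by omega) (by simp)).trans_lt hB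
    obtain ⟨s₁, h₁, hv₁, hk₁, hr₁⟩ := e.exec_code hV d s hb hBe
    obtain ⟨s₂, h₂, hv₂, hk₂, hr₂⟩ := f.exec_code hV (d + 1) s₁ (hv₁ ▸ hb) hBf
    refine ⟨_, _, h₁.seq (h₂.seq (Exec.store _ _ _ _)), ?_, ?_, hb.setArr a _ hok, ?_⟩
    · simp only [cost]
      omega
    · rw [view_setArr, hk₂ d (by omega), hr₁, hr₂, hv₂, hv₁]
      rfl
    · intro i hi
      change s₂.var (2 * i + 1) = _
      rw [hk₂ i (by omega), hk₁ i hi]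
  | skip =>
    intro d s hb _
    exact ⟨1, s, Exec.skip s, le_rfl, rfl, hb, fun _ _ => rfl⟩
  | seq P R hP hR =>
    intro d s hb hok
    simp only [weight] at hB
    obtain ⟨t₁, s₁, h₁, ht₁, hv₁, hb₁, hk₁⟩ :=
      hP ((Nat.pow_le_pow_right (by omega) (by simp)).trans_lt hB) d s hb hok.1
    obtain ⟨t₂, s₂, h₂, ht₂, hv₂, hb₂, hk₂⟩ :=
      hR ((Nat.pow_le_pow_right (by omega) (by simp)).trans_lt hB) d s₁ (hv₁ ▸ hb₁) (hv₁ ▸ hok.2)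
    rw [hv₁] at hv₂ hb₂
    exact ⟨_, s₂, h₁.seq h₂, by simp only [cost]; omega, hv₂, hb₂,
      fun i hi => (hk₂ i hi).trans (hk₁ i hi)⟩
  | ite e f P R hP hR =>
    intro d s hb hok
    simp only [weight] at hB
    have hBe : V ^ e.weight < B := (Nat.pow_le_pow_right (by omega) (by simp)).trans_lt hB
    have hBf : V ^ f.weight < B := (Nat.pow_le_pow_right (by omega) (by simp)).trans_lt hB
    obtain ⟨s₁, h₁, hv₁, hk₁, hr₁⟩ := e.exec_code hV d s hb hBe
    obtain ⟨s₂, h₂, hv₂, hk₂, hr₂⟩ := f.exec_code hV (d + 1) s₁ (hv₁ ▸ hb) hBf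
    have hd : s₂.var (2 * d + 1) = e.eval (view s) := by rw [hk₂ d (by omega), hr₁]
    have hv : view s₂ = view s := hv₂.trans hv₁
    rw [hv₁] at hr₂
    simp only [Ok] at hok
    by_cases hlt : e.eval (view s) < f.eval (view s)
    · rw [if_pos hlt] at hok
      obtain ⟨t₃, s₃, h₃, ht₃, hv₃, hb₃, hk₃⟩ :=
        hP ((Nat.pow_le_pow_right (by omega) (by simp)).trans_lt hB) d s₂ (hv ▸ hb) (hv ▸ hok)
      refine ⟨_, s₃, h₁.seq (h₂.seq (Exec.ifTrue (by rw [hd, hr₂]; exact hlt) h₃)), ?_, ?_, ?_, ?_⟩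
      · simp only [cost]
        omega
      · rw [hv₃, hv, run, if_pos hlt]
      · rw [run, if_pos hlt, ← hv]
        exact hb₃
      · exact fun i hi => by rw [hk₃ i hi, hk₂ i (by omega), hk₁ i hi]
    · rw [if_neg hlt] at hok
      obtain ⟨t₃, s₃, h₃, ht₃, hv₃, hb₃, hk₃⟩ :=
        hR ((Nat.pow_le_pow_right (by omega) (by simp)).trans_lt hB) d s₂ (hv ▸ hb) (hv ▸ hok)
      refine ⟨_, s₃, h₁.seq (h₂.seq (Exec.ifFalse (by rw [hd, hr₂]; exact hlt) h₃)), ?_, ?_, ?_, ?_⟩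
      · simp only [cost]
        omega
      · rw [hv₃, hv, run, if_neg hlt]
      · rw [run, if_neg hlt, ← hv]
        exact hb₃
      · exact fun i hi => by rw [hk₃ i hi, hk₂ i (by omega), hk₁ i hi]
  | loop x e P hP =>
    exact correct_loop hV hβ hB hVB
      (hP ((Nat.pow_le_pow_right (by omega) (by simp [weight])).trans_lt hB))

end Correctness

/-- Whether the statement assigns to the variable `w`. -/
def writesVar (w : Vr) : Stmt → Bool
  | assign x _ => decide (w = x)
  | put _ _ _ => false
  | skip => false
  | seq P R => P.writesVar w || R.writesVar w
  | ite _ _ P R => P.writesVar w || R.writesVar w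
  | loop x _ P => decide (w = x) || P.writesVar w

/-- Whether the statement writes into the array `b`. -/
def writesArr (b : Ar) : Stmt → Bool
  | assign _ _ => false
  | put a _ _ => decide (b = a)
  | skip => false
  | seq P R => P.writesArr b || R.writesArr b
  | ite _ _ P R => P.writesArr b || R.writesArr b
  | loop _ _ P => P.writesArr b

/-- The memory `g` agrees with `h` except for what the statement `P` writes. -/
structure Frame (P : Stmt) (h g : Mem) : Prop where
  var : ∀ w, P.writesVar w = false → g.var w = h.var w
  arr : ∀ b, P.writesArr b = false → g.arr b = h.arr b

theorem Frame.refl (P : Stmt) (h : Mem) : Frame P h h := ⟨fun _ _ => rfl, fun _ _ => rfl⟩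

theorem frame_run (P : Stmt) : ∀ h, Frame P h (P.run h) := by
  induction P with
  | assign x e =>
    refine fun h => ⟨fun w hw => ?_, fun _ _ => rfl⟩
    have : w ≠ x := by simpa [writesVar] using hw
    simp [run, this]
  | put a e f =>
    refine fun h => ⟨fun _ _ => rfl, fun b hb => ?_⟩
    have : b ≠ a := by simpa [writesArr] using hb
    funext k
    simp [run, this]
  | skip => exact fun h => Frame.refl _ h
  | seq P R hP hR =>
    refine fun h => ⟨fun w hw => ?_, fun b hb => ?_⟩
    · simp only [writesVar, Bool.or_eq_false_iff] at hw
      rw [run, (hR _).var w hw.2, (hP _).var w hw.1]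
    · simp only [writesArr, Bool.or_eq_false_iff] at hb
      rw [run, (hR _).arr b hb.2, (hP _).arr b hb.1]
  | ite e f P R hP hR =>
    refine fun h => ⟨fun w hw => ?_, fun b hb => ?_⟩
    · simp only [writesVar, Bool.or_eq_false_iff] at hw
      rw [run]
      split_ifs
      · exact (hP h).var w hw.1
      · exact (hR h).var w hw.2
    · simp only [writesArr, Bool.or_eq_false_iff] at hb
      rw [run]
      split_ifs
      · exact (hP h).arr b hb.1
      · exact (hR h).arr b hb.2
  | loop x e P hP =>
    intro h
    rw [run]
    generalize e.eval h = n
    refine ⟨fun w hw => ?_, fun b hb => ?_⟩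
    · simp only [writesVar, Bool.or_eq_false_iff, decide_eq_false_iff_not] at hw
      induction n with
      | zero => rfl
      | succ n ih => simp only; rw [(hP _).var w hw.2, Mem.setVar_var, if_neg hw.1, ih]
    · simp only [writesArr] at hb
      induction n with
      | zero => rfl
      | succ n ih => simp only; rw [(hP _).arr b hb, Mem.setVar_arr, ih]

/-- Total correctness with the resource bounds of `Ok`: started in `h`, the statement `P` respects
the bounds and ends in a memory with the property `C`. -/
def Tri (V : ℕ) (β : Vr → ℕ) (P : Stmt) (h : Mem) (C : Mem → Prop) : Prop :=
  P.Ok V β h ∧ C (P.run h)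

section Tri

variable {V : ℕ} {β : Vr → ℕ} {h : Mem} {C D : Mem → Prop}

theorem tri_assign {x : Vr} {e : Exp} :
    Tri V β (assign x e) h C ↔ e.eval h ≤ V ∧ C (h.setVar x (e.eval h)) := Iff.rfl

theorem tri_put {a : Ar} {e f : Exp} :
    Tri V β (put a e f) h C ↔ f.eval h ≤ V ∧ C (h.setArr a (e.eval h) (f.eval h)) := Iff.rfl

theorem tri_skip : Tri V β skip h C ↔ C h := by simp [Tri, Ok, run]

theorem tri_seq {P R : Stmt} : Tri V β (seq P R) h C ↔ Tri V β P h fun g => Tri V β R g C :=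
  and_assoc

theorem tri_ite {e f : Exp} {P R : Stmt} : Tri V β (ite e f P R) h C ↔
    if e.eval h < f.eval h then Tri V β P h C else Tri V β R h C := by
  simp only [Tri, Ok, run]
  split_ifs <;> rfl

theorem Tri.mono {P : Stmt} (hP : Tri V β P h C) (hCD : ∀ g, Frame P h g → C g → D g) :
    Tri V β P h D :=
  ⟨hP.1, hCD _ (P.frame_run h) hP.2⟩

theorem run_bounded (hβ : ∀ x, β x ≤ V) (P : Stmt) :
    ∀ h : Mem, h.Bounded V → P.Ok V β h → (P.run h).Bounded V := by
  induction P with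
  | assign x e => exact fun h hb hok => hb.setVar x hok
  | put a e f => exact fun h hb hok => hb.setArr a _ hok
  | skip => exact fun h hb _ => hb
  | seq P R hP hR => exact fun h hb hok => hR _ (hP h hb hok.1) hok.2
  | ite e f P R hP hR =>
    intro h hb hok
    simp only [Ok, run] at hok ⊢
    split_ifs with hlt <;> simp only [hlt, if_true, if_false] at hok
    · exact hP h hb hok
    · exact hR h hb hok
  | loop x e P hP =>
    rintro h hb ⟨hn, hok⟩
    have key : ∀ k ≤ e.eval h,
        Mem.Bounded V (Nat.rec h (fun i g => P.run (g.setVar x i)) k) := by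
      intro k
      induction k with
      | zero => exact fun _ => hb
      | succ k ih =>
        intro hk
        have := hβ x
        exact hP _ ((ih (by omega)).setVar x (by omega)) (hok k (by omega))
    exact key _ le_rfl

theorem Tri.bounded {P : Stmt} (hP : Tri V β P h C) (hβ : ∀ x, β x ≤ V) (hb : h.Bounded V) :
    Tri V β P h fun g => g.Bounded V ∧ C g :=
  ⟨hP.1, P.run_bounded hβ h hb hP.1, hP.2⟩

/-- The rule for loops: `I i` holds at the start of the round `i`. -/
theorem tri_loop {x : Vr} {e : Exp} {P : Stmt} (I : ℕ → Mem → Prop) (hn : e.eval h ≤ β x)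
    (h0 : I 0 h)
    (hs : ∀ i g, i < e.eval h → Frame (loop x e P) h g → I i g →
      Tri V β P (g.setVar x i) (I (i + 1)))
    (hC : ∀ g, Frame (loop x e P) h g → I (e.eval h) g → C g) :
    Tri V β (loop x e P) h C := by
  set it : ℕ → Mem := fun k => Nat.rec h (fun i g => P.run (g.setVar x i)) k with hit
  have hfr : ∀ k, Frame (loop x e P) h (it k) := fun k => by
    have := frame_run (loop x (.lit k) P) h
    exact ⟨this.var, this.arr⟩
  have hI : ∀ k ≤ e.eval h, I k (it k) := by
    intro k
    induction k with
    | zero => exact fun _ => h0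
    | succ k ih => exact fun hk => (hs k _ (by omega) (hfr k) (ih (by omega))).2
  exact ⟨⟨hn, fun i hi => (hs i _ hi (hfr i) (hI i hi.le)).1⟩, hC _ (hfr _) (hI _ le_rfl)⟩

/-- The rule for loops, with the bound on all numbers as part of the invariant. -/
theorem tri_loop_bounded (hβ : ∀ x, β x ≤ V) (hb : h.Bounded V) {x : Vr} {e : Exp} {P : Stmt}
    (I : ℕ → Mem → Prop) (hn : e.eval h ≤ β x) (h0 : I 0 h)
    (hs : ∀ i g, i < e.eval h → Frame (loop x e P) h g → (g.setVar x i).Bounded V → I i g →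
      Tri V β P (g.setVar x i) (I (i + 1)))
    (hC : ∀ g, Frame (loop x e P) h g → g.Bounded V → I (e.eval h) g → C g) :
    Tri V β (loop x e P) h C := by
  refine tri_loop (fun i g => g.Bounded V ∧ I i g) hn ⟨hb, h0⟩ (fun i g hi hf hI => ?_)
    fun g hf hI => hC g hf hI.1 hI.2
  have hbg := hI.1.setVar x (hi.le.trans (hn.trans (hβ x)))
  exact (hs i g hi hf hbg hI.2).bounded hβ hbg

end Tri

end Stmt

/-! ### Mixed radix numbers -/

/-- The place value of the digit `j` in the mixed radix system with the radices `w`. -/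
def stride (w : ℕ → ℕ) (j : ℕ) : ℕ := ∏ i ∈ Finset.range j, w i

/-- The digit `j` of `z` in the mixed radix system with the radices `w`. -/
def digit (w : ℕ → ℕ) (j z : ℕ) : ℕ := z / stride w j % w j

/-- The number with the digits `x 0, …, x (k - 1)`. -/
def enc (w : ℕ → ℕ) (k : ℕ) (x : ℕ → ℕ) : ℕ := ∑ j ∈ Finset.range k, x j * stride w j

section MixedRadix

variable {w : ℕ → ℕ} {k : ℕ} {x : ℕ → ℕ}

theorem stride_succ (w : ℕ → ℕ) (j : ℕ) : stride w (j + 1) = stride w j * w j :=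
  Finset.prod_range_succ _ _

theorem enc_succ (w : ℕ → ℕ) (k : ℕ) (x : ℕ → ℕ) :
    enc w (k + 1) x = enc w k x + x k * stride w k :=
  Finset.sum_range_succ _ _

theorem enc_digit_mod (w : ℕ → ℕ) (k z : ℕ) :
    enc w k (fun j => digit w j z) = z % stride w k := by
  induction k with
  | zero => simp [enc, stride, Nat.mod_one]
  | succ k ih => rw [enc_succ, ih, stride_succ, Nat.mod_mul, digit, mul_comm (stride w k)]

theorem enc_digit {z : ℕ} (hz : z < stride w k) : enc w k (fun j => digit w j z) = z := by
  rw [enc_digit_mod, Nat.mod_eq_of_lt hz]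

theorem enc_congr {y : ℕ → ℕ} (h : ∀ j < k, x j = y j) : enc w k x = enc w k y :=
  Finset.sum_congr rfl fun j hj => by rw [h j (Finset.mem_range.1 hj)]

theorem enc_lt (hx : ∀ j < k, x j < w j) : enc w k x < stride w k := by
  induction k with
  | zero => simp [enc, stride]
  | succ k ih =>
    rw [enc_succ, stride_succ]
    have h1 := ih fun j hj => hx j (by omega)
    have h2 : x k + 1 ≤ w k := hx k (by omega)
    calc enc w k x + x k * stride w k < stride w k + x k * stride w k := by omega
      _ = stride w k * (x k + 1) := by ring
      _ ≤ _ := Nat.mul_le_mul_left _ h2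

theorem digit_enc (hx : ∀ j < k, x j < w j) {j : ℕ} (hj : j < k) :
    digit w j (enc w k x) = x j := by
  induction k with
  | zero => omega
  | succ k ih =>
    have hlt : enc w k x < stride w k := enc_lt fun i hi => hx i (by omega)
    rw [enc_succ]
    rcases Nat.lt_succ_iff_lt_or_eq.1 hj with h | rfl
    · have hdvd : stride w (j + 1) ∣ stride w k :=
        Finset.prod_dvd_prod_of_subset _ _ _ (Finset.range_mono h)
      obtain ⟨r, hr⟩ := hdvd
      have hpos : 0 < stride w j := by
        rw [hr, stride_succ] at hlt
        exact Nat.pos_of_ne_zero fun h0 => by simp [h0] at hlt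
      rw [← ih (fun i hi => hx i (by omega)) h, digit, digit, hr, stride_succ,
        show enc w k x + x k * (stride w j * w j * r) =
          enc w k x + stride w j * (w j * (x k * r)) by ring,
        Nat.add_mul_div_left _ _ hpos, Nat.add_mul_mod_self_left]
    · rw [digit, Nat.add_mul_div_right _ _ (by omega), Nat.div_eq_of_lt hlt, zero_add,
        Nat.mod_eq_of_lt (hx j (by omega))]

theorem digit_lt {j : ℕ} (hw : 0 < w j) (z : ℕ) : digit w j z < w j := Nat.mod_lt _ hw

theorem stride_mono (hw : ∀ j, 0 < w j) {i j : ℕ} (hij : i ≤ j) : stride w i ≤ stride w j :=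
  Finset.prod_le_prod_of_subset_of_one_le' (Finset.range_mono hij) fun i _ _ => hw i

end MixedRadix

/-! ### Schedules as vectors of numbers of jobs -/

/-- The number of jobs of the type `p` in the schedule `x`, whose entry `i * Q + p` is the number of
jobs of the type `p < Q` on the machine `i`. -/
def colsum (m Q p : ℕ) (x : ℕ → ℕ) : ℕ := ∑ i ∈ Finset.range m, x (i * Q + p)

/-- The contribution of a job of the type `p` to the coordinate `j`. The first `m` coordinates of a
schedule are the loads of the machines, the next `m` ones their numbers of jobs. -/
def contrib (m j p : ℕ) : ℕ := if j < m then p else 1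

/-- The coordinate `j` of the schedule `x`. -/
def coord (m Q j : ℕ) (x : ℕ → ℕ) : ℕ :=
  ∑ p ∈ Finset.range Q, contrib m j p * x (j % m * Q + p)

/-- The scale of the coordinate `j`, an upper bound for the contribution of one job. -/
def unit (m Q j : ℕ) : ℕ := if j < m then Q else 1

/-- The schedule `x` consists of `N p` jobs of each type `p`, and its coordinates are at most
`v`. -/
structure IsWit (m Q : ℕ) (N v x : ℕ → ℕ) : Prop where
  col : ∀ p < Q, colsum m Q p x = N p
  le : ∀ j < 2 * m, coord m Q j x ≤ v j

section Schedules

variable {m Q : ℕ} {N N' v v' x y : ℕ → ℕ}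

theorem unit_pos (hQ : 0 < Q) (j : ℕ) : 0 < unit m Q j := by
  unfold unit
  split_ifs <;> omega

theorem contrib_le_unit {j p : ℕ} (hp : p < Q) : contrib m j p ≤ unit m Q j := by
  unfold contrib unit
  split_ifs <;> omega

theorem IsWit.mono (h : IsWit m Q N v x) (hN : ∀ p < Q, N p = N' p)
    (hv : ∀ j < 2 * m, v j ≤ v' j) : IsWit m Q N' v' x :=
  ⟨fun p hp => (h.col p hp).trans (hN p hp), fun j hj => (h.le j hj).trans (hv j hj)⟩

theorem colsum_add (p : ℕ) : colsum m Q p (fun q => x q + y q) = colsum m Q p x + colsum m Q p y :=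
  Finset.sum_add_distrib

theorem coord_add (j : ℕ) : coord m Q j (fun q => x q + y q) = coord m Q j x + coord m Q j y := by
  simp only [coord, mul_add, Finset.sum_add_distrib]

theorem colsum_congr {p : ℕ} (hp : p < Q) (h : ∀ q < m * Q, x q = y q) :
    colsum m Q p x = colsum m Q p y := by
  refine Finset.sum_congr rfl fun i hi => h _ ?_
  have : i + 1 ≤ m := Finset.mem_range.1 hi
  nlinarith

theorem coord_congr {j : ℕ} (hm : 0 < m) (h : ∀ q < m * Q, x q = y q) :
    coord m Q j x = coord m Q j y := by
  refine Finset.sum_congr rfl fun p hp => ?_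
  rw [h]
  have h1 : j % m + 1 ≤ m := Nat.mod_lt _ hm
  have h2 := Finset.mem_range.1 hp
  nlinarith

theorem IsWit.congr (hm : 0 < m) (hx : IsWit m Q N v x) (h : ∀ q < m * Q, x q = y q) :
    IsWit m Q N v y :=
  ⟨fun p hp => (colsum_congr hp h).symm.trans (hx.col p hp),
    fun j hj => (coord_congr hm h).symm.trans_le (hx.le j hj)⟩

theorem IsWit.add (hx : IsWit m Q N v x) (hy : IsWit m Q N' v' y) :
    IsWit m Q (fun p => N p + N' p) (fun j => v j + v' j) (fun q => x q + y q) :=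
  ⟨fun p hp => by rw [colsum_add, hx.col p hp, hy.col p hp],
    fun j hj => by rw [coord_add]; exact add_le_add (hx.le j hj) (hy.le j hj)⟩

/-- An entry of a schedule is at most the number of jobs of its type. -/
theorem IsWit.entry_le (hx : IsWit m Q N v x) {q : ℕ} (hq : q < m * Q) : x q ≤ N (q % Q) := by
  have hQ : 0 < Q := Nat.pos_of_mul_pos_left (by omega : 0 < m * Q)
  rw [← hx.col _ (Nat.mod_lt q hQ)]
  have hi : q / Q ∈ Finset.range m :=
    Finset.mem_range.2 ((Nat.div_lt_iff_lt_mul hQ).2 hq)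
  have := Finset.single_le_sum (f := fun i => x (i * Q + q % Q)) (fun _ _ => Nat.zero_le _) hi
  rwa [show q / Q * Q + q % Q = q by rw [mul_comm]; exact Nat.div_add_mod q Q] at this

end Schedules

/-! ### Balanced splitting -/

section Splitting

/-- The elements of a set of even size can be paired up: `t i j = 1` if `(i, j)` is a pair. -/
theorem exists_pairing (m : ℕ) : ∀ (r : ℕ) (O : Finset ℕ), O.card = 2 * r →
    O ⊆ Finset.range m → ∃ t : ℕ → ℕ → ℕ, (∀ i j, t i j ≤ 1) ∧ ∀ i < m,
      ∑ j ∈ Finset.range m, t i j + ∑ j ∈ Finset.range m, t j i = if i ∈ O then 1 else 0 := by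
  intro r
  induction r with
  | zero =>
    intro O hO _
    have : O = ∅ := Finset.card_eq_zero.1 (by omega)
    exact ⟨fun _ _ => 0, by simp, by simp [this]⟩
  | succ r ih =>
    intro O hO hOm
    obtain ⟨a, ha, b, hb, hab⟩ := Finset.one_lt_card.1 (show 1 < O.card by omega)
    have hb' : b ∈ O.erase a := Finset.mem_erase.2 ⟨hab.symm, hb⟩
    obtain ⟨t, ht, hs⟩ := ih ((O.erase a).erase b)
      (by rw [Finset.card_erase_of_mem hb', Finset.card_erase_of_mem ha]; omega)
      (((Finset.erase_subset _ _).trans (Finset.erase_subset _ _)).trans hOm)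
    have ham := Finset.mem_range.1 (hOm ha)
    have hbm := Finset.mem_range.1 (hOm hb)
    refine ⟨fun i j => t i j + if i = a ∧ j = b then 1 else 0, fun i j => ?_, fun i hi => ?_⟩
    · -- the pair is new, since `t` has no pair with the element `a`
      have h1 := ht i j
      dsimp only
      split_ifs with h
      · obtain ⟨rfl, rfl⟩ := h
        have h2 := hs i ham
        have h3 : t i j ≤ ∑ j ∈ Finset.range m, t i j :=
          Finset.single_le_sum (f := fun j => t i j) (fun _ _ => Nat.zero_le _)
            (Finset.mem_range.2 hbm)
        simp at h2
        have := h2.1 j hbm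
        omega
      · omega
    · have h2 := hs i hi
      simp only [Finset.sum_add_distrib]
      have e1 : ∑ j ∈ Finset.range m, (if i = a ∧ j = b then 1 else 0) =
          if i = a then 1 else 0 := by
        by_cases h : i = a <;> simp [h, hbm]
      have e2 : ∑ j ∈ Finset.range m, (if j = a ∧ i = b then 1 else 0) =
          if i = b then 1 else 0 := by
        by_cases h : i = b <;> simp [h, ham]
      rw [e1, e2]
      by_cases hia : i = a
      · subst hia
        rw [if_neg (by simp)] at h2
        rw [if_pos ha, if_pos rfl, if_neg hab]
        omega
      · by_cases hib : i = b
        · subst hib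
          rw [if_neg (by simp)] at h2
          rw [if_pos hb, if_pos rfl, if_neg hia]
          omega
        · simpa [hia, hib] using h2

/-- The sub-family of every other one of the types `p` with `t p = 1`, starting with the first one
for `b = 0` and with the second one for `b = 1`. -/
def alternate (t : ℕ → ℕ) (b p : ℕ) : ℕ := if (∑ q ∈ Finset.range p, t q) % 2 = b then t p else 0

theorem alternate_add (t : ℕ → ℕ) (p : ℕ) : alternate t 0 p + alternate t 1 p = t p := by
  unfold alternate
  rcases Nat.mod_two_eq_zero_or_one (∑ q ∈ Finset.range p, t q) with h | h <;> simp [h]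

theorem alternate_count {t : ℕ → ℕ} (ht : ∀ p, t p ≤ 1) (n : ℕ) :
    ∑ p ∈ Finset.range n, alternate t 0 p =
      ∑ p ∈ Finset.range n, alternate t 1 p + (∑ q ∈ Finset.range n, t q) % 2 := by
  induction n with
  | zero => simp
  | succ n ih =>
    simp only [Finset.sum_range_succ]
    have h1 := ht n
    have h2 : alternate t 0 n = if (∑ q ∈ Finset.range n, t q) % 2 = 0 then t n else 0 := rfl
    have h3 : alternate t 1 n = if (∑ q ∈ Finset.range n, t q) % 2 = 1 then t n else 0 := rfl
    split_ifs at h2 h3 <;> omega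

/-- Alternating sums of increasing numbers are small. -/
theorem alternate_load {t : ℕ → ℕ} (ht : ∀ p, t p ≤ 1) (n : ℕ) :
    ((∑ q ∈ Finset.range n, t q) % 2 = 0 →
      ∑ p ∈ Finset.range n, p * alternate t 0 p ≤ ∑ p ∈ Finset.range n, p * alternate t 1 p ∧
      ∑ p ∈ Finset.range n, p * alternate t 1 p ≤ ∑ p ∈ Finset.range n, p * alternate t 0 p + n) ∧
    ((∑ q ∈ Finset.range n, t q) % 2 = 1 →
      ∑ p ∈ Finset.range n, p * alternate t 1 p ≤ ∑ p ∈ Finset.range n, p * alternate t 0 p ∧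
      ∑ p ∈ Finset.range n, p * alternate t 0 p ≤
        ∑ p ∈ Finset.range n, p * alternate t 1 p + n) := by
  induction n with
  | zero => simp
  | succ n ih =>
    simp only [Finset.sum_range_succ]
    have h2 : alternate t 0 n = if (∑ q ∈ Finset.range n, t q) % 2 = 0 then t n else 0 := rfl
    have h3 : alternate t 1 n = if (∑ q ∈ Finset.range n, t q) % 2 = 1 then t n else 0 := rfl
    have h1 : t n = 0 ∨ t n = 1 := by have := ht n; omega
    rcases h1 with h | h <;> rw [h2, h3, h] <;> split_ifs <;>
      simp only [mul_zero, mul_one] <;> omega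

theorem alternate_contrib {t : ℕ → ℕ} (ht : ∀ p, t p ≤ 1) (m Q j : ℕ) :
    ∑ p ∈ Finset.range Q, contrib m j p * alternate t 0 p ≤
        ∑ p ∈ Finset.range Q, contrib m j p * alternate t 1 p + unit m Q j ∧
      ∑ p ∈ Finset.range Q, contrib m j p * alternate t 1 p ≤
        ∑ p ∈ Finset.range Q, contrib m j p * alternate t 0 p + unit m Q j := by
  unfold contrib unit
  split_ifs
  · have := alternate_load ht Q
    rcases Nat.mod_two_eq_zero_or_one (∑ q ∈ Finset.range Q, t q) with h | h <;>
      simp [h] at this <;> omega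
  · have := alternate_count ht Q
    simp only [one_mul]
    omega

/-- A schedule with an even number of jobs of each type splits into two schedules with the same
numbers of jobs of each type and with almost the same coordinates. Machines with an odd number of
jobs of a type are paired up, and the odd jobs of each pair of machines are distributed
alternatingly, in the order of their sizes. -/
theorem exists_split {m Q : ℕ} (hQ : 0 < Q) {N x : ℕ → ℕ}
    (hx : ∀ p < Q, colsum m Q p x = 2 * N p) :
    ∃ y y' : ℕ → ℕ, (∀ q < m * Q, x q = y q + y' q) ∧ (∀ p < Q, colsum m Q p y = N p) ∧
      (∀ p < Q, colsum m Q p y' = N p) ∧ ∀ j < 2 * m,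
        coord m Q j y ≤ coord m Q j y' + 2 * m * unit m Q j ∧
        coord m Q j y' ≤ coord m Q j y + 2 * m * unit m Q j := by
  have hpair : ∀ p, ∃ t : ℕ → ℕ → ℕ, (∀ i j, t i j ≤ 1) ∧ (p < Q → ∀ i < m,
      ∑ j ∈ Finset.range m, t i j + ∑ j ∈ Finset.range m, t j i = x (i * Q + p) % 2) := by
    intro p
    by_cases hp : p < Q
    · have hcard : ((Finset.range m).filter fun i => x (i * Q + p) % 2 = 1).card =
          ∑ i ∈ Finset.range m, x (i * Q + p) % 2 := by
        rw [Finset.card_filter]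
        refine Finset.sum_congr rfl fun i _ => ?_
        split_ifs <;> omega
      have heven : (∑ i ∈ Finset.range m, x (i * Q + p) % 2) % 2 = 0 := by
        rw [← Finset.sum_nat_mod]
        have := hx p hp
        rw [colsum] at this
        omega
      obtain ⟨t, ht, hs⟩ := exists_pairing m _
        ((Finset.range m).filter fun i => x (i * Q + p) % 2 = 1)
        (by rw [hcard]; exact (Nat.mul_div_cancel' (Nat.dvd_of_mod_eq_zero heven)).symm)
        (Finset.filter_subset _ _)
      refine ⟨t, ht, fun _ i hi => (hs i hi).trans ?_⟩
      simp only [Finset.mem_filter, Finset.mem_range, hi, true_and]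
      split_ifs <;> omega
    · exact ⟨fun _ _ => 0, by simp, fun h => absurd h hp⟩
  choose t ht hs using hpair
  set T : ℕ → ℕ → ℕ → ℕ → ℕ := fun b i j p => alternate (fun p => t p i j) b p with hT
  have hTadd : ∀ i j p, T 0 i j p + T 1 i j p = t p i j := fun i j p => alternate_add _ p
  -- The machine `i` gets half of its jobs of the type `p`, and from each of its pairs the types of
  -- one alternation: `b` from pairs `(i, j)`, `b'` from pairs `(j, i)`. The two halves of the
  -- schedule are `Y 0 1` and `Y 1 0`.
  set Y : ℕ → ℕ → ℕ → ℕ → ℕ := fun b b' i p => x (i * Q + p) / 2 +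
    (∑ j ∈ Finset.range m, T b i j p + ∑ j ∈ Finset.range m, T b' j i p) with hY
  have hdiv : ∀ i p, p < Q → (i * Q + p) / Q = i := fun i p hp => by
    rw [mul_comm, Nat.mul_add_div hQ, Nat.div_eq_of_lt hp, add_zero]
  have hmod : ∀ i p, p < Q → (i * Q + p) % Q = p := fun i p hp => by
    rw [mul_comm, Nat.mul_add_mod, Nat.mod_eq_of_lt hp]
  have hYadd : ∀ i < m, ∀ p < Q, Y 0 1 i p + Y 1 0 i p = x (i * Q + p) := by
    intro i hi p hp
    have h1 := hs p hp i hi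
    simp only [← hTadd, Finset.sum_add_distrib] at h1
    simp only [hY]
    omega
  have hcol : ∀ p, ∑ i ∈ Finset.range m, Y 0 1 i p = ∑ i ∈ Finset.range m, Y 1 0 i p := by
    intro p
    simp only [hY, Finset.sum_add_distrib]
    rw [Finset.sum_comm (f := fun i j => T 1 j i p), Finset.sum_comm (f := fun i j => T 0 j i p)]
    ring
  have hsum : ∀ p < Q, ∑ i ∈ Finset.range m, Y 0 1 i p + ∑ i ∈ Finset.range m, Y 1 0 i p =
      2 * N p := by
    intro p hp
    rw [← hx p hp, colsum, ← Finset.sum_add_distrib]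
    exact Finset.sum_congr rfl fun i hi => hYadd i (Finset.mem_range.1 hi) p hp
  have hcolY : ∀ b b' p, p < Q → colsum m Q p (fun q => Y b b' (q / Q) (q % Q)) =
      ∑ i ∈ Finset.range m, Y b b' i p := by
    intro b b' p hp
    simp only [colsum, hdiv _ p hp, hmod _ p hp]
  have hcoordY : ∀ b b' j, coord m Q j (fun q => Y b b' (q / Q) (q % Q)) =
      ∑ p ∈ Finset.range Q, contrib m j p * (x (j % m * Q + p) / 2) +
        (∑ i ∈ Finset.range m, ∑ p ∈ Finset.range Q, contrib m j p * T b (j % m) i p +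
          ∑ i ∈ Finset.range m, ∑ p ∈ Finset.range Q, contrib m j p * T b' i (j % m) p) := by
    intro b b' j
    rw [Finset.sum_comm, Finset.sum_comm (s := Finset.range m) (t := Finset.range Q)
      (f := fun i p => contrib m j p * T b' i (j % m) p), ← Finset.sum_add_distrib,
      ← Finset.sum_add_distrib]
    refine Finset.sum_congr rfl fun p hp => ?_
    have hp := Finset.mem_range.1 hp
    simp only [hdiv _ p hp, hmod _ p hp, hY, mul_add, Finset.mul_sum]
  have hbal : ∀ j i i', ∑ p ∈ Finset.range Q, contrib m j p * T 0 i i' p ≤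
        ∑ p ∈ Finset.range Q, contrib m j p * T 1 i i' p + unit m Q j ∧
      ∑ p ∈ Finset.range Q, contrib m j p * T 1 i i' p ≤
        ∑ p ∈ Finset.range Q, contrib m j p * T 0 i i' p + unit m Q j :=
    fun j i i' => alternate_contrib (fun p => ht p i i') m Q j
  have hle : ∀ (f g : ℕ → ℕ) (d : ℕ), (∀ i, f i ≤ g i + d) →
      ∑ i ∈ Finset.range m, f i ≤ ∑ i ∈ Finset.range m, g i + m * d := by
    intro f g d hfg
    refine (Finset.sum_le_sum fun i _ => hfg i).trans_eq ?_
    simp [Finset.sum_add_distrib]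
  refine ⟨fun q => Y 0 1 (q / Q) (q % Q), fun q => Y 1 0 (q / Q) (q % Q), fun q hq => ?_,
    fun p hp => ?_, fun p hp => ?_, fun j _ => ⟨?_, ?_⟩⟩
  · rw [hYadd _ ((Nat.div_lt_iff_lt_mul hQ).2 hq) _ (Nat.mod_lt q hQ), mul_comm, Nat.div_add_mod]
  · rw [hcolY _ _ p hp]
    have h1 := hsum p hp
    have h2 := hcol p
    omega
  · rw [hcolY _ _ p hp]
    have h1 := hsum p hp
    have h2 := hcol p
    omega
  · rw [hcoordY, hcoordY]
    have h1 := hle _ _ _ fun i => (hbal j (j % m) i).1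
    have h2 := hle _ _ _ fun i => (hbal j i (j % m)).2
    have h3 : 2 * m * unit m Q j = m * unit m Q j + m * unit m Q j := by ring
    omega
  · rw [hcoordY, hcoordY]
    have h1 := hle _ _ _ fun i => (hbal j (j % m) i).2
    have h2 := hle _ _ _ fun i => (hbal j i (j % m)).1
    have h3 : 2 * m * unit m Q j = m * unit m Q j + m * unit m Q j := by ring
    omega

/-- A schedule of doubled jobs with coordinates at most `v` splits into two halves whose bounds add
up to `v` and almost agree. -/
theorem IsWit.exists_half {m Q : ℕ} (hm : 0 < m) (hQ : 0 < Q) {N v x : ℕ → ℕ}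
    (hx : IsWit m Q (fun p => 2 * N p) v x) :
    ∃ a b y y' : ℕ → ℕ, IsWit m Q N a y ∧ IsWit m Q N b y' ∧ ∀ j < 2 * m, a j + b j = v j ∧
      a j ≤ b j + (2 * m + 1) * unit m Q j ∧ b j ≤ a j + (2 * m + 1) * unit m Q j := by
  obtain ⟨y, y', hsum, hy, hy', hbal⟩ := exists_split hQ hx.col
  -- the slack `v j - coord m Q j x` is split evenly, too
  refine ⟨fun j => coord m Q j y + (v j - coord m Q j x) / 2,
    fun j => coord m Q j y' + (v j - coord m Q j x + 1) / 2, y, y',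
    ⟨hy, fun j _ => Nat.le_add_right _ _⟩, ⟨hy', fun j _ => Nat.le_add_right _ _⟩,
    fun j hj => ?_⟩
  have h1 : coord m Q j x = coord m Q j y + coord m Q j y' := by
    rw [← coord_add]
    exact coord_congr hm hsum
  have h2 := hx.le j hj
  have h3 := hbal j hj
  have h4 := unit_pos (m := m) hQ j
  have h5 : (2 * m + 1) * unit m Q j = 2 * m * unit m Q j + unit m Q j := by ring
  dsimp only
  omega

end Splitting

/-! ### Tables of schedules -/

/-- The number of values of the coordinate `j` in the window of a table. -/
def width (m Q j : ℕ) : ℕ := (4 * m + 6) * (Q * unit m Q j)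

/-- A bound on the number of differences of the coordinate `j` that occur in balanced splittings. -/
def dwidth (m Q j : ℕ) : ℕ := (4 * m + 3) * unit m Q j

/-- The first value of the coordinate `j` in the window around the value `c`. -/
def windowBase (m Q : ℕ) (c : ℕ → ℕ) (j : ℕ) : ℕ := c j - (2 * m + 3) * (Q * unit m Q j)

/-- The number of cells of a table. A cell is a vector of coordinates in the window, encoded in the
mixed radix system with the radices `width`. -/
def tableSize (m Q : ℕ) : ℕ := stride (width m Q) (2 * m)

/-- The number of vectors of differences, encoded in the mixed radix system `dwidth`. -/
def diffSize (m Q : ℕ) : ℕ := stride (dwidth m Q) (2 * m)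

/-- The coordinates of the cell `z` of a table whose window starts at `base`. -/
def point (m Q : ℕ) (base : ℕ → ℕ) (z j : ℕ) : ℕ := base j + digit (width m Q) j z

/-- The row `z` of the array `X`, which holds the schedule of the cell `z`. -/
def rowOf (m Q : ℕ) (X : ℕ → ℕ) (z q : ℕ) : ℕ := X (z * (m * Q) + q)

/-- The cells that are flagged in `F` hold schedules of the jobs `N` in the rows of `X`. -/
def Sound (m Q : ℕ) (N base F X : ℕ → ℕ) : Prop :=
  ∀ z < tableSize m Q, F z ≠ 0 → IsWit m Q N (point m Q base z) (rowOf m Q X z)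

/-- If the coordinates of a cell are at distance at most `(2 * m + 2) * Q` from `c`, and at most `e`
more below `c`, both in units of the coordinate, and there is a schedule of the jobs `N` for the
cell, then the cell is flagged in `F`. -/
def Complete (m Q : ℕ) (N base c : ℕ → ℕ) (e : ℕ) (F : ℕ → ℕ) : Prop :=
  ∀ z < tableSize m Q, (∀ j < 2 * m,
      c j ≤ point m Q base z j + ((2 * m + 2) * (Q * unit m Q j) + e * unit m Q j) ∧
      point m Q base z j ≤ c j + (2 * m + 2) * (Q * unit m Q j)) →
    (∃ x, IsWit m Q N (point m Q base z) x) → F z ≠ 0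

section Tables

variable {m Q : ℕ}

theorem width_pos (hQ : 0 < Q) (j : ℕ) : 0 < width m Q j :=
  Nat.mul_pos (by omega) (Nat.mul_pos hQ (unit_pos hQ j))

theorem dwidth_pos (hQ : 0 < Q) (j : ℕ) : 0 < dwidth m Q j :=
  Nat.mul_pos (by omega) (unit_pos hQ j)

theorem unit_le_mul (hQ : 0 < Q) (j : ℕ) : unit m Q j ≤ Q * unit m Q j :=
  Nat.le_mul_of_pos_left _ hQ

/-- Points that are near enough to `c` lie in the window. -/
theorem exists_cell {c v : ℕ → ℕ}
    (hQ : 0 < Q)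
    (hv : ∀ j < 2 * m, windowBase m Q c j ≤ v j ∧ v j ≤ c j + (2 * m + 2) * (Q * unit m Q j)) :
    ∃ z < tableSize m Q, z = enc (width m Q) (2 * m) (fun j => v j - windowBase m Q c j) ∧
      ∀ j < 2 * m, point m Q (windowBase m Q c) z j = v j := by
  have hlt : ∀ j < 2 * m, v j - windowBase m Q c j < width m Q j := by
    intro j hj
    have h1 := hv j hj
    have h2 := unit_pos (m := m) hQ j
    have h3 := unit_le_mul (m := m) hQ j
    unfold windowBase width at *
    have e1 : (2 * m + 3) * (Q * unit m Q j) =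
        (2 * m + 2) * (Q * unit m Q j) + Q * unit m Q j := by ring
    have e2 : (4 * m + 6) * (Q * unit m Q j) =
        2 * ((2 * m + 2) * (Q * unit m Q j)) + 2 * (Q * unit m Q j) := by ring
    omega
  refine ⟨_, enc_lt hlt, rfl, fun j hj => ?_⟩
  rw [point, digit_enc hlt hj]
  exact Nat.add_sub_cancel' (hv j hj).1

/-! ### Doubling -/

/-- In the doubling step, the cell `z` is combined with the cell at the difference `d`. This is the
coordinate `j` of the latter. -/
def pairDigit (m Q z d j : ℕ) : ℕ :=
  digit (width m Q) j z + digit (dwidth m Q) j d - (2 * m + 1) * unit m Q j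

/-- The coordinate `j` of the sum of the two cells. -/
def sumDigit (m Q : ℕ) (obase base : ℕ → ℕ) (z d j : ℕ) : ℕ :=
  2 * obase j + digit (width m Q) j z + pairDigit m Q z d j - base j

/-- The coordinate `j` of the second cell and of the sum lie in the windows. -/
def PairValid (m Q : ℕ) (obase base : ℕ → ℕ) (z d j : ℕ) : Prop :=
  (2 * m + 1) * unit m Q j ≤ digit (width m Q) j z + digit (dwidth m Q) j d ∧
  pairDigit m Q z d j < width m Q j ∧
  base j ≤ 2 * obase j + digit (width m Q) j z + pairDigit m Q z d j ∧
  sumDigit m Q obase base z d j < width m Q j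

theorem point_sum {obase base : ℕ → ℕ} {z d : ℕ}
    (h : ∀ j < 2 * m, PairValid m Q obase base z d j) {j : ℕ} (hj : j < 2 * m) :
    point m Q base (enc (width m Q) (2 * m) (sumDigit m Q obase base z d)) j =
      point m Q obase z j +
        point m Q obase (enc (width m Q) (2 * m) (pairDigit m Q z d)) j := by
  rw [point, point, point, digit_enc (fun j hj => (h j hj).2.2.2) hj,
    digit_enc (fun j hj => (h j hj).2.1) hj]
  have := (h j hj).2.2.1
  unfold sumDigit
  omega

/-- The doubling step finds every schedule near the centre `c'` if the given table has all schedules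
near the centre `c' / 2`. -/
theorem exists_pair (hm : 0 < m) (hQ : 0 < Q) {N c c' F : ℕ → ℕ} (hc : ∀ j < 2 * m, c' j / 2 = c j)
    (hF : Complete m Q N (windowBase m Q c) c 0 F) {z : ℕ} (hz : z < tableSize m Q)
    (hnear : ∀ j < 2 * m, c' j ≤ point m Q (windowBase m Q c') z j +
        ((2 * m + 2) * (Q * unit m Q j) + Q * unit m Q j) ∧
      point m Q (windowBase m Q c') z j ≤ c' j + (2 * m + 2) * (Q * unit m Q j))
    (hx : ∃ x, IsWit m Q (fun p => 2 * N p) (point m Q (windowBase m Q c') z) x) :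
    ∃ z' < tableSize m Q, ∃ d < diffSize m Q,
      (∀ j < 2 * m, PairValid m Q (windowBase m Q c) (windowBase m Q c') z' d j) ∧ F z' ≠ 0 ∧
      F (enc (width m Q) (2 * m) (pairDigit m Q z' d)) ≠ 0 ∧
      enc (width m Q) (2 * m)
        (sumDigit m Q (windowBase m Q c) (windowBase m Q c') z' d) = z := by
  obtain ⟨x, hx⟩ := hx
  obtain ⟨a, b, y, y', hy, hy', hab⟩ := hx.exists_half hm hQ
  -- both halves are near the centre `c`
  have hnear' : ∀ j < 2 * m, (c j ≤ a j + (2 * m + 2) * (Q * unit m Q j) ∧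
      a j ≤ c j + (2 * m + 2) * (Q * unit m Q j)) ∧
      (c j ≤ b j + (2 * m + 2) * (Q * unit m Q j) ∧
      b j ≤ c j + (2 * m + 2) * (Q * unit m Q j)) := by
    intro j hj
    have h1 := hab j hj
    have h2 := hnear j hj
    have h3 := hc j hj
    have h4 := unit_pos (m := m) hQ j
    have h5 := unit_le_mul (m := m) hQ j
    have h6 : (2 * m + 1) * unit m Q j ≤ (2 * m + 1) * (Q * unit m Q j) :=
      Nat.mul_le_mul_left _ h5
    have h7 : (2 * m + 2) * (Q * unit m Q j) = (2 * m + 1) * (Q * unit m Q j) + Q * unit m Q j := by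
      ring
    omega
  have hlow : ∀ j, windowBase m Q c j + (2 * m + 2) * (Q * unit m Q j) ≤
      c j ∨ windowBase m Q c j = 0 := by
    intro j
    unfold windowBase
    have h7 : (2 * m + 3) * (Q * unit m Q j) = (2 * m + 2) * (Q * unit m Q j) + Q * unit m Q j := by
      ring
    omega
  obtain ⟨za, hza, hza', hpa⟩ := exists_cell (c := c) (v := a) hQ fun j hj => by
    have h1 := hnear' j hj
    have h2 := hlow j
    omega
  obtain ⟨zb, hzb, hzb', hpb⟩ := exists_cell (c := c) (v := b) hQ fun j hj => by
    have h1 := hnear' j hj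
    have h2 := hlow j
    omega
  have hdlt : ∀ j < 2 * m, b j + (2 * m + 1) * unit m Q j - a j < dwidth m Q j := by
    intro j hj
    have h1 := hab j hj
    have h4 := unit_pos (m := m) hQ j
    have h5 : dwidth m Q j = 2 * ((2 * m + 1) * unit m Q j) + unit m Q j := by
      unfold dwidth
      ring
    omega
  set d := enc (dwidth m Q) (2 * m) (fun j => b j + (2 * m + 1) * unit m Q j - a j) with hd
  have hdig : ∀ j < 2 * m, digit (dwidth m Q) j d = b j + (2 * m + 1) * unit m Q j - a j :=
    fun j hj => digit_enc hdlt hj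
  have hpair : ∀ j < 2 * m, pairDigit m Q za d j = digit (width m Q) j zb ∧
      (2 * m + 1) * unit m Q j ≤ digit (width m Q) j za + digit (dwidth m Q) j d := by
    intro j hj
    have h1 := hab j hj
    have h2 := hpa j hj
    have h3 := hpb j hj
    have h4 := hdig j hj
    unfold point at h2 h3
    unfold pairDigit
    omega
  have hsum : ∀ j < 2 * m, sumDigit m Q (windowBase m Q c) (windowBase m Q c') za d j =
        digit (width m Q) j z ∧
      windowBase m Q c' j ≤
        2 * windowBase m Q c j + digit (width m Q) j za + pairDigit m Q za d j := by
    intro j hj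
    have h1 := (hab j hj).1
    have h2 := hpa j hj
    have h3 := hpb j hj
    have h4 := (hpair j hj).1
    unfold sumDigit
    unfold point at h1 h2 h3
    omega
  refine ⟨za, hza, d, enc_lt hdlt, fun j hj => ⟨(hpair j hj).2, ?_, (hsum j hj).2, ?_⟩, ?_, ?_, ?_⟩
  · rw [(hpair j hj).1]
    exact digit_lt (width_pos hQ j) _
  · rw [(hsum j hj).1]
    exact digit_lt (width_pos hQ j) _
  · refine hF za hza (fun j hj => ?_) ⟨y, hy.mono (fun _ _ => rfl) fun j hj => (hpa j hj).ge⟩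
    rw [hpa j hj, zero_mul, add_zero]
    exact (hnear' j hj).1
  · rw [enc_congr fun j hj => (hpair j hj).1, enc_digit hzb]
    refine hF zb hzb (fun j hj => ?_) ⟨y', hy'.mono (fun _ _ => rfl) fun j hj => (hpb j hj).ge⟩
    rw [hpb j hj, zero_mul, add_zero]
    exact (hnear' j hj).2
  · rw [enc_congr fun j hj => (hsum j hj).1, enc_digit hz]

/-! ### Adding a job -/

/-- The type `p` job on the machine `i`, as a vector of numbers of jobs. -/
def single (Q i p q : ℕ) : ℕ := if q = i * Q + p then 1 else 0

/-- The multiset of jobs `N` with one more job of the type `p`. -/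
def addJob (N : ℕ → ℕ) (p p' : ℕ) : ℕ := N p' + if p' = p then 1 else 0

theorem mul_add_inj {i i' p p' : ℕ} (hp : p < Q) (hp' : p' < Q) :
    i * Q + p = i' * Q + p' ↔ i = i' ∧ p = p' := by
  refine ⟨fun h => ?_, fun h => by rw [h.1, h.2]⟩
  have h1 : i = i' := by
    have := congrArg (· / Q) h
    simpa [Nat.mul_add_div (show 0 < Q by omega), mul_comm _ Q, Nat.div_eq_of_lt hp,
      Nat.div_eq_of_lt hp'] using this
  subst h1
  exact ⟨rfl, by omega⟩

theorem colsum_single {i p p' : ℕ} (hi : i < m) (hp : p < Q) (hp' : p' < Q) :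
    colsum m Q p' (single Q i p) = if p' = p then 1 else 0 := by
  simp only [colsum, single, mul_add_inj hp' hp]
  by_cases h : p' = p <;> simp [h, hi]

/-- The increase of the coordinate `j` by a job of the type `p` on the machine `i`. -/
def jobStep (m i p j : ℕ) : ℕ := if j % m = i then contrib m j p else 0

theorem coord_single {i p j : ℕ} (hp : p < Q) : coord m Q j (single Q i p) = jobStep m i p j := by
  simp only [coord, single, jobStep]
  rw [Finset.sum_congr rfl (g := fun p' => if p' = p then
    (if j % m = i then contrib m j p else 0) else 0)]
  · simp [hp]
  · intro p' hp'
    simp only [mul_add_inj (Finset.mem_range.1 hp') hp]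
    by_cases h : p' = p <;> by_cases h' : j % m = i <;> simp [h, h']

/-- The cell for the cell `z` with a job of the type `p` added on the machine `i`. -/
def addCell (m Q i p z : ℕ) : ℕ := z + p * stride (width m Q) i + stride (width m Q) (m + i)

theorem enc_jobStep {i : ℕ} (hi : i < m) (p : ℕ) (w : ℕ → ℕ) :
    enc w (2 * m) (jobStep m i p) = p * stride w i + stride w (m + i) := by
  have h1 : ∀ j < m, jobStep m i p j = if j = i then p else 0 := fun j hj => by
    simp [jobStep, contrib, hj, Nat.mod_eq_of_lt hj]
  have h2 : ∀ j < m, jobStep m i p (m + j) = if j = i then 1 else 0 := fun j hj => by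
    simp [jobStep, contrib, Nat.mod_eq_of_lt hj]
  rw [enc, two_mul, Finset.sum_range_add]
  congr 1
  · rw [Finset.sum_congr rfl fun j hj => by rw [h1 j (Finset.mem_range.1 hj)]]
    simp [hi]
  · rw [Finset.sum_congr rfl fun j hj => by rw [h2 j (Finset.mem_range.1 hj)]]
    simp [hi]

/-- The cell `z` stays in the window when a job of the type `p` is added on the machine `i`. -/
def AddValid (m Q i p z : ℕ) : Prop :=
  digit (width m Q) i z + p < width m Q i ∧ digit (width m Q) (m + i) z + 1 < width m Q (m + i)

theorem AddValid.lt {i p z : ℕ} (hi : i < m) (hQ : 0 < Q) (h : AddValid m Q i p z) :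
    ∀ j < 2 * m, digit (width m Q) j z + jobStep m i p j < width m Q j := by
  intro j hj
  unfold jobStep
  split_ifs with hji
  · rcases lt_or_ge j m with hjm | hjm
    · rw [Nat.mod_eq_of_lt hjm] at hji
      subst hji
      simpa [contrib, hjm] using h.1
    · have : j = m + i := by
        rw [Nat.mod_eq_sub_mod hjm, Nat.mod_eq_of_lt (by omega)] at hji
        omega
      subst this
      simpa [contrib] using h.2
  · exact digit_lt (width_pos hQ j) z

theorem addCell_eq {i p z : ℕ} (hi : i < m) (hz : z < tableSize m Q) :
    addCell m Q i p z =
      enc (width m Q) (2 * m) (fun j => digit (width m Q) j z + jobStep m i p j) := by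
  conv_lhs => rw [addCell, ← enc_digit hz, add_assoc, ← enc_jobStep hi]
  simp only [enc, add_mul, Finset.sum_add_distrib]

theorem addCell_lt {i p z : ℕ} (hi : i < m) (hQ : 0 < Q) (hz : z < tableSize m Q)
    (h : AddValid m Q i p z) : addCell m Q i p z < tableSize m Q := by
  rw [addCell_eq hi hz]
  exact enc_lt (h.lt hi hQ)

theorem IsWit.addJob {base N x : ℕ → ℕ} {i p z : ℕ} (hi : i < m) (hp : p < Q)
    (hz : z < tableSize m Q) (h : AddValid m Q i p z) (hx : IsWit m Q N (point m Q base z) x) :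
    IsWit m Q (addJob N p) (point m Q base (addCell m Q i p z))
      (fun q => x q + single Q i p q) := by
  have hQ : 0 < Q := by omega
  refine ⟨fun p' hp' => ?_, fun j hj => ?_⟩
  · rw [colsum_add, hx.col p' hp', colsum_single hi hp hp', CapScheduling.addJob]
  · rw [coord_add, coord_single hp, point, addCell_eq hi hz, digit_enc (h.lt hi hQ) hj,
      ← add_assoc]
    exact Nat.add_le_add_right (hx.le j hj) _

/-- The cells that become feasible by adding a job of the type `p` arise by adding the job to a
feasible cell. -/
theorem exists_add (hQ : 0 < Q) {N c F : ℕ → ℕ} {p e : ℕ} (hp : p < Q) (he : e + 1 ≤ Q)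
    (hF : Complete m Q N (windowBase m Q c) c (e + 1) F) {z : ℕ} (hz : z < tableSize m Q)
    (hnear : ∀ j < 2 * m, c j ≤ point m Q (windowBase m Q c) z j +
        ((2 * m + 2) * (Q * unit m Q j) + e * unit m Q j) ∧
      point m Q (windowBase m Q c) z j ≤ c j + (2 * m + 2) * (Q * unit m Q j))
    (hx : ∃ x, IsWit m Q (addJob N p) (point m Q (windowBase m Q c) z) x) :
    ∃ z' < tableSize m Q, ∃ i < m, AddValid m Q i p z' ∧ F z' ≠ 0 ∧ addCell m Q i p z' = z := by
  obtain ⟨x, hx⟩ := hx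
  -- some machine has a job of the type `p`
  obtain ⟨i, hi, hpos⟩ : ∃ i < m, 0 < x (i * Q + p) := by
    by_contra! hcon
    have := hx.col p hp
    rw [colsum, Finset.sum_eq_zero fun i hi => Nat.le_zero.1 (hcon i (Finset.mem_range.1 hi)),
      addJob, if_pos rfl] at this
    omega
  have hxs : ∀ q, x q = (x q - single Q i p q) + single Q i p q := by
    intro q
    unfold single
    split_ifs with h
    · rw [h]
      omega
    · rfl
  have hcoord : ∀ j, coord m Q j x =
      coord m Q j (fun q => x q - single Q i p q) + jobStep m i p j := by
    intro j
    rw [← coord_single hp, ← coord_add]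
    exact congrArg _ (funext hxs)
  have hcol : ∀ p' < Q, colsum m Q p' (fun q => x q - single Q i p q) = N p' := by
    intro p' hp'
    have h1 : colsum m Q p' x = colsum m Q p' (fun q => x q - single Q i p q) +
        colsum m Q p' (single Q i p) := by
      rw [← colsum_add]
      exact congrArg _ (funext hxs)
    rw [hx.col p' hp', colsum_single hi hp hp', addJob] at h1
    omega
  have hstep : ∀ j, jobStep m i p j ≤ unit m Q j := by
    intro j
    unfold jobStep
    split_ifs
    · exact contrib_le_unit hp
    · exact Nat.zero_le _
  -- the coordinates leave room for removing the job
  have hroom : ∀ j < 2 * m, jobStep m i p j ≤ digit (width m Q) j z := by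
    intro j hj
    have h1 := hnear j hj
    have h2 := hx.le j hj
    rw [hcoord] at h2
    have h3 := hstep j
    have h4 : (2 * m + 3) * (Q * unit m Q j) = (2 * m + 2) * (Q * unit m Q j) + Q * unit m Q j := by
      ring
    have h5 : (e + 1) * unit m Q j ≤ Q * unit m Q j := Nat.mul_le_mul_right _ he
    have h6 : (e + 1) * unit m Q j = e * unit m Q j + unit m Q j := by ring
    have h7 : windowBase m Q c j = c j - (2 * m + 3) * (Q * unit m Q j) := rfl
    unfold point at h1 h2
    omega
  have hlt : ∀ j < 2 * m, digit (width m Q) j z - jobStep m i p j < width m Q j := fun j _ =>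
    (Nat.sub_le _ _).trans_lt (digit_lt (width_pos hQ j) z)
  set z' := enc (width m Q) (2 * m) (fun j => digit (width m Q) j z - jobStep m i p j) with hz'
  have hz'lt : z' < tableSize m Q := enc_lt hlt
  have hdig : ∀ j < 2 * m, digit (width m Q) j z' + jobStep m i p j = digit (width m Q) j z := by
    intro j hj
    rw [hz', digit_enc hlt hj]
    exact Nat.sub_add_cancel (hroom j hj)
  refine ⟨z', hz'lt, i, hi, ⟨?_, ?_⟩, ?_, ?_⟩
  · have h1 := hdig i (by omega)
    rw [show jobStep m i p i = p by simp [jobStep, contrib, hi, Nat.mod_eq_of_lt hi]] at h1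
    rw [h1]
    exact digit_lt (width_pos hQ i) z
  · have h1 := hdig (m + i) (by omega)
    rw [show jobStep m i p (m + i) = 1 by simp [jobStep, contrib, Nat.mod_eq_of_lt hi]] at h1
    rw [h1]
    exact digit_lt (width_pos hQ _) z
  · refine hF z' hz'lt (fun j hj => ?_) ⟨_, hcol, fun j hj => ?_⟩
    · have h1 := hnear j hj
      have h2 := hdig j hj
      have h3 := hstep j
      have h6 : (e + 1) * unit m Q j = e * unit m Q j + unit m Q j := by ring
      unfold point at h1 ⊢
      omega
    · have h1 := hx.le j hj
      rw [hcoord] at h1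
      have h2 := hdig j hj
      unfold point at h1 ⊢
      omega
  · rw [addCell_eq hi hz'lt, enc_congr hdig, enc_digit hz]

end Tables

open Stmt Exp

/-! ### The parameters of the tables in memory -/

/-- The width of the coordinate `c`. -/
def eWidth (m : ℕ) (c : Exp) : Exp := lit (4 * m + 6) * (var .types * get .unit c)

/-- The coordinate `c` of the cell `z`, relative to the window. -/
def eDigit (m : ℕ) (c z : Exp) : Exp := z / get .str c % eWidth m c

/-- The coordinate `c` of the vector of differences `d`. -/
def eDiff (m : ℕ) (c d : Exp) : Exp := d / get .dstr c % (lit (4 * m + 3) * get .unit c)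

/-- The memory holds the parameters of the tables. -/
structure Env (m Q : ℕ) (h : Mem) : Prop where
  types : h.var .types = Q
  row : h.var .row = m * Q
  size : h.var .size = tableSize m Q
  dsize : h.var .dsize = diffSize m Q
  unit : ∀ j < 2 * m, h.arr .unit j = unit m Q j
  str : ∀ j < 2 * m, h.arr .str j = stride (width m Q) j
  dstr : ∀ j < 2 * m, h.arr .dstr j = stride (dwidth m Q) j

/-- The loop bounds and the largest allowed number suit the tables. -/
structure Fits (V : ℕ) (β : Vr → ℕ) (m Q : ℕ) : Prop where
  zz : tableSize m Q ≤ β .zz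
  dd : diffSize m Q ≤ β .dd
  cc : 2 * m ≤ β .cc
  ii : m ≤ β .ii
  qq : m * Q ≤ β .qq
  pp : Q ≤ β .pp
  le : ∀ x, β x ≤ V
  one : 1 ≤ V
  size : tableSize m Q ≤ V

/-- The statement leaves the parameters of the tables alone. -/
def KeepsEnv (P : Stmt) : Prop :=
  (P.writesVar .types || P.writesVar .row || P.writesVar .size || P.writesVar .dsize ||
    P.writesArr .unit || P.writesArr .str || P.writesArr .dstr) = false

section Env

variable {m Q : ℕ} {h g : Mem}

theorem Env.frame {P : Stmt} (hE : Env m Q h) (hf : Frame P h g) (hP : KeepsEnv P) : Env m Q g := by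
  simp only [KeepsEnv, Bool.or_eq_false_iff] at hP
  obtain ⟨⟨⟨⟨⟨⟨h1, h2⟩, h3⟩, h4⟩, h5⟩, h6⟩, h7⟩ := hP
  constructor
  · rw [hf.var _ h1, hE.types]
  · rw [hf.var _ h2, hE.row]
  · rw [hf.var _ h3, hE.size]
  · rw [hf.var _ h4, hE.dsize]
  · rw [hf.arr _ h5]; exact hE.unit
  · rw [hf.arr _ h6]; exact hE.str
  · rw [hf.arr _ h7]; exact hE.dstr

theorem Env.setVar (hE : Env m Q h) {x : Vr} (v : ℕ)
    (hx : Vr.types ≠ x ∧ Vr.row ≠ x ∧ Vr.size ≠ x ∧ Vr.dsize ≠ x) :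
    Env m Q (h.setVar x v) := by
  constructor
  · simpa [hx.1] using hE.types
  · simpa [hx.2.1] using hE.row
  · simpa [hx.2.2.1] using hE.size
  · simpa [hx.2.2.2] using hE.dsize
  · exact hE.unit
  · exact hE.str
  · exact hE.dstr

theorem Env.setArr (hE : Env m Q h) {a : Ar} (i v : ℕ)
    (ha : Ar.unit ≠ a ∧ Ar.str ≠ a ∧ Ar.dstr ≠ a) : Env m Q (h.setArr a i v) := by
  constructor
  · exact hE.types
  · exact hE.row
  · exact hE.size
  · exact hE.dsize
  · simpa [ha.1] using hE.unit
  · simpa [ha.2.1] using hE.str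
  · simpa [ha.2.2] using hE.dstr

theorem Env.eval_width (hE : Env m Q h) {c : Exp} (hc : c.eval h < 2 * m) :
    (eWidth m c).eval h = width m Q (c.eval h) := by
  simp [eWidth, width, hE.types, hE.unit _ hc]

theorem Env.eval_digit (hE : Env m Q h) {c : Exp} (hc : c.eval h < 2 * m) (z : Exp) :
    (eDigit m c z).eval h = digit (width m Q) (c.eval h) (z.eval h) := by
  simp [eDigit, digit, hE.eval_width hc, hE.str _ hc]

theorem Env.eval_diff (hE : Env m Q h) {c : Exp} (hc : c.eval h < 2 * m) (d : Exp) :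
    (eDiff m c d).eval h = digit (dwidth m Q) (c.eval h) (d.eval h) := by
  simp [eDiff, digit, dwidth, hE.unit _ hc, hE.dstr _ hc]

end Env

/-! ### Rows of tables -/

/-- Fill the row `z` of the array `a` with the values of `e` for `qq = 0, 1, …`. -/
def fillRow (a : Ar) (z e : Exp) : Stmt := loop .qq (var .row) (put a (z * var .row + var .qq) e)

/-- The cells `A` with the row `z` replaced by `x`. -/
def replaceRow (m Q : ℕ) (A : ℕ → ℕ) (z : ℕ) (x : ℕ → ℕ) (k : ℕ) : ℕ :=
  if z * (m * Q) ≤ k ∧ k < z * (m * Q) + m * Q then x (k - z * (m * Q)) else A k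

section Rows

variable {V : ℕ} {β : Vr → ℕ} {m Q : ℕ} {h : Mem}

theorem rowOf_replaceRow_self {A : ℕ → ℕ} {z : ℕ} {x : ℕ → ℕ} {q : ℕ} (hq : q < m * Q) :
    rowOf m Q (replaceRow m Q A z x) z q = x q := by
  rw [rowOf, replaceRow, if_pos ⟨by omega, by omega⟩, Nat.add_sub_cancel_left]

theorem rowOf_replaceRow_of_ne {A : ℕ → ℕ} {z z' : ℕ} {x : ℕ → ℕ} {q : ℕ} (hz : z' ≠ z)
    (hq : q < m * Q) : rowOf m Q (replaceRow m Q A z x) z' q = rowOf m Q A z' q := by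
  rw [rowOf, replaceRow, if_neg]
  · rfl
  · rintro ⟨h1, h2⟩
    rcases lt_or_gt_of_ne hz with hlt | hlt
    · have : (z' + 1) * (m * Q) ≤ z * (m * Q) := Nat.mul_le_mul_right _ hlt
      rw [add_mul] at this
      omega
    · have : (z + 1) * (m * Q) ≤ z' * (m * Q) := Nat.mul_le_mul_right _ hlt
      rw [add_mul] at this
      omega

theorem fillRow_spec (hV : Fits V β m Q) (hE : Env m Q h) {a : Ar} {z e : Exp} (zv : ℕ) (x : ℕ → ℕ)
    (hz : ∀ q < m * Q, ∀ g, Frame (fillRow a z e) h g → z.eval (g.setVar .qq q) = zv)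
    (hx : ∀ q < m * Q, ∀ g, Frame (fillRow a z e) h g →
      e.eval (g.setVar .qq q) = x q ∧ x q ≤ V) :
    Tri V β (fillRow a z e) h fun g => g.arr a = replaceRow m Q (h.arr a) zv x := by
  have hrow : (var Vr.row).eval h = m * Q := hE.row
  refine tri_loop (fun i g => ∀ k, g.arr a k = if zv * (m * Q) ≤ k ∧ k < zv * (m * Q) + i then
    x (k - zv * (m * Q)) else h.arr a k) ?_ ?_ ?_ ?_
  · rw [hrow]
    exact hV.qq
  · intro k
    rw [if_neg (by omega)]
  · intro i g hi hf hI
    rw [hrow] at hi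
    have hr : g.var .row = m * Q := (hf.var .row rfl).trans hE.row
    rw [tri_put]
    simp only [eval_add, eval_mul, hz i hi g hf, (hx i hi g hf).1, eval_var, Mem.setVar_var,
      reduceCtorEq, if_false, if_true, hr]
    refine ⟨(hx i hi g hf).2, fun k => ?_⟩
    rw [Mem.setArr_arr]
    simp only [true_and, Mem.setVar_arr]
    by_cases hk : k = zv * (m * Q) + i
    · subst hk
      rw [if_pos rfl, if_pos (by omega), Nat.add_sub_cancel_left]
    · rw [if_neg hk, hI k]
      have : (zv * (m * Q) ≤ k ∧ k < zv * (m * Q) + i) ↔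
          (zv * (m * Q) ≤ k ∧ k < zv * (m * Q) + (i + 1)) := by omega
      simp only [this]
  · intro g _ hI
    rw [hrow] at hI
    exact funext hI

/-- A sound table stays sound when a cell is flagged and given a schedule. -/
theorem Sound.insert (hm : 0 < m) {N base F X F' X' x : ℕ → ℕ} {z : ℕ} (hS : Sound m Q N base F X)
    (hF : ∀ z', F' z' = if z' = z then 1 else F z') (hX : X' = replaceRow m Q X z x)
    (hx : IsWit m Q N (point m Q base z) x) : Sound m Q N base F' X' := by
  intro z' hz' hF'
  rw [hX]
  by_cases h : z' = z
  · subst h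
    exact hx.congr hm fun q hq => (rowOf_replaceRow_self hq).symm
  · rw [hF, if_neg h] at hF'
    exact (hS z' hz' hF').congr hm fun q hq => (rowOf_replaceRow_of_ne h hq).symm

/-- Clear the flags of the second table. -/
def clearFlags : Stmt := loop .zz (var .size) (put .flag2 (var .zz) (lit 0))

theorem clearFlags_spec (hV : Fits V β m Q) (hE : Env m Q h) :
    Tri V β clearFlags h fun g => ∀ z < tableSize m Q, g.arr .flag2 z = 0 := by
  have hsize : (var Vr.size).eval h = tableSize m Q := hE.size
  refine tri_loop (fun i g => ∀ z < i, g.arr .flag2 z = 0) ?_ ?_ ?_ ?_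
  · rw [hsize]
    exact hV.zz
  · simp
  · intro i g hi hf hI
    rw [tri_put]
    refine ⟨by simp, fun z hz => ?_⟩
    simp only [Mem.setArr_arr, eval_var, Mem.setVar_var, if_true, true_and, eval_lit,
      Mem.setVar_arr]
    split_ifs with hzi
    · rfl
    · exact hI z (by omega)
  · intro g _ hI
    rwa [hsize] at hI

/-- Copy the second table to the first one. -/
def copyTable : Stmt :=
  loop .zz (var .size) (put .flag (var .zz) (get .flag2 (var .zz)) ;;
    fillRow .wit (var .zz) (get .wit2 (var .zz * var .row + var .qq)))

theorem copyTable_spec (hV : Fits V β m Q) (hE : Env m Q h)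
    (hb : h.Bounded V) :
    Tri V β copyTable h fun g => ∀ z < tableSize m Q, g.arr .flag z = h.arr .flag2 z ∧
      ∀ q < m * Q, rowOf m Q (g.arr .wit) z q = rowOf m Q (h.arr .wit2) z q := by
  have hsize : (var Vr.size).eval h = tableSize m Q := hE.size
  refine tri_loop (fun i g => ∀ z < i, g.arr .flag z = h.arr .flag2 z ∧
      ∀ q < m * Q, rowOf m Q (g.arr .wit) z q = rowOf m Q (h.arr .wit2) z q) ?_ ?_ ?_ ?_
  · rw [hsize]
    exact hV.zz
  · simp
  · intro i g hi hf hI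
    have hf2 : g.arr .flag2 = h.arr .flag2 := hf.arr .flag2 rfl
    have hw2 : g.arr .wit2 = h.arr .wit2 := hf.arr .wit2 rfl
    rw [tri_seq, tri_put]
    simp only [eval_get, eval_var, Mem.setVar_var, if_true, Mem.setVar_arr, hf2]
    refine ⟨hb.2 _ _, ?_⟩
    set g' := (g.setVar .zz i).setArr .flag i (h.arr .flag2 i) with hg'
    have hE' : Env m Q g' := ((hE.frame hf rfl).setVar i (by decide)).setArr _ _ (by decide)
    refine (fillRow_spec hV hE' i (rowOf m Q (h.arr .wit2) i) ?_ ?_).mono ?_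
    · intro q hq k hk
      simp [hk.var .zz rfl, hg']
    · intro q hq k hk
      have h1 : k.var .zz = i := by simp [hk.var .zz rfl, hg']
      have h2 : k.var .row = m * Q := (hk.var .row rfl).trans hE'.row
      have h3 : k.arr .wit2 = h.arr .wit2 := by
        rw [hk.arr .wit2 rfl, hg', ← hw2]
        funext l
        simp
      refine ⟨?_, hb.2 _ _⟩
      simp [h1, h2, h3, rowOf]
    · intro k hk hC z hz
      have hflag : k.arr .flag z = if z = i then h.arr .flag2 i else g.arr .flag z := by
        rw [hk.arr .flag rfl, hg']
        simp
      have hwit : g'.arr .wit = g.arr .wit := by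
        funext l
        simp [hg']
      rw [hwit] at hC
      by_cases hzi : z = i
      · subst hzi
        refine ⟨by rw [hflag, if_pos rfl], fun q hq => ?_⟩
        rw [hC, rowOf_replaceRow_self hq]
      · have := hI z (by omega)
        refine ⟨by rw [hflag, if_neg hzi, this.1], fun q hq => ?_⟩
        rw [hC, rowOf_replaceRow_of_ne hzi hq, this.2 q hq]
  · intro g _ hI
    rwa [hsize] at hI

/-- Flag all cells of the first table and give them the empty schedule. -/
def initTable : Stmt :=
  loop .zz (var .size) (put .flag (var .zz) (lit 1) ;; fillRow .wit (var .zz) (lit 0))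

theorem initTable_spec (hV : Fits V β m Q) (hE : Env m Q h) :
    Tri V β initTable h fun g => ∀ z < tableSize m Q, g.arr .flag z = 1 ∧
      ∀ q < m * Q, rowOf m Q (g.arr .wit) z q = 0 := by
  have hsize : (var Vr.size).eval h = tableSize m Q := hE.size
  refine tri_loop (fun i g => ∀ z < i, g.arr .flag z = 1 ∧
      ∀ q < m * Q, rowOf m Q (g.arr .wit) z q = 0) ?_ ?_ ?_ ?_
  · rw [hsize]
    exact hV.zz
  · simp
  · intro i g hi hf hI
    rw [tri_seq, tri_put]
    simp only [eval_lit, eval_var, Mem.setVar_var, if_true]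
    refine ⟨hV.one, ?_⟩
    set g' := (g.setVar .zz i).setArr .flag i 1 with hg'
    have hE' : Env m Q g' := ((hE.frame hf rfl).setVar i (by decide)).setArr _ _ (by decide)
    refine (fillRow_spec hV hE' i (fun _ => 0) ?_ ?_).mono ?_
    · intro q hq k hk
      simp [hk.var .zz rfl, hg']
    · exact fun q hq k hk => ⟨rfl, Nat.zero_le _⟩
    · intro k hk hC z hz
      have hflag : k.arr .flag z = if z = i then 1 else g.arr .flag z := by
        rw [hk.arr .flag rfl, hg']
        simp
      have hwit : g'.arr .wit = g.arr .wit := by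
        funext l
        simp [hg']
      rw [hwit] at hC
      by_cases hzi : z = i
      · subst hzi
        refine ⟨by rw [hflag, if_pos rfl], fun q hq => ?_⟩
        rw [hC, rowOf_replaceRow_self hq]
      · have := hI z (by omega)
        refine ⟨by rw [hflag, if_neg hzi, this.1], fun q hq => ?_⟩
        rw [hC, rowOf_replaceRow_of_ne hzi hq, this.2 q hq]
  · intro g _ hI
    rwa [hsize] at hI

end Rows

/-! ### The doubling step -/

/-- The digit of the second cell of a pair. -/
def ePair (m : ℕ) : Exp :=
  eDigit m (var .cc) (var .zz) + eDiff m (var .cc) (var .dd) -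
    lit (2 * m + 1) * get .unit (var .cc)

/-- The coordinate of the sum of a pair of cells. -/
def eSum (m : ℕ) : Exp :=
  lit 2 * get .obase (var .cc) + eDigit m (var .cc) (var .zz) + ePair m

/-- Compute the second cell `zb` and the sum `zu` for the cell `zz` and the difference `dd`, and
whether they lie in the windows. -/
def pairCells (m : ℕ) : Stmt :=
  .zb ::= lit 0 ;; .zu ::= lit 0 ;; .valid ::= lit 1 ;;
  loop .cc (lit (2 * m))
    (ite (eDigit m (var .cc) (var .zz) + eDiff m (var .cc) (var .dd))
        (lit (2 * m + 1) * get .unit (var .cc))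
      (.valid ::= lit 0)
      (ite (ePair m) (eWidth m (var .cc))
        (ite (eSum m) (get .base (var .cc))
          (.valid ::= lit 0)
          (ite (eSum m - get .base (var .cc)) (eWidth m (var .cc))
            (.zb ::= var .zb + ePair m * get .str (var .cc) ;;
              .zu ::= var .zu + (eSum m - get .base (var .cc)) * get .str (var .cc))
            (.valid ::= lit 0)))
        (.valid ::= lit 0)))

/-- Combine the cell `zz` with all cells at the differences `dd`. -/
def combineCell (m : ℕ) : Stmt :=
  loop .dd (var .dsize)
    (pairCells m ;;
      ite (lit 0) (var .valid)
        (ite (lit 0) (get .flag (var .zb))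
          (put .flag2 (var .zu) (lit 1) ;;
            fillRow .wit2 (var .zu) (get .wit (var .zz * var .row + var .qq) +
              get .wit (var .zb * var .row + var .qq)))
          skip)
        skip)

/-- Replace the table by the table for twice the jobs. -/
def double (m : ℕ) : Stmt :=
  clearFlags ;;
  loop .zz (var .size) (ite (lit 0) (get .flag (var .zz)) (combineCell m) skip) ;;
  copyTable

section Double

variable {V : ℕ} {β : Vr → ℕ} {m Q : ℕ} {h : Mem}

theorem add_mul_stride_lt {w : ℕ → ℕ} {c a x : ℕ} (ha : a < stride w c) (hx : x < w c) :
    a + x * stride w c < stride w (c + 1) := by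
  rw [stride_succ]
  have h2 : x + 1 ≤ w c := hx
  calc a + x * stride w c < stride w c + x * stride w c := by omega
    _ = stride w c * (x + 1) := by ring
    _ ≤ _ := Nat.mul_le_mul_left _ h2

theorem pairCells_spec (hQ : 0 < Q) (hV : Fits V β m Q) (hE : Env m Q h) :
    Tri V β (pairCells m) h fun g =>
      (0 < g.var .valid ↔
        ∀ j < 2 * m, PairValid m Q (h.arr .obase) (h.arr .base) (h.var .zz) (h.var .dd) j) ∧
      (0 < g.var .valid →
        g.var .zb = enc (width m Q) (2 * m) (pairDigit m Q (h.var .zz) (h.var .dd)) ∧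
        g.var .zu = enc (width m Q) (2 * m)
          (sumDigit m Q (h.arr .obase) (h.arr .base) (h.var .zz) (h.var .dd))) := by
  set z := h.var .zz with hz
  set d := h.var .dd with hd
  simp only [pairCells, tri_seq, tri_assign, eval_lit]
  refine ⟨Nat.zero_le _, Nat.zero_le _, hV.one, ?_⟩
  set h₀ := ((h.setVar .zb 0).setVar .zu 0).setVar .valid 1 with hh₀
  have hE₀ : Env m Q h₀ :=
    ((hE.setVar 0 (by decide)).setVar 0 (by decide)).setVar 1 (by decide)
  refine tri_loop (fun c g =>
      (0 < g.var .valid ↔ ∀ j < c, PairValid m Q (h.arr .obase) (h.arr .base) z d j) ∧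
      g.var .zb < stride (width m Q) c ∧ g.var .zu < stride (width m Q) c ∧
      (0 < g.var .valid → g.var .zb = enc (width m Q) c (pairDigit m Q z d) ∧
        g.var .zu = enc (width m Q) c (sumDigit m Q (h.arr .obase) (h.arr .base) z d)))
    hV.cc ?_ ?_ ?_
  · simp [hh₀, enc, stride]
  · intro c g hc hf hI
    rw [eval_lit] at hc
    obtain ⟨hI1, hI2, hI3, hI4⟩ := hI
    set g' := g.setVar .cc c with hg'
    have hE' : Env m Q g' := (hE₀.frame hf rfl).setVar c (by decide)
    have hcc : (var Vr.cc).eval g' = c := by simp [hg']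
    have hccm : (var Vr.cc).eval g' < 2 * m := by rw [hcc]; exact hc
    have e1 : (eDigit m (var .cc) (var .zz)).eval g' = digit (width m Q) c z := by
      rw [hE'.eval_digit hccm, hcc]
      simp [hg', hf.var .zz rfl, hh₀, hz]
    have e2 : (eDiff m (var .cc) (var .dd)).eval g' = digit (dwidth m Q) c d := by
      rw [hE'.eval_diff hccm, hcc]
      simp [hg', hf.var .dd rfl, hh₀, hd]
    have e3 : (get .unit (var .cc)).eval g' = unit m Q c := by
      rw [eval_get, hcc, hE'.unit c hc]
    have e4 : (eWidth m (var .cc)).eval g' = width m Q c := by rw [hE'.eval_width hccm, hcc]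
    have e5 : (ePair m).eval g' = pairDigit m Q z d c := by
      simp only [ePair, eval_sub, eval_add, eval_mul, eval_lit, e1, e2, e3, pairDigit]
    have e6 : (get .base (var .cc)).eval g' = h.arr .base c := by
      rw [eval_get, hcc]
      simp [hg', hf.arr .base rfl, hh₀]
    have e7 : (get .obase (var .cc)).eval g' = h.arr .obase c := by
      rw [eval_get, hcc]
      simp [hg', hf.arr .obase rfl, hh₀]
    have e8 : (eSum m).eval g' =
        2 * h.arr .obase c + digit (width m Q) c z + pairDigit m Q z d c := by
      simp only [eSum, eval_add, eval_mul, eval_lit, e1, e5, e7]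
    have e9 : (eSum m - get .base (var .cc)).eval g' =
        sumDigit m Q (h.arr .obase) (h.arr .base) z d c := by
      rw [eval_sub, e8, e6, sumDigit]
    have e10 : (get .str (var .cc)).eval g' = stride (width m Q) c := by
      rw [eval_get, hcc, hE'.str c hc]
    have hmono : stride (width m Q) c ≤ stride (width m Q) (c + 1) :=
      stride_mono (width_pos hQ) (Nat.le_succ c)
    have hzb : g'.var .zb = g.var .zb := by simp [hg']
    have hzu : g'.var .zu = g.var .zu := by simp [hg']
    have hva : g'.var .valid = g.var .valid := by simp [hg']
    -- an invalid coordinate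
    have hfail : ¬ PairValid m Q (h.arr .obase) (h.arr .base) z d c →
        Tri V β (.valid ::= lit 0) g' (fun g =>
        (0 < g.var .valid ↔ ∀ j < c + 1, PairValid m Q (h.arr .obase) (h.arr .base) z d j) ∧
        g.var .zb < stride (width m Q) (c + 1) ∧ g.var .zu < stride (width m Q) (c + 1) ∧
        (0 < g.var .valid → g.var .zb = enc (width m Q) (c + 1) (pairDigit m Q z d) ∧
          g.var .zu =
            enc (width m Q) (c + 1) (sumDigit m Q (h.arr .obase) (h.arr .base) z d))) := by
      intro hnot
      rw [tri_assign]
      refine ⟨Nat.zero_le _, ?_⟩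
      simp only [Mem.setVar_var, eval_lit, reduceCtorEq, if_false, if_true, hzb, hzu]
      refine ⟨⟨fun h0 => absurd h0 (by omega), fun hall => absurd (hall c (by omega)) hnot⟩,
        by omega, by omega, fun h0 => absurd h0 (by omega)⟩
    simp only [tri_ite, eval_add, eval_mul, eval_lit, e1, e2, e3, e4, e5, e6, e8, e9]
    split_ifs with c1 c2 c3 c4
    · exact hfail fun hp => by have := hp.1; omega
    · exact hfail fun hp => by have := hp.2.2.1; omega
    · have hpv : PairValid m Q (h.arr .obase) (h.arr .base) z d c := ⟨by omega, c2, by omega, c4⟩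
      have hsz : stride (width m Q) (c + 1) ≤ V :=
        (stride_mono (width_pos hQ) hc).trans hV.size
      have hb := add_mul_stride_lt hI2 c2
      have hu := add_mul_stride_lt hI3 c4
      rw [tri_seq, tri_assign, tri_assign]
      set g₂ := g'.setVar .zb ((var Vr.zb + ePair m * get .str (var .cc)).eval g') with hg₂
      have f0 : (var Vr.zb + ePair m * get .str (var .cc)).eval g' =
          g.var .zb + pairDigit m Q z d c * stride (width m Q) c := by
        rw [eval_add, eval_mul, e5, e10, eval_var, hzb]
      have f1 : (var Vr.zu + (eSum m - get .base (var .cc)) * get .str (var .cc)).eval g₂ =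
          g.var .zu +
            sumDigit m Q (h.arr .obase) (h.arr .base) z d c * stride (width m Q) c := by
        rw [← e9, ← e10, ← hzu]
        rfl
      rw [f0, f1]
      refine ⟨by omega, by omega, ?_⟩
      simp only [Mem.setVar_var, reduceCtorEq, if_false, if_true, hg₂, f0, hva]
      refine ⟨?_, hb, hu, fun h0 => ?_⟩
      · rw [hI1]
        refine ⟨fun hall j hj => ?_, fun hall j hj => hall j (by omega)⟩
        rcases Nat.lt_succ_iff_lt_or_eq.1 hj with hj | rfl
        · exact hall j hj
        · exact hpv
      · rw [enc_succ, enc_succ, (hI4 h0).1, (hI4 h0).2]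
        exact ⟨rfl, rfl⟩
    · exact hfail fun hp => c4 hp.2.2.2
    · exact hfail fun hp => c2 hp.2.1
  · intro g hf hI
    exact ⟨hI.1, hI.2.2.2⟩

/-- Flags are only set, and only for sound cells. -/
structure Grows (m Q : ℕ) (N base : ℕ → ℕ) (h g : Mem) : Prop where
  sound : Sound m Q N base (g.arr .flag2) (g.arr .wit2)
  mono : ∀ z, h.arr .flag2 z ≠ 0 → g.arr .flag2 z ≠ 0

theorem combineCell_spec (hm : 0 < m) (hQ : 0 < Q) (hV : Fits V β m Q) (hE : Env m Q h)
    {N : ℕ → ℕ} (hN : ∀ p < Q, 2 * N p ≤ V)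
    (hS : Sound m Q N (h.arr .obase) (h.arr .flag) (h.arr .wit))
    (hz : h.var .zz < tableSize m Q) (hflag : h.arr .flag (h.var .zz) ≠ 0)
    (hG : Grows m Q (fun p => 2 * N p) (h.arr .base) h h) :
    Tri V β (combineCell m) h fun g => Grows m Q (fun p => 2 * N p) (h.arr .base) h g ∧
      ∀ d < diffSize m Q,
        (∀ j < 2 * m, PairValid m Q (h.arr .obase) (h.arr .base) (h.var .zz) d j) →
        h.arr .flag (enc (width m Q) (2 * m) (pairDigit m Q (h.var .zz) d)) ≠ 0 →
        g.arr .flag2 (enc (width m Q) (2 * m)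
          (sumDigit m Q (h.arr .obase) (h.arr .base) (h.var .zz) d)) ≠ 0 := by
  set z := h.var .zz with hzz
  have hdsize : (var Vr.dsize).eval h = diffSize m Q := hE.dsize
  refine tri_loop (fun i g => Grows m Q (fun p => 2 * N p) (h.arr .base) h g ∧
      ∀ d < i, (∀ j < 2 * m, PairValid m Q (h.arr .obase) (h.arr .base) z d j) →
        h.arr .flag (enc (width m Q) (2 * m) (pairDigit m Q z d)) ≠ 0 →
        g.arr .flag2 (enc (width m Q) (2 * m)
          (sumDigit m Q (h.arr .obase) (h.arr .base) z d)) ≠ 0) ?_ ⟨hG, by simp⟩ ?_ ?_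
  · rw [hdsize]
    exact hV.dd
  · rintro d g hd hf ⟨hG', hI⟩
    rw [hdsize] at hd
    rw [tri_seq]
    have hE' : Env m Q (g.setVar .dd d) := (hE.frame hf rfl).setVar d (by decide)
    refine (pairCells_spec hQ hV hE').mono ?_
    have a1 : (g.setVar .dd d).arr .obase = h.arr .obase := hf.arr .obase rfl
    have a2 : (g.setVar .dd d).arr .base = h.arr .base := hf.arr .base rfl
    have a3 : (g.setVar .dd d).var .zz = z := by
      simp [hf.var .zz rfl, hzz]
    have a4 : (g.setVar .dd d).var .dd = d := by simp
    rw [a1, a2, a3, a4]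
    rintro k hk ⟨hk1, hk2⟩
    have hEk : Env m Q k := hE'.frame hk rfl
    have b1 : k.arr .flag = h.arr .flag := (hk.arr .flag rfl).trans (hf.arr .flag rfl)
    have b2 : k.arr .flag2 = g.arr .flag2 := hk.arr .flag2 rfl
    have b3 : k.arr .wit2 = g.arr .wit2 := hk.arr .wit2 rfl
    have b4 : k.arr .wit = h.arr .wit := (hk.arr .wit rfl).trans (hf.arr .wit rfl)
    have b5 : k.var .zz = z := (hk.var .zz rfl).trans a3
    simp only [tri_ite, eval_lit, eval_var, eval_get, tri_skip, b1]
    -- the invariant if nothing is written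
    have hskip : ¬ ((∀ j < 2 * m, PairValid m Q (h.arr .obase) (h.arr .base) z d j) ∧
        h.arr .flag (enc (width m Q) (2 * m) (pairDigit m Q z d)) ≠ 0) →
        Grows m Q (fun p => 2 * N p) (h.arr .base) h k ∧
        ∀ d' < d + 1, (∀ j < 2 * m, PairValid m Q (h.arr .obase) (h.arr .base) z d' j) →
        h.arr .flag (enc (width m Q) (2 * m) (pairDigit m Q z d')) ≠ 0 →
        k.arr .flag2 (enc (width m Q) (2 * m)
          (sumDigit m Q (h.arr .obase) (h.arr .base) z d')) ≠ 0 := by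
      intro hnot
      refine ⟨⟨?_, ?_⟩, fun d' hd' hv hfl => ?_⟩
      · rw [b2, b3]
        exact hG'.sound
      · rw [b2]
        exact hG'.mono
      · rcases Nat.lt_succ_iff_lt_or_eq.1 hd' with hd' | rfl
        · rw [b2]
          exact hI d' hd' hv hfl
        · exact absurd ⟨hv, hfl⟩ hnot
    split_ifs with c1 c2
    · have hval := hk1.1 c1
      obtain ⟨hzb, hzu⟩ := hk2 c1
      set zb := enc (width m Q) (2 * m) (pairDigit m Q z d) with hzbdef
      set zu := enc (width m Q) (2 * m)
        (sumDigit m Q (h.arr .obase) (h.arr .base) z d) with hzudef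
      have hzblt : zb < tableSize m Q := enc_lt fun j hj => (hval j hj).2.1
      rw [hzb] at c2
      have hw1 := hS z hz hflag
      have hw2 := hS zb hzblt (by omega)
      have hw := (hw1.add hw2).mono (N' := fun p => 2 * N p)
        (v' := point m Q (h.arr .base) zu) (fun p _ => (two_mul _).symm)
        fun j hj => (point_sum hval hj).ge
      rw [tri_seq, tri_put]
      refine ⟨hV.one, ?_⟩
      simp only [eval_var, eval_lit, hzu]
      set k₁ := k.setArr .flag2 zu 1 with hk₁
      have hE₁ : Env m Q k₁ := hEk.setArr _ _ (by decide)
      refine (fillRow_spec hV hE₁ zu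
        (fun q => rowOf m Q (h.arr .wit) z q + rowOf m Q (h.arr .wit) zb q) ?_ ?_).mono ?_
      · intro q hq l hl
        simp [hl.var .zu rfl, hk₁, hzu]
      · intro q hq l hl
        have l1 : l.var .row = m * Q := (hl.var .row rfl).trans hE₁.row
        have l2 : l.var .zz = z := (hl.var .zz rfl).trans b5
        have l3 : l.var .zb = zb := (hl.var .zb rfl).trans hzb
        have l4 : l.arr .wit = h.arr .wit := by
          rw [hl.arr .wit rfl, ← b4, hk₁]
          funext i
          simp
        refine ⟨?_, (hw.entry_le hq).trans (hN _ (Nat.mod_lt q hQ))⟩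
        simp [l1, l2, l3, l4, rowOf]
      · intro l hl hC
        have hflag2 : ∀ z', l.arr .flag2 z' = if z' = zu then 1 else g.arr .flag2 z' := by
          intro z'
          rw [hl.arr .flag2 rfl, ← b2, hk₁]
          simp
        have hwit2 : k₁.arr .wit2 = g.arr .wit2 := by
          rw [← b3, hk₁]
          funext i
          simp
        rw [hwit2] at hC
        refine ⟨⟨hG'.sound.insert hm hflag2 hC hw, fun z' hz' => ?_⟩,
          fun d' hd' hv hfl => ?_⟩
        · rw [hflag2]
          split_ifs
          · exact one_ne_zero
          · exact hG'.mono z' hz'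
        · rw [hflag2]
          split_ifs with hne
          · exact one_ne_zero
          · rcases Nat.lt_succ_iff_lt_or_eq.1 hd' with hd' | rfl
            · exact hI d' hd' hv hfl
            · exact absurd rfl hne
    · refine hskip fun hboth => c2 ?_
      rw [(hk2 c1).1]
      exact Nat.pos_of_ne_zero hboth.2
    · exact hskip fun hboth => c1 (hk1.2 hboth.1)
  · intro g _ hI
    rwa [hdsize] at hI

theorem Sound.congr (hm : 0 < m) {N base F X F' X' : ℕ → ℕ} (hS : Sound m Q N base F X)
    (h : ∀ z < tableSize m Q, F' z = F z ∧ ∀ q < m * Q, rowOf m Q X' z q = rowOf m Q X z q) :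
    Sound m Q N base F' X' := fun z hz hF =>
  (hS z hz (by rwa [← (h z hz).1])).congr hm fun q hq => ((h z hz).2 q hq).symm

theorem double_spec (hm : 0 < m) (hQ : 0 < Q) (hV : Fits V β m Q) (hE : Env m Q h)
    (hb : h.Bounded V) {N : ℕ → ℕ} (hN : ∀ p < Q, 2 * N p ≤ V)
    (hS : Sound m Q N (h.arr .obase) (h.arr .flag) (h.arr .wit)) :
    Tri V β (double m) h fun g =>
      Sound m Q (fun p => 2 * N p) (h.arr .base) (g.arr .flag) (g.arr .wit) ∧
      ∀ z < tableSize m Q, ∀ d < diffSize m Q,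
        (∀ j < 2 * m, PairValid m Q (h.arr .obase) (h.arr .base) z d j) → h.arr .flag z ≠ 0 →
        h.arr .flag (enc (width m Q) (2 * m) (pairDigit m Q z d)) ≠ 0 →
        g.arr .flag (enc (width m Q) (2 * m)
          (sumDigit m Q (h.arr .obase) (h.arr .base) z d)) ≠ 0 := by
  rw [double, tri_seq]
  refine ((clearFlags_spec hV hE).bounded hV.le hb).mono ?_
  rintro h₁ hf₁ ⟨hb₁, hcl⟩
  have hE₁ : Env m Q h₁ := hE.frame hf₁ rfl
  have a1 : h₁.arr .obase = h.arr .obase := hf₁.arr .obase rfl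
  have a2 : h₁.arr .base = h.arr .base := hf₁.arr .base rfl
  have a3 : h₁.arr .flag = h.arr .flag := hf₁.arr .flag rfl
  have a4 : h₁.arr .wit = h.arr .wit := hf₁.arr .wit rfl
  have hsize : (var Vr.size).eval h₁ = tableSize m Q := hE₁.size
  rw [tri_seq]
  refine (Tri.bounded (C := fun g =>
      Sound m Q (fun p => 2 * N p) (h.arr .base) (g.arr .flag2) (g.arr .wit2) ∧
      ∀ z < tableSize m Q, ∀ d < diffSize m Q,
        (∀ j < 2 * m, PairValid m Q (h.arr .obase) (h.arr .base) z d j) → h.arr .flag z ≠ 0 →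
        h.arr .flag (enc (width m Q) (2 * m) (pairDigit m Q z d)) ≠ 0 →
        g.arr .flag2 (enc (width m Q) (2 * m)
          (sumDigit m Q (h.arr .obase) (h.arr .base) z d)) ≠ 0) ?_ hV.le hb₁).mono ?_
  · refine tri_loop (fun i g =>
      Sound m Q (fun p => 2 * N p) (h.arr .base) (g.arr .flag2) (g.arr .wit2) ∧
      ∀ z < i, ∀ d < diffSize m Q,
        (∀ j < 2 * m, PairValid m Q (h.arr .obase) (h.arr .base) z d j) → h.arr .flag z ≠ 0 →
        h.arr .flag (enc (width m Q) (2 * m) (pairDigit m Q z d)) ≠ 0 →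
        g.arr .flag2 (enc (width m Q) (2 * m)
          (sumDigit m Q (h.arr .obase) (h.arr .base) z d)) ≠ 0) ?_ ⟨?_, by simp⟩ ?_ ?_
    · rw [hsize]
      exact hV.zz
    · exact fun z hz hne => absurd (hcl z hz) hne
    · rintro z g hz hf ⟨hS', hI⟩
      rw [hsize] at hz
      have hE' : Env m Q (g.setVar .zz z) := (hE₁.frame hf rfl).setVar z (by decide)
      have b1 : (g.setVar .zz z).arr .obase = h.arr .obase := (hf.arr .obase rfl).trans a1
      have b2 : (g.setVar .zz z).arr .base = h.arr .base := (hf.arr .base rfl).trans a2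
      have b3 : (g.setVar .zz z).arr .flag = h.arr .flag := (hf.arr .flag rfl).trans a3
      have b4 : (g.setVar .zz z).arr .wit = h.arr .wit := (hf.arr .wit rfl).trans a4
      have b5 : (g.setVar .zz z).var .zz = z := by simp
      simp only [tri_ite, eval_lit, eval_get, eval_var, tri_skip, b3, b5]
      split_ifs with hfl
      · refine (combineCell_spec hm hQ hV hE' hN (by rw [b1, b3, b4]; exact hS)
          (by rw [b5]; exact hz) (by rw [b5, b3]; omega)
          ⟨by rw [b2]; exact hS', fun _ h0 => h0⟩).mono ?_
        rw [b1, b2, b3, b5]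
        rintro k hk ⟨hG, hC⟩
        refine ⟨hG.sound, fun z' hz' d hd hv h1 h2 => ?_⟩
        rcases Nat.lt_succ_iff_lt_or_eq.1 hz' with hz' | rfl
        · exact hG.mono _ (hI z' hz' d hd hv h1 h2)
        · exact hC d hd hv h2
      · refine ⟨hS', fun z' hz' d hd hv h1 h2 => ?_⟩
        rcases Nat.lt_succ_iff_lt_or_eq.1 hz' with hz' | rfl
        · exact hI z' hz' d hd hv h1 h2
        · exact absurd (Nat.pos_of_ne_zero h1) hfl
    · intro g _ hI
      rwa [hsize] at hI
  · rintro h₂ hf₂ ⟨hb₂, hS₂, hC₂⟩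
    refine (copyTable_spec hV (hE₁.frame hf₂ rfl) hb₂).mono ?_
    intro g _ hC
    refine ⟨hS₂.congr hm hC, fun z hz d hd hv h1 h2 => ?_⟩
    rw [(hC _ (enc_lt fun j hj => (hv j hj).2.2.2)).1]
    exact hC₂ z hz d hd hv h1 h2

end Double

/-! ### Adding jobs -/

/-- Replace the table by the table with one more job of the type `pp`. -/
def addJobs (m : ℕ) : Stmt :=
  clearFlags ;;
  loop .zz (var .size) (ite (lit 0) (get .flag (var .zz))
    (loop .ii (lit m)
      (ite (eDigit m (var .ii) (var .zz) + var .pp) (eWidth m (var .ii))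
        (ite (eDigit m (lit m + var .ii) (var .zz) + lit 1) (eWidth m (lit m + var .ii))
          (.zu ::= var .zz + var .pp * get .str (var .ii) + get .str (lit m + var .ii) ;;
            put .flag2 (var .zu) (lit 1) ;;
            fillRow .wit2 (var .zu) (get .wit (var .zz * var .row + var .qq)) ;;
            put .wit2 (var .zu * var .row + (var .ii * var .types + var .pp))
              (get .wit (var .zz * var .row + (var .ii * var .types + var .pp)) + lit 1))
          skip)
        skip))
    skip) ;;
  copyTable

section AddJobs

variable {V : ℕ} {β : Vr → ℕ} {m Q : ℕ} {h : Mem}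

theorem addJobs_spec (hm : 0 < m) (hQ : 0 < Q) (hV : Fits V β m Q) (hE : Env m Q h)
    (hb : h.Bounded V) {N : ℕ → ℕ} {p : ℕ} (hpp : h.var .pp = p) (hp : p < Q) (hN : N p + 1 ≤ V)
    (hS : Sound m Q N (h.arr .base) (h.arr .flag) (h.arr .wit)) :
    Tri V β (addJobs m) h fun g =>
      Sound m Q (addJob N p) (h.arr .base) (g.arr .flag) (g.arr .wit) ∧
      ∀ z < tableSize m Q, ∀ i < m, AddValid m Q i p z → h.arr .flag z ≠ 0 →
        g.arr .flag (addCell m Q i p z) ≠ 0 := by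
  rw [addJobs, tri_seq]
  refine ((clearFlags_spec hV hE).bounded hV.le hb).mono ?_
  rintro h₁ hf₁ ⟨hb₁, hcl⟩
  have hE₁ : Env m Q h₁ := hE.frame hf₁ rfl
  have a2 : h₁.arr .base = h.arr .base := hf₁.arr .base rfl
  have a3 : h₁.arr .flag = h.arr .flag := hf₁.arr .flag rfl
  have a4 : h₁.arr .wit = h.arr .wit := hf₁.arr .wit rfl
  have a5 : h₁.var .pp = p := (hf₁.var .pp rfl).trans hpp
  have hsize : (var Vr.size).eval h₁ = tableSize m Q := hE₁.size
  rw [tri_seq]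
  refine (Tri.bounded (C := fun g =>
      Sound m Q (addJob N p) (h.arr .base) (g.arr .flag2) (g.arr .wit2) ∧
      ∀ z < tableSize m Q, ∀ i < m, AddValid m Q i p z → h.arr .flag z ≠ 0 →
        g.arr .flag2 (addCell m Q i p z) ≠ 0) ?_ hV.le hb₁).mono ?_
  · refine tri_loop (fun k g =>
      Sound m Q (addJob N p) (h.arr .base) (g.arr .flag2) (g.arr .wit2) ∧
      ∀ z < k, ∀ i < m, AddValid m Q i p z → h.arr .flag z ≠ 0 →
        g.arr .flag2 (addCell m Q i p z) ≠ 0) ?_ ⟨?_, by simp⟩ ?_ ?_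
    · rw [hsize]
      exact hV.zz
    · exact fun z hz hne => absurd (hcl z hz) hne
    · rintro z g hz hf ⟨hS', hI⟩
      rw [hsize] at hz
      set g₁ := g.setVar .zz z with hg₁
      have hE' : Env m Q g₁ := (hE₁.frame hf rfl).setVar z (by decide)
      have b3 : g₁.arr .flag = h.arr .flag := (hf.arr .flag rfl).trans a3
      have b4 : g₁.arr .wit = h.arr .wit := (hf.arr .wit rfl).trans a4
      have b5 : g₁.var .zz = z := by simp [hg₁]
      have b6 : g₁.var .pp = p := by simp [hg₁, hf.var .pp rfl, a5]
      simp only [tri_ite, eval_lit, eval_get, eval_var, tri_skip, b3, b5]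
      split_ifs with hfl
      · refine tri_loop (fun i k =>
          Sound m Q (addJob N p) (h.arr .base) (k.arr .flag2) (k.arr .wit2) ∧
          (∀ z', g.arr .flag2 z' ≠ 0 → k.arr .flag2 z' ≠ 0) ∧
          ∀ i' < i, AddValid m Q i' p z → k.arr .flag2 (addCell m Q i' p z) ≠ 0)
          hV.ii ⟨hS', fun _ h0 => h0, by simp⟩ ?_ ?_
        · rintro i k hi hk ⟨hSk, hmono, hIk⟩
          rw [eval_lit] at hi
          set k₁ := k.setVar .ii i with hk₁
          have hEk : Env m Q k₁ := (hE'.frame hk rfl).setVar i (by decide)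
          have c4 : k₁.arr .wit = h.arr .wit := (hk.arr .wit rfl).trans b4
          have c5 : k₁.var .zz = z := by simp [hk₁, hk.var .zz rfl, b5]
          have c6 : k₁.var .pp = p := by simp [hk₁, hk.var .pp rfl, b6]
          have c7 : k₁.var .ii = i := by simp [hk₁]
          have d1 : (eDigit m (var .ii) (var .zz)).eval k₁ = digit (width m Q) i z := by
            rw [hEk.eval_digit (by rw [eval_var, c7]; omega), eval_var, eval_var, c5, c7]
          have d2 : (eDigit m (lit m + var .ii) (var .zz)).eval k₁ =
              digit (width m Q) (m + i) z := by
            rw [hEk.eval_digit (by rw [eval_add, eval_lit, eval_var, c7]; omega), eval_add,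
              eval_lit, eval_var, eval_var, c5, c7]
          have d3 : (eWidth m (var .ii)).eval k₁ = width m Q i := by
            rw [hEk.eval_width (by rw [eval_var, c7]; omega), eval_var, c7]
          have d4 : (eWidth m (lit m + var .ii)).eval k₁ = width m Q (m + i) := by
            rw [hEk.eval_width (by rw [eval_add, eval_lit, eval_var, c7]; omega), eval_add,
              eval_lit, eval_var, c7]
          have d5 : (get .str (var .ii)).eval k₁ = stride (width m Q) i := by
            rw [eval_get, eval_var, c7, hEk.str i (by omega)]
          have d6 : (get .str (lit m + var .ii)).eval k₁ = stride (width m Q) (m + i) := by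
            rw [eval_get, eval_add, eval_lit, eval_var, c7, hEk.str _ (by omega)]
          -- the invariant if nothing is written
          have hskip : ¬ AddValid m Q i p z →
              Sound m Q (addJob N p) (h.arr .base) (k₁.arr .flag2) (k₁.arr .wit2) ∧
              (∀ z', g.arr .flag2 z' ≠ 0 → k₁.arr .flag2 z' ≠ 0) ∧
              ∀ i' < i + 1, AddValid m Q i' p z → k₁.arr .flag2 (addCell m Q i' p z) ≠ 0 := by
            refine fun hnot => ⟨hSk, hmono, fun i' hi' hv => ?_⟩
            rcases Nat.lt_succ_iff_lt_or_eq.1 hi' with hi' | rfl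
            · exact hIk i' hi' hv
            · exact absurd hv hnot
          simp only [tri_ite, tri_skip, eval_add _ (eDigit _ _ _), d1, d2, d3, d4, eval_lit,
            eval_var, c6]
          split_ifs with c1 c2
          · have hval : AddValid m Q i p z := ⟨c1, c2⟩
            set zu := addCell m Q i p z with hzu
            have hzult : zu < tableSize m Q := addCell_lt hi hQ hz hval
            have hw1 := hS z hz (by omega)
            have hw := hw1.addJob hi hp hz hval
            rw [tri_seq, tri_assign]
            have f0 : (var Vr.zz + var .pp * get .str (var .ii) +
                get .str (lit m + var .ii)).eval k₁ = zu := by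
              simp only [eval_add _ (_ + _), eval_add _ (var _) (_ * _), eval_mul, d5, d6]
              rw [eval_var, eval_var, c5, c6]
              rfl
            rw [f0, tri_seq, tri_put]
            refine ⟨hzult.le.trans hV.size, hV.one, ?_⟩
            simp only [eval_var, eval_lit, Mem.setVar_var, if_true]
            set k₂ := (k₁.setVar .zu zu).setArr .flag2 zu 1 with hk₂
            have hE₂ : Env m Q k₂ := (hEk.setVar _ (by decide)).setArr _ _ (by decide)
            have hqlt : i * Q + p < m * Q := by
              have : i + 1 ≤ m := hi
              nlinarith
            rw [tri_seq]
            refine (fillRow_spec hV hE₂ zu (rowOf m Q (h.arr .wit) z) ?_ ?_).mono ?_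
            · intro q hq l hl
              simp [hl.var .zu rfl, hk₂]
            · intro q hq l hl
              have l1 : l.var .row = m * Q := (hl.var .row rfl).trans hE₂.row
              have l2 : l.var .zz = z := by rw [hl.var .zz rfl, ← c5, hk₂]; simp
              have l4 : l.arr .wit = h.arr .wit := by
                rw [hl.arr .wit rfl, ← c4, hk₂]
                funext i
                simp
              have hle : rowOf m Q (h.arr .wit) z q ≤ V := by
                have := hb.2 .wit (z * (m * Q) + q)
                exact this
              refine ⟨?_, hle⟩
              simp [l1, l2, l4, rowOf]
            · intro l hl hC
              have l1 : l.var .row = m * Q := (hl.var .row rfl).trans hE₂.row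
              have l2 : l.var .zz = z := by rw [hl.var .zz rfl, ← c5, hk₂]; simp
              have l3 : l.var .zu = zu := by rw [hl.var .zu rfl, hk₂]; simp
              have l4 : l.arr .wit = h.arr .wit := by
                rw [hl.arr .wit rfl, ← c4, hk₂]
                funext i
                simp
              have l5 : l.var .ii = i := by rw [hl.var .ii rfl, ← c7, hk₂]; simp
              have l6 : l.var .pp = p := by rw [hl.var .pp rfl, ← c6, hk₂]; simp
              have l7 : l.var .types = Q := (hl.var .types rfl).trans hE₂.types
              have hflag2 : ∀ z', l.arr .flag2 z' = if z' = zu then 1 else k.arr .flag2 z' := by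
                intro z'
                rw [hl.arr .flag2 rfl, hk₂]
                simp [hk₁]
              have hwit2 : k₂.arr .wit2 = k.arr .wit2 := by
                funext i
                simp [hk₂, hk₁]
              rw [hwit2] at hC
              rw [tri_put]
              simp only [eval_add, eval_mul, eval_get, eval_var, eval_lit, l1, l2, l3, l4, l5, l6,
                l7]
              have hent := hw1.entry_le hqlt
              rw [show (i * Q + p) % Q = p by
                rw [mul_comm, Nat.mul_add_mod, Nat.mod_eq_of_lt hp]] at hent
              refine ⟨le_trans (Nat.succ_le_succ hent) hN, ?_⟩
              have hrep : (l.setArr .wit2 (zu * (m * Q) + (i * Q + p))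
                  (h.arr .wit (z * (m * Q) + (i * Q + p)) + 1)).arr .wit2 =
                  replaceRow m Q (k.arr .wit2) zu
                    (fun q => rowOf m Q (h.arr .wit) z q + single Q i p q) := by
                funext r
                simp only [Mem.setArr_arr, true_and, hC]
                unfold replaceRow single rowOf
                by_cases hr : r = zu * (m * Q) + (i * Q + p)
                · subst hr
                  rw [if_pos rfl, if_pos ⟨by omega, by omega⟩, Nat.add_sub_cancel_left]
                  dsimp only
                  rw [if_pos rfl]
                · rw [if_neg hr]
                  split_ifs with h1
                  · dsimp only
                    rw [if_neg (by omega), add_zero]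
                  · rfl
              have hfl' : (l.setArr .wit2 (zu * (m * Q) + (i * Q + p))
                  (h.arr .wit (z * (m * Q) + (i * Q + p)) + 1)).arr .flag2 = l.arr .flag2 := by
                funext r
                simp
              rw [hfl']
              refine ⟨hSk.insert hm hflag2 hrep hw, fun z' hz' => ?_, fun i' hi' hv => ?_⟩
              · rw [hflag2]
                split_ifs
                · exact one_ne_zero
                · exact hmono z' hz'
              · rw [hflag2]
                split_ifs with hne
                · exact one_ne_zero
                · rcases Nat.lt_succ_iff_lt_or_eq.1 hi' with hi' | rfl
                  · exact hIk i' hi' hv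
                  · exact absurd rfl hne
          · exact hskip fun hv => c2 hv.2
          · exact hskip fun hv => c1 hv.1
        · rintro k hk ⟨hSk, hmono, hIk⟩
          refine ⟨hSk, fun z' hz' i hi hv h1 => ?_⟩
          rcases Nat.lt_succ_iff_lt_or_eq.1 hz' with hz' | rfl
          · exact hmono _ (hI z' hz' i hi hv h1)
          · exact hIk i hi hv
      · refine ⟨hS', fun z' hz' i hi hv h1 => ?_⟩
        rcases Nat.lt_succ_iff_lt_or_eq.1 hz' with hz' | rfl
        · exact hI z' hz' i hi hv h1
        · exact absurd (Nat.pos_of_ne_zero h1) hfl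
    · intro g _ hI
      rwa [hsize] at hI
  · rintro h₂ hf₂ ⟨hb₂, hS₂, hC₂⟩
    refine (copyTable_spec hV (hE₁.frame hf₂ rfl) hb₂).mono ?_
    intro g _ hC
    refine ⟨hS₂.congr hm hC, fun z hz i hi hv h1 => ?_⟩
    rw [(hC _ (addCell_lt hi hQ hz hv)).1]
    exact hC₂ z hz i hi hv h1

end AddJobs

/-! ### The tables of all levels -/

section Congr

variable {m Q : ℕ} {N N' base base' c F X : ℕ → ℕ} {e e' : ℕ}

theorem Sound.base_congr (hS : Sound m Q N base F X) (hN : ∀ p < Q, N p = N' p)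
    (h : ∀ j < 2 * m, base j = base' j) : Sound m Q N' base' F X := fun z hz hF =>
  (hS z hz hF).mono hN fun j hj => by rw [point, point, h j hj]

theorem Complete.mono (hC : Complete m Q N base c e F) (hN : ∀ p < Q, N p = N' p) (he : e' ≤ e) :
    Complete m Q N' base c e' F := by
  rintro z hz hnear ⟨x, hx⟩
  refine hC z hz (fun j hj => ?_) ⟨x, hx.mono (fun p hp => (hN p hp).symm) fun _ _ => le_rfl⟩
  have h1 := hnear j hj
  have h2 : e' * unit m Q j ≤ e * unit m Q j := Nat.mul_le_mul_right _ he
  omega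

theorem pairValid_congr {ob ob' b b' : ℕ → ℕ} {z d j : ℕ} (h1 : ob j = ob' j) (h2 : b j = b' j) :
    PairValid m Q ob b z d j ↔ PairValid m Q ob' b' z d j := by
  unfold PairValid sumDigit
  rw [h1, h2]

theorem enc_sumDigit_congr {ob ob' b b' : ℕ → ℕ} {z d : ℕ} (h1 : ∀ j < 2 * m, ob j = ob' j)
    (h2 : ∀ j < 2 * m, b j = b' j) :
    enc (width m Q) (2 * m) (sumDigit m Q ob b z d) =
      enc (width m Q) (2 * m) (sumDigit m Q ob' b' z d) :=
  enc_congr fun j hj => by rw [sumDigit, sumDigit, h1 j hj, h2 j hj]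

end Congr

/-- The memory holds a sound table for the jobs `N` with a window around `c`. It is complete up to
a margin of `e` units below `c`. -/
structure TableFor (m Q : ℕ) (N c : ℕ → ℕ) (e : ℕ) (g : Mem) : Prop where
  base : ∀ j < 2 * m, g.arr .base j = windowBase m Q c j
  sound : Sound m Q N (windowBase m Q c) (g.arr .flag) (g.arr .wit)
  complete : Complete m Q N (windowBase m Q c) c e (g.arr .flag)

/-- Move the window to the targets divided by `lpow`. -/
def setBase (m : ℕ) : Stmt :=
  loop .cc (lit (2 * m))
    (put .obase (var .cc) (get .base (var .cc)) ;;
      put .base (var .cc) (get .tgt (var .cc) / var .lpow -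
        lit (2 * m + 3) * (var .types * get .unit (var .cc))))

/-- Replace the table of a level by that of the next one, with twice as many jobs: the jobs of each
type double, and one more job is added if that makes their number the right one. -/
def nextLevel (m : ℕ) : Stmt :=
  .lpow ::= var .lpow / lit 2 ;;
  setBase m ;;
  double m ;;
  loop .pp (var .types)
    (ite (lit 0) (get .cnt (var .pp) / var .lpow % lit 2) (addJobs m) skip)

/-- Find out whether there is a schedule of the jobs `cnt` with coordinates at most `tgt`. -/
def decideTarget (m : ℕ) : Stmt :=
  .lpow ::= var .pow ;;
  setBase m ;;
  initTable ;;
  loop .kk (var .levels) (nextLevel m) ;;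
  .centre ::= lit 0 ;;
  loop .cc (lit (2 * m))
    (.centre ::= var .centre +
      (get .tgt (var .cc) - get .base (var .cc)) * get .str (var .cc)) ;;
  ite (lit 0) (get .flag (var .centre)) (.ok ::= lit 1) (.ok ::= lit 0)

section Levels

variable {V : ℕ} {β : Vr → ℕ} {m Q : ℕ} {h : Mem}

theorem setBase_spec (hV : Fits V β m Q) (hE : Env m Q h) (hb : h.Bounded V) :
    Tri V β (setBase m) h fun g => (∀ j < 2 * m, g.arr .obase j = h.arr .base j) ∧
      ∀ j < 2 * m, g.arr .base j = windowBase m Q (fun j => h.arr .tgt j / h.var .lpow) j := by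
  refine tri_loop (fun i g => (∀ j < i, g.arr .obase j = h.arr .base j) ∧
      (∀ j < i, g.arr .base j = windowBase m Q (fun j => h.arr .tgt j / h.var .lpow) j) ∧
      ∀ j, i ≤ j → g.arr .base j = h.arr .base j) hV.cc (by simp) ?_ ?_
  · rintro i g hi hf ⟨h1, h2, h3⟩
    rw [eval_lit] at hi
    have hE' : Env m Q g := hE.frame hf rfl
    have e1 : g.arr .tgt = h.arr .tgt := hf.arr .tgt rfl
    have e2 : g.var .lpow = h.var .lpow := hf.var .lpow rfl
    simp only [tri_seq, tri_put, eval_get, eval_var, eval_div, eval_sub, eval_mul, eval_lit,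
      Mem.setVar_var, Mem.setVar_arr, Mem.setArr_arr, Mem.setArr_var, if_true, reduceCtorEq,
      if_false, false_and, true_and, e1, e2, hE'.types, hE'.unit i hi]
    refine ⟨?_, ?_, ?_, ?_, ?_⟩
    · rw [h3 i le_rfl]
      exact hb.2 _ _
    · exact (Nat.sub_le _ _).trans ((Nat.div_le_self _ _).trans (hb.2 _ _))
    · intro j hj
      split_ifs with hji
      · rw [hji, h3 i le_rfl]
      · exact h1 j (by omega)
    · intro j hj
      split_ifs with hji
      · rw [hji, windowBase]
      · exact h2 j (by omega)
    · intro j hj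
      rw [if_neg (by omega)]
      exact h3 j (by omega)
  · rintro g _ ⟨h1, h2, _⟩
    exact ⟨h1, h2⟩

theorem nextLevel_spec (hm : 0 < m) (hQ : 0 < Q) (hV : Fits V β m Q) (hE : Env m Q h)
    (hb : h.Bounded V) {l : ℕ} (hl : h.var .lpow = 2 * l)
    (hT : TableFor m Q (fun p => h.arr .cnt p / (2 * l)) (fun j => h.arr .tgt j / (2 * l)) 0 h) :
    Tri V β (nextLevel m) h fun g => g.var .lpow = l ∧
      TableFor m Q (fun p => h.arr .cnt p / l) (fun j => h.arr .tgt j / l) 0 g := by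
  set N := fun p => h.arr .cnt p / (2 * l) with hN
  set c := fun j => h.arr .tgt j / (2 * l) with hc
  set c' := fun j => h.arr .tgt j / l with hc'
  have hcc : ∀ j < 2 * m, c' j / 2 = c j := fun j _ => by
    rw [hc', hc]
    dsimp only
    rw [Nat.div_div_eq_div_mul, mul_comm]
  have hlV : l ≤ V := by
    have := hb.1 .lpow
    omega
  rw [nextLevel, tri_seq, tri_assign]
  have hlv : (var Vr.lpow / lit 2).eval h = l := by
    rw [eval_div, eval_var, eval_lit, hl, Nat.mul_div_cancel_left _ (by omega)]
  rw [hlv]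
  refine ⟨hlV, ?_⟩
  have hb₁ := hb.setVar .lpow hlV
  have hE₁ : Env m Q (h.setVar .lpow l) := hE.setVar l (by decide)
  set h₁ := h.setVar .lpow l with hh₁
  have hl₁ : h₁.var .lpow = l := by simp [hh₁]
  rw [tri_seq]
  refine ((setBase_spec hV hE₁ hb₁).bounded hV.le hb₁).mono ?_
  rintro h₂ hf₂ ⟨hb₂, hob, hba⟩
  rw [hl₁] at hba
  have hE₂ : Env m Q h₂ := hE₁.frame hf₂ rfl
  have hob : ∀ j < 2 * m, h₂.arr .obase j = windowBase m Q c j := fun j hj =>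
    (hob j hj).trans (hT.base j hj)
  have hba : ∀ j < 2 * m, h₂.arr .base j = windowBase m Q c' j := hba
  have hfl₂ : h₂.arr .flag = h.arr .flag := hf₂.arr .flag rfl
  have hwi₂ : h₂.arr .wit = h.arr .wit := hf₂.arr .wit rfl
  have hcn₂ : h₂.arr .cnt = h.arr .cnt := hf₂.arr .cnt rfl
  have hl₂ : h₂.var .lpow = l := (hf₂.var .lpow rfl).trans hl₁
  have h2N : ∀ p, 2 * N p ≤ V := fun p => by
    have h1 := hb.2 .cnt p
    have h2 : 2 * (h.arr .cnt p / (2 * l)) ≤ h.arr .cnt p := by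
      rw [mul_comm 2 l, ← Nat.div_div_eq_div_mul]
      have := Nat.div_le_self (h.arr .cnt p) l
      omega
    simp only [hN]
    omega
  rw [tri_seq]
  refine ((double_spec hm hQ hV hE₂ hb₂ (fun p _ => h2N p) (N := N) ?_).bounded hV.le hb₂).mono ?_
  · rw [hfl₂, hwi₂]
    exact hT.sound.base_congr (fun _ _ => rfl) fun j hj => (hob j hj).symm
  rintro h₃ hf₃ ⟨hb₃, hS₃, hC₃⟩
  rw [hfl₂] at hC₃
  have hE₃ : Env m Q h₃ := hE₂.frame hf₃ rfl
  have hcn₃ : h₃.arr .cnt = h.arr .cnt := (hf₃.arr .cnt rfl).trans hcn₂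
  have hl₃ : h₃.var .lpow = l := (hf₃.var .lpow rfl).trans hl₂
  have hba₃ : ∀ j < 2 * m, h₃.arr .base j = windowBase m Q c' j := by
    rw [hf₃.arr .base rfl]
    exact hba
  have hT₃ : TableFor m Q (fun p => 2 * N p) c' Q h₃ := by
    refine ⟨hba₃, hS₃.base_congr (fun _ _ => rfl) hba, fun z hz hnear hx => ?_⟩
    obtain ⟨z', hz', d, hd, hv, hz1, hz2, hz3⟩ := exists_pair hm hQ hcc hT.complete hz hnear hx
    have := hC₃ z' hz' d hd
      (fun j hj => (pairValid_congr (hob j hj) (hba j hj)).2 (hv j hj)) hz1 hz2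
    rwa [enc_sumDigit_congr hob hba, hz3] at this
  have htypes : (var Vr.types).eval h₃ = Q := hE₃.types
  have hbit : ∀ p, 2 * N p + h.arr .cnt p / l % 2 = h.arr .cnt p / l := by
    intro p
    simp only [hN]
    rw [mul_comm 2 l, ← Nat.div_div_eq_div_mul]
    omega
  -- each type may cost one unit of the margin, and the doubled table has a margin of `Q` units
  refine (tri_loop (fun i g => g.Bounded V ∧ TableFor m Q
    (fun p => 2 * N p + if p < i then h.arr .cnt p / l % 2 else 0) c' (Q - i) g) ?_ ?_ ?_ ?_)
  · rw [htypes]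
    exact hV.pp
  · simpa using ⟨hb₃, hT₃⟩
  · rintro i g hi hf ⟨hbg, hTg⟩
    rw [htypes] at hi
    have hiV : i ≤ V := hi.le.trans (hV.pp.trans (hV.le _))
    have hE' : Env m Q (g.setVar .pp i) := (hE₃.frame hf rfl).setVar i (by decide)
    have hcn' : g.arr .cnt = h.arr .cnt := (hf.arr .cnt rfl).trans hcn₃
    have hl' : g.var .lpow = l := (hf.var .lpow rfl).trans hl₃
    simp only [tri_ite, eval_lit, eval_mod, eval_div, eval_get, eval_var, Mem.setVar_arr,
      Mem.setVar_var, if_true, reduceCtorEq, if_false, hcn', hl', tri_skip]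
    split_ifs with hodd
    · have hbi : h.arr .cnt i / l % 2 = 1 := by omega
      refine ((addJobs_spec hm hQ hV hE' (hbg.setVar .pp hiV) (p := i)
        (N := fun p => 2 * N p + if p < i then h.arr .cnt p / l % 2 else 0) (by simp) hi ?_
        ?_).bounded hV.le (hbg.setVar .pp hiV)).mono ?_
      · have h1 := hbit i
        have h2 := Nat.div_le_self (h.arr .cnt i) l
        have h3 := hb.2 .cnt i
        simp only [lt_irrefl, if_false]
        omega
      · exact hTg.sound.base_congr (fun _ _ => rfl) fun j hj => (hTg.base j hj).symm
      · rintro k hk ⟨hbk, hSk, hCk⟩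
        have hadd : ∀ p < Q, addJob (fun p => 2 * N p + if p < i then h.arr .cnt p / l % 2 else 0)
            i p = 2 * N p + if p < i + 1 then h.arr .cnt p / l % 2 else 0 := by
          intro p _
          unfold addJob
          dsimp only
          rcases lt_trichotomy p i with hp | rfl | hp
          · rw [if_pos hp, if_neg hp.ne, if_pos (by omega), add_zero]
          · rw [if_neg (lt_irrefl _), if_pos rfl, if_pos (by omega), hbi, add_zero]
          · rw [if_neg (by omega), if_neg (by omega), if_neg (by omega)]
        refine ⟨hbk, ?_, hSk.base_congr hadd hTg.base, ?_⟩
        · rw [hk.arr .base rfl]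
          exact hTg.base
        · refine Complete.mono (e := Q - (i + 1)) ?_ hadd le_rfl
          intro z hz hnear hx
          obtain ⟨z', hz', i', hi', hv, hz1, hz2⟩ := exists_add hQ hi (by omega)
            (show Complete m Q _ (windowBase m Q c') c' (Q - (i + 1) + 1) (g.arr .flag) by
              rw [show Q - (i + 1) + 1 = Q - i by omega]
              exact hTg.complete) hz hnear hx
          have := hCk z' hz' i' hi' hv hz1
          rwa [hz2] at this
    · have hbi : h.arr .cnt i / l % 2 = 0 := by omega
      have hsame : ∀ p < Q, 2 * N p + (if p < i then h.arr .cnt p / l % 2 else 0) =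
          2 * N p + if p < i + 1 then h.arr .cnt p / l % 2 else 0 := by
        intro p _
        rcases lt_trichotomy p i with hp | rfl | hp
        · rw [if_pos hp, if_pos (by omega)]
        · rw [if_neg (lt_irrefl _), if_pos (by omega), hbi]
        · rw [if_neg (by omega), if_neg (by omega)]
      exact ⟨hbg.setVar .pp hiV, hTg.base, hTg.sound.base_congr hsame fun _ _ => rfl,
        hTg.complete.mono hsame (by omega)⟩
  · rintro g hf ⟨_, hTg⟩
    rw [htypes] at hTg
    have hsame : ∀ p < Q, 2 * N p + (if p < Q then h.arr .cnt p / l % 2 else 0) =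
        h.arr .cnt p / l := fun p hp => by rw [if_pos hp, hbit]
    exact ⟨(hf.var .lpow rfl).trans hl₃, hTg.base, hTg.sound.base_congr hsame fun _ _ => rfl,
      hTg.complete.mono hsame (by omega)⟩

theorem decideTarget_spec (hm : 0 < m) (hQ : 0 < Q) (hV : Fits V β m Q) (hE : Env m Q h)
    (hb : h.Bounded V) (hK : h.var .levels ≤ β .kk) (hpow : h.var .pow = 2 ^ h.var .levels)
    (hcnt : ∀ p < Q, h.arr .cnt p < 2 ^ h.var .levels) :
    Tri V β (decideTarget m) h fun g =>
      (0 < g.var .ok ∧ g.var .centre < tableSize m Q ∧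
        IsWit m Q (h.arr .cnt) (h.arr .tgt) (rowOf m Q (g.arr .wit) (g.var .centre))) ∨
      (g.var .ok = 0 ∧ ¬ ∃ x, IsWit m Q (h.arr .cnt) (h.arr .tgt) x) := by
  set K := h.var .levels with hKdef
  rw [decideTarget, tri_seq, tri_assign, eval_var, hpow]
  have hpV : 2 ^ K ≤ V := hpow ▸ hb.1 .pow
  refine ⟨hpV, ?_⟩
  have hb₁ := hb.setVar .lpow hpV
  have hE₁ : Env m Q (h.setVar .lpow (2 ^ K)) := hE.setVar _ (by decide)
  set h₁ := h.setVar .lpow (2 ^ K) with hh₁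
  have hl₁ : h₁.var .lpow = 2 ^ K := by simp [hh₁]
  rw [tri_seq]
  refine ((setBase_spec hV hE₁ hb₁).bounded hV.le hb₁).mono ?_
  rintro h₂ hf₂ ⟨hb₂, _, hba⟩
  rw [hl₁] at hba
  have hE₂ : Env m Q h₂ := hE₁.frame hf₂ rfl
  rw [tri_seq]
  refine ((initTable_spec hV hE₂).bounded hV.le hb₂).mono ?_
  rintro h₃ hf₃ ⟨hb₃, hini⟩
  have hE₃ : Env m Q h₃ := hE₂.frame hf₃ rfl
  have hcn₃ : h₃.arr .cnt = h.arr .cnt := (hf₃.arr .cnt rfl).trans (hf₂.arr .cnt rfl)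
  have htg₃ : h₃.arr .tgt = h.arr .tgt := (hf₃.arr .tgt rfl).trans (hf₂.arr .tgt rfl)
  have hl₃ : h₃.var .lpow = 2 ^ K := ((hf₃.var .lpow rfl).trans (hf₂.var .lpow rfl)).trans hl₁
  have hK₃ : (var Vr.levels).eval h₃ = K :=
    (hf₃.var .levels rfl).trans (hf₂.var .levels rfl)
  -- the first level has no jobs, so that the empty schedule serves for all cells
  have hT₃ : TableFor m Q (fun p => h.arr .cnt p / 2 ^ K) (fun j => h.arr .tgt j / 2 ^ K) 0 h₃ := by
    refine ⟨fun j hj => ?_, fun z hz _ => ⟨fun p hp => ?_, fun j hj => ?_⟩, fun z hz _ _ => ?_⟩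
    · rw [hf₃.arr .base rfl]
      exact hba j hj
    · rw [Nat.div_eq_of_lt (hcnt p hp), colsum_congr hp (hini z hz).2]
      simp [colsum]
    · rw [coord_congr hm (hini z hz).2]
      simp [coord]
    · rw [(hini z hz).1]
      exact one_ne_zero
  rw [tri_seq]
  refine (tri_loop (fun i g => g.Bounded V ∧ g.var .lpow = 2 ^ (K - i) ∧ TableFor m Q
    (fun p => h.arr .cnt p / 2 ^ (K - i)) (fun j => h.arr .tgt j / 2 ^ (K - i)) 0 g) ?_ ?_ ?_ ?_)
  · rw [hK₃]
    exact hK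
  · exact ⟨hb₃, hl₃, hT₃⟩
  · rintro i g hi hf ⟨hbg, hlg, hTg⟩
    rw [hK₃] at hi
    have hE' : Env m Q (g.setVar .kk i) := (hE₃.frame hf rfl).setVar i (by decide)
    have hiV : i ≤ V := hi.le.trans (hK.trans (hV.le _))
    have hcn : (g.setVar .kk i).arr .cnt = h.arr .cnt := (hf.arr .cnt rfl).trans hcn₃
    have htg : (g.setVar .kk i).arr .tgt = h.arr .tgt := (hf.arr .tgt rfl).trans htg₃
    have h2 : 2 ^ (K - i) = 2 * 2 ^ (K - (i + 1)) := by
      rw [← pow_succ']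
      congr 1
      omega
    refine ((nextLevel_spec hm hQ hV hE' (hbg.setVar .kk hiV) (l := 2 ^ (K - (i + 1))) ?_
      ?_).bounded hV.le (hbg.setVar .kk hiV)).mono ?_
    · rw [← h2]
      simpa using hlg
    · rw [hcn, htg, ← h2]
      exact ⟨hTg.base, hTg.sound, hTg.complete⟩
    · rw [hcn, htg]
      exact fun k _ hk => hk
  rintro h₄ hf₄ ⟨hb₄, _, hT₄⟩
  rw [hK₃, Nat.sub_self, pow_zero] at hT₄
  simp only [Nat.div_one] at hT₄
  have hE₄ : Env m Q h₄ := hE₃.frame hf₄ rfl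
  have htg₄ : h₄.arr .tgt = h.arr .tgt := (hf₄.arr .tgt rfl).trans htg₃
  obtain ⟨z, hz, hzenc, hpt⟩ := exists_cell (m := m) (c := h.arr .tgt) (v := h.arr .tgt) hQ
    fun j _ => ⟨Nat.sub_le _ _, Nat.le_add_right _ _⟩
  have hdig : ∀ j < 2 * m, h.arr .tgt j - windowBase m Q (h.arr .tgt) j =
      digit (width m Q) j z := by
    intro j hj
    have := hpt j hj
    unfold point at this
    omega
  rw [tri_seq, tri_assign]
  refine ⟨Nat.zero_le _, ?_⟩
  rw [tri_seq]
  set h₅ := h₄.setVar .centre ((lit 0).eval h₄) with hh₅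
  have hE₅ : Env m Q h₅ := hE₄.setVar _ (by decide)
  refine tri_loop (fun i g => g.var .centre = enc (width m Q) i (fun j => digit (width m Q) j z))
    hV.cc ?_ ?_ ?_
  · simp [hh₅, enc]
  · intro i g hi hf hI
    rw [eval_lit] at hi
    have hE' : Env m Q (g.setVar .cc i) := (hE₅.frame hf rfl).setVar i (by decide)
    have e1 : (g.setVar .cc i).arr .tgt = h.arr .tgt := (hf.arr .tgt rfl).trans htg₄
    have e2 : (g.setVar .cc i).arr .base = h₄.arr .base := hf.arr .base rfl
    have e3 : (g.setVar .cc i).var .centre = g.var .centre := by simp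
    have e4 : (g.setVar .cc i).var .cc = i := by simp
    rw [tri_assign]
    simp only [eval_add, eval_sub, eval_mul, eval_get, eval_var, e1, e2, e3, e4, hI,
      hE'.str i hi, hT₄.base i hi, hdig i hi, ← enc_succ _ _ (fun j => digit (width m Q) j z)]
    refine ⟨?_, by simp⟩
    exact (enc_lt fun j _ => digit_lt (width_pos hQ j) z).le.trans
      ((stride_mono (width_pos hQ) hi).trans hV.size)
  · intro g hf hI
    rw [eval_lit, enc_digit hz] at hI
    have e1 : g.arr .flag = h₄.arr .flag := hf.arr .flag rfl
    have e2 : g.arr .wit = h₄.arr .wit := hf.arr .wit rfl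
    simp only [tri_ite, tri_assign, eval_lit, eval_get, eval_var, e1, hI]
    split_ifs with hfl
    · refine ⟨hV.one, Or.inl ⟨by simp, by simpa [hI] using hz, ?_⟩⟩
      have := hT₄.sound z hz (by omega)
      simpa [hI, e2] using this.mono (fun _ _ => rfl) fun j hj => (hpt j hj).le
    · refine ⟨Nat.zero_le _, Or.inr ⟨by simp, ?_⟩⟩
      rintro ⟨x, hx⟩
      refine hfl (Nat.pos_of_ne_zero (hT₄.complete z hz (fun j hj => ?_)
        ⟨x, hx.mono (fun _ _ => rfl) fun j hj => (hpt j hj).ge⟩))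
      rw [hpt j hj]
      omega

end Levels

/-! ### Reading the input -/

/-- The number of the first `n` jobs that have the type `p`. -/
def typeCount (proc : ℕ → ℕ) (n p : ℕ) : ℕ := ((Finset.range n).filter fun j => proc j = p).card

theorem typeCount_succ (proc : ℕ → ℕ) (n p : ℕ) :
    typeCount proc (n + 1) p = typeCount proc n p + if p = proc n then 1 else 0 := by
  rw [typeCount, Finset.range_add_one, Finset.filter_insert]
  by_cases h : proc n = p
  · rw [if_pos h, Finset.card_insert_of_notMem (by simp), if_pos h.symm, typeCount]
  · rw [if_neg h, if_neg (Ne.symm h), typeCount, add_zero]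

theorem typeCount_le (proc : ℕ → ℕ) (n p : ℕ) : typeCount proc n p ≤ n :=
  (Finset.card_filter_le _ _).trans (Finset.card_range n).le

/-- Compute the largest processing time, the number of jobs of each type, and the number of levels:
the exponent of a power of two that exceeds the sum of the number of jobs and the largest processing
time. -/
def readInput : Stmt :=
  .jobs ::= var .io ;;
  .pmax ::= lit 0 ;;
  loop .jj (var .jobs)
    (ite (var .pmax) (get .proc (var .jj)) (.pmax ::= get .proc (var .jj)) skip) ;;
  .types ::= var .pmax + lit 1 ;;
  loop .jj (var .jobs)
    (put .cnt (get .proc (var .jj)) (get .cnt (get .proc (var .jj)) + lit 1)) ;;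
  .pow ::= lit 1 ;;
  .levels ::= lit 0 ;;
  loop .jj (var .jobs + var .pmax)
    (ite (var .pow) (var .jobs + var .pmax + lit 1)
      (.pow ::= var .pow * lit 2 ;; .levels ::= var .levels + lit 1) skip)

/-- Compute the parameters of the tables. -/
def setParams (m : ℕ) : Stmt :=
  .row ::= lit m * var .types ;;
  .size ::= lit 1 ;;
  .dsize ::= lit 1 ;;
  loop .cc (lit (2 * m))
    (ite (var .cc) (lit m) (put .unit (var .cc) (var .types)) (put .unit (var .cc) (lit 1)) ;;
      put .str (var .cc) (var .size) ;;
      put .dstr (var .cc) (var .dsize) ;;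
      .size ::= var .size * eWidth m (var .cc) ;;
      .dsize ::= var .dsize * (lit (4 * m + 3) * get .unit (var .cc)))

section Input

variable {V : ℕ} {β : Vr → ℕ} {m Q : ℕ} {h : Mem}

theorem readInput_spec {n pm : ℕ} {proc : ℕ → ℕ} (hβ : n + pm ≤ β .jj) (hV : 2 * (n + pm) + 1 ≤ V)
    (hn : 0 < n) (hio : h.var .io = n) (hproc : h.arr .proc = proc)
    (hpm : (Finset.range n).sup proc = pm) (hcnt : ∀ p, h.arr .cnt p = 0) :
    Tri V β readInput h fun g => g.var .jobs = n ∧ g.var .types = pm + 1 ∧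
      (∀ p, g.arr .cnt p = typeCount proc n p) ∧ g.var .pow = 2 ^ g.var .levels ∧
      n + pm < g.var .pow ∧ g.var .pow ≤ 2 * (n + pm) := by
  have hle : ∀ i ≤ n, (Finset.range i).sup proc ≤ pm := fun i hi =>
    hpm ▸ Finset.sup_mono (Finset.range_mono hi)
  simp only [readInput, tri_seq, tri_assign, eval_var, eval_lit, hio]
  refine ⟨by omega, Nat.zero_le _, ?_⟩
  refine tri_loop (fun i g => g.var .pmax = (Finset.range i).sup proc) ?_ (by simp) ?_ ?_
  · simp only [eval_var, Mem.setVar_var, reduceCtorEq, if_false, if_true]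
    omega
  · intro i g hi hf hI
    have hi : i < n := by simpa using hi
    have e1 : g.arr .proc = proc := by
      rw [hf.arr .proc rfl]
      exact hproc
    simp only [tri_ite, tri_assign, tri_skip, eval_var, eval_get, Mem.setVar_var, Mem.setVar_arr,
      reduceCtorEq, if_false, if_true, e1, hI]
    have hsup : (Finset.range (i + 1)).sup proc = proc i ⊔ (Finset.range i).sup proc := by
      rw [Finset.range_add_one, Finset.sup_insert]
    have := hle (i + 1) hi
    rw [hsup] at this ⊢
    split_ifs with hlt
    · refine ⟨?_, (sup_eq_left.2 hlt.le).symm⟩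
      have := le_sup_left.trans this
      omega
    · exact (sup_eq_right.2 (by omega)).symm
  intro h₁ hf₁ hpm₁
  have a1 : h₁.var .jobs = n := by simp [hf₁.var .jobs rfl]
  have a2 : h₁.arr .proc = proc := by
    rw [hf₁.arr .proc rfl]
    exact hproc
  have a3 : h₁.arr .cnt = h.arr .cnt := hf₁.arr .cnt rfl
  have a4 : h₁.var .pmax = pm := by simpa [hpm] using hpm₁
  simp only [eval_add, eval_var, eval_lit, a4]
  refine ⟨by omega, ?_⟩
  refine tri_loop (fun i g => ∀ p, g.arr .cnt p = typeCount proc i p) ?_ ?_ ?_ ?_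
  · simp only [eval_var, Mem.setVar_var, reduceCtorEq, if_false, a1]
    omega
  · intro p
    simp [a3, hcnt, typeCount]
  · intro i g hi hf hI
    have hi : i < n := by simpa [a1] using hi
    have e1 : g.arr .proc = proc := by
      rw [hf.arr .proc rfl]
      exact a2
    have := typeCount_le proc i (proc i)
    simp only [tri_put, eval_add, eval_var, eval_get, eval_lit, Mem.setVar_var, Mem.setVar_arr,
      if_true, e1, hI, Mem.setArr_arr, true_and]
    refine ⟨by omega, fun p => ?_⟩
    rw [typeCount_succ]
    split_ifs with hp
    · rw [hp]
    · rfl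
  intro h₂ hf₂ hcnt₂
  have b1 : h₂.var .jobs = n := by simp [hf₂.var .jobs rfl, a1]
  have b2 : h₂.var .pmax = pm := by simp [hf₂.var .pmax rfl, a4]
  have b3 : h₂.var .types = pm + 1 := by simp [hf₂.var .types rfl]
  have hcnt₂ : ∀ p, h₂.arr .cnt p = typeCount proc n p := by simpa [a1] using hcnt₂
  refine ⟨by omega, Nat.zero_le _, ?_⟩
  have c0 : (var Vr.jobs + var .pmax).eval ((h₂.setVar .pow 1).setVar .levels 0) = n + pm := by
    simp [b1, b2]
  refine tri_loop (fun i g => g.var .pow = 2 ^ g.var .levels ∧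
    (n + pm < g.var .pow ∨ g.var .levels = i) ∧ g.var .levels ≤ i ∧
    g.var .pow ≤ 2 * (n + pm)) ?_ ?_ ?_ ?_
  · rw [c0]
    exact hβ
  · simp
    omega
  · rintro i g hi hf ⟨hI1, hI2, hI3, hI4⟩
    rw [c0] at hi
    have e1 : g.var .jobs = n := by simp [hf.var .jobs rfl, b1]
    have e2 : g.var .pmax = pm := by simp [hf.var .pmax rfl, b2]
    simp only [tri_ite, tri_seq, tri_assign, tri_skip, eval_var, eval_add, eval_mul, eval_lit,
      Mem.setVar_var, reduceCtorEq, if_false, if_true, e1, e2]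
    split_ifs with hlt
    · refine ⟨by omega, by omega, ?_, ?_, by omega, by omega⟩
      · rw [pow_succ, hI1]
      · right
        omega
    · exact ⟨hI1, Or.inl (by omega), by omega, hI4⟩
  · rintro g hf ⟨hI1, hI2, _, hI4⟩
    rw [c0] at hI2
    refine ⟨by simp [hf.var .jobs rfl, b1], by simp [hf.var .types rfl, b3], fun p => ?_, hI1,
      ?_, hI4⟩
    · rw [hf.arr .cnt rfl]
      exact hcnt₂ p
    · rcases hI2 with hI2 | hI2
      · exact hI2
      · rw [hI1, hI2]
        exact Nat.lt_two_pow_self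

theorem setParams_spec (hQ : 0 < Q) (hV : Fits V β m Q) (htypes : h.var .types = Q) :
    Tri V β (setParams m) h (Env m Q) := by
  have hmQ : m * Q ≤ V := hV.qq.trans (hV.le _)
  have hdV : diffSize m Q ≤ V := hV.dd.trans (hV.le _)
  have hQV : Q ≤ V := hV.pp.trans (hV.le _)
  simp only [setParams, tri_seq, tri_assign, eval_mul, eval_var, eval_lit, htypes]
  refine ⟨hmQ, hV.one, hV.one, ?_⟩
  set h₁ := ((h.setVar .row (m * Q)).setVar .size 1).setVar .dsize 1 with hh₁
  refine tri_loop (fun i g => g.var .size = stride (width m Q) i ∧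
    g.var .dsize = stride (dwidth m Q) i ∧ (∀ j < i, g.arr .unit j = unit m Q j) ∧
    (∀ j < i, g.arr .str j = stride (width m Q) j) ∧
    ∀ j < i, g.arr .dstr j = stride (dwidth m Q) j) hV.cc ?_ ?_ ?_
  · simp [hh₁, stride]
  · rintro i g hi hf ⟨hI1, hI2, hI3, hI4, hI5⟩
    rw [eval_lit] at hi
    have e1 : g.var .types = Q := by simp [hf.var .types rfl, hh₁, htypes]
    have hunit : Tri V β (ite (var .cc) (lit m) (put .unit (var .cc) (var .types))
        (put .unit (var .cc) (lit 1))) (g.setVar .cc i) fun k =>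
        k = (g.setVar .cc i).setArr .unit i (unit m Q i) := by
      simp only [tri_ite, tri_put, eval_var, eval_lit, Mem.setVar_var, if_true, reduceCtorEq,
        if_false, e1, unit]
      split_ifs
      · exact ⟨hQV, rfl⟩
      · exact ⟨hV.one, rfl⟩
    rw [tri_seq]
    refine hunit.mono ?_
    rintro k - rfl
    have hs : stride (width m Q) i * ((4 * m + 6) * (Q * unit m Q i)) =
        stride (width m Q) (i + 1) := (stride_succ _ _).symm
    have hd : stride (dwidth m Q) i * ((4 * m + 3) * unit m Q i) =
        stride (dwidth m Q) (i + 1) := (stride_succ _ _).symm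
    simp only [tri_seq, tri_put, tri_assign, eWidth, eval_var, eval_lit, eval_mul, eval_get,
      Mem.setVar_var, Mem.setVar_arr, Mem.setArr_var, Mem.setArr_arr, if_true, reduceCtorEq,
      if_false, false_and, true_and, e1, hI1, hI2, hs, hd]
    have hstr : stride (width m Q) (i + 1) ≤ V :=
      (stride_mono (width_pos hQ) hi).trans hV.size
    have hdstr : stride (dwidth m Q) (i + 1) ≤ V := (stride_mono (dwidth_pos hQ) hi).trans hdV
    refine ⟨(stride_mono (width_pos hQ) (Nat.le_succ i)).trans hstr,
      (stride_mono (dwidth_pos hQ) (Nat.le_succ i)).trans hdstr, hstr, hdstr, ?_, ?_, ?_⟩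
    all_goals
      intro j hj
      split_ifs with hji
      · rw [hji]
    · exact hI3 j (by omega)
    · exact hI4 j (by omega)
    · exact hI5 j (by omega)
  · rintro g hf ⟨hI1, hI2, hI3, hI4, hI5⟩
    exact ⟨by simp [hf.var .types rfl, hh₁, htypes], by simp [hf.var .row rfl, hh₁], hI1, hI2, hI3,
      hI4, hI5⟩

end Input

/-! ### The search for the makespan -/

/-- The bounds for the coordinates of a schedule if the makespan is at most the time in which the
machine `i` processes the load `L`: loads that the machines process within this time, and the
capacities of the machines. -/
def target (m : ℕ) (num den cap : ℕ → ℕ) (i L j : ℕ) : ℕ :=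
  if j < m then L * den i * num j / (num i * den j) else cap (j - m)

/-- The data of the instance on which the search works. -/
structure Ready (m Q K : ℕ) (cnt num den cap : ℕ → ℕ) (h : Mem) : Prop where
  env : Env m Q h
  levels : h.var .levels = K
  pow : h.var .pow = 2 ^ K
  cnt : h.arr .cnt = cnt
  num : h.arr .num = num
  den : h.arr .den = den
  cap : h.arr .cap = cap

/-- The statement leaves the data of the instance alone. -/
def KeepsReady (P : Stmt) : Prop :=
  KeepsEnv P ∧ (P.writesVar .levels || P.writesVar .pow || P.writesArr .cnt || P.writesArr .num ||
    P.writesArr .den || P.writesArr .cap) = false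

theorem Ready.frame {m Q K : ℕ} {cnt num den cap : ℕ → ℕ} {h g : Mem} {P : Stmt}
    (hR : Ready m Q K cnt num den cap h) (hf : Frame P h g) (hP : KeepsReady P) :
    Ready m Q K cnt num den cap g := by
  obtain ⟨hP', hP⟩ := hP
  simp only [Bool.or_eq_false_iff] at hP
  obtain ⟨⟨⟨⟨⟨h1, h2⟩, h3⟩, h4⟩, h5⟩, h6⟩ := hP
  exact ⟨hR.env.frame hf hP', (hf.var _ h1).trans hR.levels, (hf.var _ h2).trans hR.pow,
    (hf.arr _ h3).trans hR.cnt, (hf.arr _ h4).trans hR.num, (hf.arr _ h5).trans hR.den,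
    (hf.arr _ h6).trans hR.cap⟩

/-- Find out whether there is a schedule for the makespan in which the machine `mach` processes the
load `query`. -/
def decideLoad (m : ℕ) : Stmt :=
  loop .ii (lit m)
    (put .tgt (var .ii) (var .query * get .den (var .mach) * get .num (var .ii) /
        (get .num (var .mach) * get .den (var .ii))) ;;
      put .tgt (lit m + var .ii) (get .cap (var .ii))) ;;
  decideTarget m

/-- Binary search for the least load `lo` of the machine `mach`. -/
def findLoad (m : ℕ) : Stmt :=
  .lo ::= lit 0 ;;
  .step ::= var .pow * var .pow ;;
  loop .bb (var .levels + var .levels)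
    (.step ::= var .step / lit 2 ;;
      .query ::= var .lo + var .step - lit 1 ;;
      decideLoad m ;;
      ite (var .ok) (lit 1) (.lo ::= var .lo + var .step) skip)

/-- Make the current machine and load the best ones. -/
def setBest : Stmt :=
  .found ::= lit 1 ;; .bestLoad ::= var .query ;; .bestMach ::= var .mach

/-- Find a machine and a load that describe the least makespan of a schedule. -/
def search (m : ℕ) : Stmt :=
  .found ::= lit 0 ;;
  loop .ss (lit m)
    (.mach ::= var .ss ;;
      findLoad m ;;
      .query ::= var .lo ;;
      decideLoad m ;;
      ite (lit 0) (var .ok)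
        (ite (var .found) (lit 1)
          setBest
          (ite (var .query * get .den (var .mach) * get .num (var .bestMach))
              (var .bestLoad * get .den (var .bestMach) * get .num (var .mach))
            setBest skip))
        skip)

section Search

variable {V : ℕ} {β : Vr → ℕ} {m Q K : ℕ} {cnt num den cap : ℕ → ℕ} {h : Mem}

/-- The numbers that arise in the search are small enough. -/
structure SearchFits (V : ℕ) (β : Vr → ℕ) (m Q K : ℕ) (cnt num den : ℕ → ℕ) : Prop where
  fits : Fits V β m Q
  kk : K ≤ β .kk
  bb : 2 * K ≤ β .bb
  ss : m ≤ β .ss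
  pow : 2 ^ K * 2 ^ K ≤ V
  cnt : ∀ p < Q, cnt p < 2 ^ K
  load : ∀ i < m, ∀ j < m, ∀ L < 2 ^ K * 2 ^ K, L * den i * num j ≤ V

/-- There is a schedule for the makespan in which the machine `i` processes the load `L`. -/
def Feas (m Q : ℕ) (cnt num den cap : ℕ → ℕ) (i L : ℕ) : Prop :=
  ∃ x, IsWit m Q cnt (target m num den cap i L) x

theorem Feas.mono {i L L' : ℕ} (hL : L ≤ L') (hF : Feas m Q cnt num den cap i L) :
    Feas m Q cnt num den cap i L' := by
  obtain ⟨x, hx⟩ := hF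
  refine ⟨x, hx.mono (fun _ _ => rfl) fun j _ => ?_⟩
  unfold target
  split_ifs
  · exact Nat.div_le_div_right (Nat.mul_le_mul_right _ (Nat.mul_le_mul_right _ hL))
  · exact le_rfl

theorem decideLoad_spec (hm : 0 < m) (hQ : 0 < Q) (hV : SearchFits V β m Q K cnt num den)
    (hR : Ready m Q K cnt num den cap h) (hb : h.Bounded V) {i L : ℕ} (hi : i < m)
    (hL : L < 2 ^ K * 2 ^ K) (hmach : h.var .mach = i) (hquery : h.var .query = L) :
    Tri V β (decideLoad m) h fun g =>
      (0 < g.var .ok ∧ IsWit m Q cnt (target m num den cap i L)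
        (rowOf m Q (g.arr .wit) (g.var .centre))) ∨
      (g.var .ok = 0 ∧ ¬ Feas m Q cnt num den cap i L) := by
  rw [decideLoad, tri_seq]
  refine tri_loop_bounded hV.fits.le hb (fun r g => (∀ j < r, g.arr .tgt j =
      target m num den cap i L j) ∧ ∀ j < r, g.arr .tgt (m + j) = target m num den cap i L (m + j))
    hV.fits.ii (by simp) ?_ ?_
  · rintro r g hr hf - ⟨hI1, hI2⟩
    rw [eval_lit] at hr
    have hRg := hR.frame hf ⟨rfl, rfl⟩
    have e1 : g.var .mach = i := (hf.var .mach rfl).trans hmach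
    have e2 : g.var .query = L := (hf.var .query rfl).trans hquery
    have ht1 : target m num den cap i L r = L * den i * num r / (num i * den r) := if_pos hr
    have ht2 : target m num den cap i L (m + r) = cap r := by simp [target]
    simp only [tri_seq, tri_put, eval_get, eval_var, eval_div, eval_mul, eval_add, eval_lit,
      Mem.setVar_var, Mem.setVar_arr, Mem.setArr_arr, Mem.setArr_var, if_true, reduceCtorEq,
      if_false, false_and, true_and, hRg.num, hRg.den, hRg.cap, e1, e2, ← ht1]
    refine ⟨?_, ?_, fun j hj => ?_, fun j hj => ?_⟩
    · rw [ht1]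
      exact (Nat.div_le_self _ _).trans (hV.load i hi r hr L hL)
    · rw [← hR.cap]
      exact hb.2 _ _
    · rw [if_neg (by omega)]
      split_ifs with hjr
      · rw [hjr]
      · exact hI1 j (by omega)
    · split_ifs with h1 h2
      · rw [h1, ht2]
      · omega
      · exact hI2 j (by omega)
  · rintro g hf hbg ⟨hI1, hI2⟩
    rw [eval_lit] at hI1 hI2
    have hRg := hR.frame hf ⟨rfl, rfl⟩
    have htgt : ∀ j < 2 * m, g.arr .tgt j = target m num den cap i L j := by
      intro j hj
      rcases lt_or_ge j m with hjm | hjm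
      · exact hI1 j hjm
      · have := hI2 (j - m) (by omega)
        rwa [Nat.add_sub_cancel' hjm] at this
    refine (decideTarget_spec hm hQ hV.fits hRg.env hbg (by rw [hRg.levels]; exact hV.kk)
      (by rw [hRg.levels, hRg.pow]) (by rw [hRg.levels, hRg.cnt]; exact hV.cnt)).mono ?_
    rw [hRg.cnt]
    rintro k hk (⟨h1, _, h3⟩ | ⟨h1, h2⟩)
    · exact Or.inl ⟨h1, h3.mono (fun _ _ => rfl) fun j hj => (htgt j hj).le⟩
    · refine Or.inr ⟨h1, fun ⟨x, hx⟩ => h2 ⟨x, hx.mono (fun _ _ => rfl) fun j hj => (htgt j hj).ge⟩⟩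

theorem findLoad_spec (hm : 0 < m) (hQ : 0 < Q) (hV : SearchFits V β m Q K cnt num den)
    (hR : Ready m Q K cnt num den cap h) (hb : h.Bounded V) {i : ℕ} (hi : i < m)
    (hmach : h.var .mach = i) :
    Tri V β (findLoad m) h fun g => g.var .lo < 2 ^ K * 2 ^ K ∧
      (∀ L < g.var .lo, ¬ Feas m Q cnt num den cap i L) ∧
      ((∃ L < 2 ^ K * 2 ^ K, Feas m Q cnt num den cap i L) →
        Feas m Q cnt num den cap i (g.var .lo)) := by
  have hpos : 0 < 2 ^ K * 2 ^ K := by positivity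
  simp only [findLoad, tri_seq, tri_assign, eval_lit, eval_mul, eval_var, Mem.setVar_var,
    reduceCtorEq, if_false, hR.pow]
  refine ⟨Nat.zero_le _, hV.pow, ?_⟩
  set h₁ := (h.setVar .lo 0).setVar .step (2 ^ K * 2 ^ K) with hh₁
  have hb₁ : h₁.Bounded V := (hb.setVar _ (Nat.zero_le _)).setVar _ hV.pow
  have hR₁ : Ready m Q K cnt num den cap h₁ :=
    ⟨(hR.env.setVar _ (by decide)).setVar _ (by decide), by simp [hh₁, hR.levels],
      by simp [hh₁, hR.pow], hR.cnt, hR.num, hR.den, hR.cap⟩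
  have hK : (var Vr.levels + var .levels).eval h₁ = 2 * K := by
    rw [eval_add, eval_var, hR₁.levels, two_mul]
  -- the least load, if there is one, lies between `lo` and `lo + step - 1`
  refine tri_loop_bounded hV.fits.le hb₁ (fun b g => g.var .step = 2 ^ (2 * K - b) ∧
    g.var .lo + g.var .step ≤ 2 ^ K * 2 ^ K ∧
    (∀ L < g.var .lo, ¬ Feas m Q cnt num den cap i L) ∧
      ((∃ L < 2 ^ K * 2 ^ K, Feas m Q cnt num den cap i L) →
        Feas m Q cnt num den cap i (g.var .lo + g.var .step - 1))) ?_ ?_ ?_ ?_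
  · rw [hK]
    exact hV.bb
  · refine ⟨by simp [hh₁, two_mul, pow_add], by simp [hh₁], by simp [hh₁], ?_⟩
    rintro ⟨L, hL, hF⟩
    refine hF.mono ?_
    simp only [hh₁, Mem.setVar_var, reduceCtorEq, if_true, if_false]
    omega
  · rintro b g hbK hf hbg ⟨hI1, hI2, hI3, hI4⟩
    rw [hK] at hbK
    have hRg : Ready m Q K cnt num den cap (g.setVar .bb b) := by
      have := hR₁.frame hf ⟨rfl, rfl⟩
      exact ⟨this.env.setVar _ (by decide), by simp [this.levels], by simp [this.pow], this.cnt,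
        this.num, this.den, this.cap⟩
    have hhalf : 2 ^ (2 * K - b) / 2 = 2 ^ (2 * K - (b + 1)) := by
      rw [show 2 * K - b = (2 * K - (b + 1)) + 1 by omega, pow_succ, Nat.mul_div_cancel _ two_pos]
    have hdbl : 2 ^ (2 * K - b) = 2 * 2 ^ (2 * K - (b + 1)) := by
      rw [← pow_succ']
      congr 1
      omega
    have hs0 : 0 < 2 ^ (2 * K - (b + 1)) := by positivity
    simp only [tri_seq, tri_assign, eval_lit, eval_div, eval_sub, eval_add, eval_var,
      Mem.setVar_var, reduceCtorEq, if_false, if_true, hI1, hhalf]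
    rw [hI1, hdbl] at hI2 hI4
    set s := 2 ^ (2 * K - (b + 1)) with hs
    have hpV := hV.pow
    refine ⟨by omega, by omega, ?_⟩
    set g₁ := ((g.setVar .bb b).setVar .step s).setVar .query (g.var .lo + s - 1) with hg₁
    have hRg₁ : Ready m Q K cnt num den cap g₁ :=
      ⟨(hRg.env.setVar _ (by decide)).setVar _ (by decide), by simp [hg₁, ← hRg.levels],
        by simp [hg₁, ← hRg.pow], hRg.cnt, hRg.num, hRg.den, hRg.cap⟩
    have hbg₁ : g₁.Bounded V := (hbg.setVar _ (by omega)).setVar _ (by omega)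
    refine (decideLoad_spec hm hQ hV hRg₁ hbg₁ hi (L := g.var .lo + s - 1) (by omega) ?_
      (by simp [hg₁])).mono ?_
    · simp [hg₁, hf.var .mach rfl, hh₁, hmach]
    · intro k hk hdec
      have k1 : k.var .lo = g.var .lo := by simp [hk.var .lo rfl, hg₁]
      have k2 : k.var .step = s := by simp [hk.var .step rfl, hg₁]
      simp only [tri_ite, tri_assign, tri_skip, eval_lit, eval_add, eval_var, Mem.setVar_var,
        reduceCtorEq, if_false, if_true, k1, k2]
      split_ifs with hok
      · obtain ⟨h1, _⟩ | ⟨_, hnot⟩ := hdec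
        · omega
        refine ⟨by omega, trivial, by omega, fun L hL hF => hnot (hF.mono (by omega)),
          fun hex => ?_⟩
        have := hI4 hex
        rwa [show g.var .lo + 2 * s - 1 = g.var .lo + s + s - 1 by omega] at this
      · obtain ⟨_, hx⟩ | ⟨h1, _⟩ := hdec
        · exact ⟨trivial, by omega, hI3, fun _ => ⟨_, hx⟩⟩
        · omega
  · rintro g hf hbg ⟨hI1, hI2, hI3, hI4⟩
    rw [hK, Nat.sub_self, pow_zero] at hI1
    rw [hI1] at hI2 hI4
    exact ⟨by omega, hI3, hI4⟩

theorem cross_le_trans {a b c x y z : ℕ} (hy : 0 < y) (h1 : a * y ≤ b * x) (h2 : b * z ≤ c * y) :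
    a * z ≤ c * x := by
  refine Nat.le_of_mul_le_mul_left ?_ hy
  calc y * (a * z) = a * y * z := by ring
    _ ≤ b * x * z := Nat.mul_le_mul_right _ h1
    _ = b * z * x := by ring
    _ ≤ c * y * x := Nat.mul_le_mul_right _ h2
    _ = y * (c * x) := by ring

/-- The state of the search when the machines below `r` are done. -/
def SearchInv (m Q K : ℕ) (cnt num den cap : ℕ → ℕ) (r : ℕ) (g : Mem) : Prop :=
  (g.var .found = 0 ∧ ∀ i < r, ∀ L < 2 ^ K * 2 ^ K, ¬ Feas m Q cnt num den cap i L) ∨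
  (g.var .found = 1 ∧ g.var .bestMach < m ∧ g.var .bestLoad < 2 ^ K * 2 ^ K ∧
    Feas m Q cnt num den cap (g.var .bestMach) (g.var .bestLoad) ∧
    ∀ i < r, ∀ L < 2 ^ K * 2 ^ K, Feas m Q cnt num den cap i L →
      g.var .bestLoad * den (g.var .bestMach) * num i ≤ L * den i * num (g.var .bestMach))

theorem search_spec (hm : 0 < m) (hQ : 0 < Q) (hV : SearchFits V β m Q K cnt num den)
    (hnum : ∀ i < m, 0 < num i) (hR : Ready m Q K cnt num den cap h) (hb : h.Bounded V) :
    Tri V β (search m) h (SearchInv m Q K cnt num den cap m) := by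
  rw [search, tri_seq, tri_assign]
  refine ⟨Nat.zero_le _, ?_⟩
  have hb₁ : (h.setVar .found ((lit 0).eval h)).Bounded V := hb.setVar _ (Nat.zero_le _)
  have hR₁ : Ready m Q K cnt num den cap (h.setVar .found ((lit 0).eval h)) :=
    ⟨hR.env.setVar _ (by decide), by simp [hR.levels], by simp [hR.pow], hR.cnt, hR.num, hR.den,
      hR.cap⟩
  refine tri_loop_bounded hV.fits.le hb₁ (SearchInv m Q K cnt num den cap) hV.ss ?_ ?_ ?_
  · exact Or.inl ⟨by simp, by simp⟩
  · intro i g hi hf hbg hI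
    rw [eval_lit] at hi
    have hRg : Ready m Q K cnt num den cap ((g.setVar .ss i).setVar .mach i) := by
      have := hR₁.frame hf ⟨rfl, rfl⟩
      exact ⟨(this.env.setVar _ (by decide)).setVar _ (by decide), by simp [this.levels],
        by simp [this.pow], this.cnt, this.num, this.den, this.cap⟩
    have hiV : i ≤ V := hi.le.trans (hV.ss.trans (hV.fits.le _))
    rw [tri_seq, tri_assign]
    simp only [eval_var, Mem.setVar_var, if_true]
    refine ⟨hiV, ?_⟩
    have hbg' := hbg.setVar .mach hiV
    rw [tri_seq]
    refine ((findLoad_spec hm hQ hV hRg hbg' hi (by simp)).bounded hV.fits.le hbg').mono ?_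
    rintro k hk ⟨hbk, hk1, hk2, hk3⟩
    have hRk := hRg.frame hk ⟨rfl, rfl⟩
    set L := k.var .lo with hL
    rw [tri_seq, tri_assign]
    simp only [eval_var]
    have hLV : L ≤ V := hk1.le.trans hV.pow
    refine ⟨hLV, ?_⟩
    rw [← hL]
    have hbk' := hbk.setVar .query hLV
    have hRk' : Ready m Q K cnt num den cap (k.setVar .query L) :=
      ⟨hRk.env.setVar _ (by decide), by simp [hRk.levels], by simp [hRk.pow], hRk.cnt, hRk.num,
        hRk.den, hRk.cap⟩
    have hkm : (k.setVar .query L).var .mach = i := by simp [hk.var .mach rfl]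
    rw [tri_seq]
    refine (decideLoad_spec hm hQ hV hRk' hbk' hi hk1 hkm (by simp)).mono ?_
    intro l hl hdec
    have hRl := hRk'.frame hl ⟨rfl, rfl⟩
    have l1 : l.var .found = g.var .found := by simp [hl.var .found rfl, hk.var .found rfl]
    have l2 : l.var .bestLoad = g.var .bestLoad := by
      simp [hl.var .bestLoad rfl, hk.var .bestLoad rfl]
    have l3 : l.var .bestMach = g.var .bestMach := by
      simp [hl.var .bestMach rfl, hk.var .bestMach rfl]
    have l4 : l.var .mach = i := (hl.var .mach rfl).trans hkm
    have l5 : l.var .query = L := by simp [hl.var .query rfl]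
    -- `L` is the least load of the machine `i`
    have hleast : ∀ L', Feas m Q cnt num den cap i L' → L ≤ L' := fun L' hF =>
      not_lt.1 fun hlt => hk2 L' hlt hF
    -- the machine `i` becomes the best one
    have hset : Feas m Q cnt num den cap i L → (∀ i' < i, ∀ L' < 2 ^ K * 2 ^ K,
        Feas m Q cnt num den cap i' L' → L * den i * num i' ≤ L' * den i' * num i) →
        Tri V β setBest l (SearchInv m Q K cnt num den cap (i + 1)) := by
      intro hF hbest
      simp only [setBest, tri_seq, tri_assign, eval_lit, eval_var, Mem.setVar_var, reduceCtorEq,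
        if_false, l4, l5]
      refine ⟨hV.fits.one, hLV, hiV, Or.inr ⟨by simp, by simpa using hi, by simpa using hk1,
        by simpa using hF, ?_⟩⟩
      simp only [Mem.setVar_var, reduceCtorEq, if_false, if_true]
      intro i' hi' L' hL' hF'
      rcases Nat.lt_succ_iff_lt_or_eq.1 hi' with hi' | rfl
      · exact hbest i' hi' L' hL' hF'
      · exact Nat.mul_le_mul_right _ (Nat.mul_le_mul_right _ (hleast L' hF'))
    simp only [tri_ite, tri_skip, eval_lit, eval_var, eval_mul, eval_get, l1, l2, l3, l4, l5,
      hRl.num, hRl.den]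
    split_ifs with c1 c2 c3
    · obtain ⟨_, hx⟩ | ⟨h1, _⟩ := hdec
      · obtain ⟨hf0, hI⟩ | ⟨hf1, _⟩ := hI
        · exact hset ⟨_, hx⟩ fun i' hi' L' hL' hF' => absurd hF' (hI i' hi' L' hL')
        · omega
      · omega
    · obtain ⟨_, hx⟩ | ⟨h1, _⟩ := hdec
      · obtain ⟨hf0, _⟩ | ⟨hf1, hbm, hbl, _, hI⟩ := hI
        · omega
        · exact hset ⟨_, hx⟩ fun i' hi' L' hL' hF' =>
            cross_le_trans (hnum _ hbm) c3.le (hI i' hi' L' hL' hF')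
      · omega
    · obtain ⟨hf0, _⟩ | ⟨hf1, hbm, hbl, hF, hI⟩ := hI
      · omega
      · refine Or.inr ⟨l1.trans hf1, by rw [l3]; exact hbm, by rw [l2]; exact hbl,
          by rw [l2, l3]; exact hF, fun i' hi' L' hL' hF' => ?_⟩
        rw [l2, l3]
        rcases Nat.lt_succ_iff_lt_or_eq.1 hi' with hi' | rfl
        · exact hI i' hi' L' hL' hF'
        · exact (not_lt.1 c3).trans
            (Nat.mul_le_mul_right _ (Nat.mul_le_mul_right _ (hleast L' hF')))
    · obtain ⟨h1, _⟩ | ⟨_, hnot⟩ := hdec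
      · omega
      · have hnone : ∀ L' < 2 ^ K * 2 ^ K, ¬ Feas m Q cnt num den cap i L' :=
          fun L' hL' hF' => hnot (hk3 ⟨L', hL', hF'⟩)
        obtain ⟨hf0, hI⟩ | ⟨hf1, hbm, hbl, hF, hI⟩ := hI
        · refine Or.inl ⟨l1.trans hf0, fun i' hi' L' hL' => ?_⟩
          rcases Nat.lt_succ_iff_lt_or_eq.1 hi' with hi' | rfl
          · exact hI i' hi' L' hL'
          · exact hnone L' hL'
        · refine Or.inr ⟨l1.trans hf1, by rw [l3]; exact hbm, by rw [l2]; exact hbl,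
            by rw [l2, l3]; exact hF, fun i' hi' L' hL' hF' => ?_⟩
          rw [l2, l3]
          rcases Nat.lt_succ_iff_lt_or_eq.1 hi' with hi' | rfl
          · exact hI i' hi' L' hL' hF'
          · exact absurd hF' (hnone L' hL')
  · intro g _ _ hI
    exact hI

end Search

/-! ### Distributing the jobs -/

/-- The index of the cell that holds the number of jobs of the type of the job `jj` that are still
to be given to the machine `ii`. -/
def eEntry : Exp := var .centre * var .row + (var .ii * var .types + get .proc (var .jj))

/-- Give each job to a machine for which the schedule in the row `centre` of the table still
provides a job of its type. -/
def distribute (m : ℕ) : Stmt :=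
  loop .jj (var .jobs)
    (.used ::= lit 0 ;;
      loop .ii (lit m)
        (ite (var .used) (lit 1)
          (ite (lit 0) (get .wit eEntry)
            (put .out (var .jj) (var .ii) ;;
              put .wit eEntry (get .wit eEntry - lit 1) ;;
              .used ::= lit 1)
            skip)
          skip))

/-- The number of the first `n` jobs that have the type `p` and are on the machine `i`. -/
def placed (out proc : ℕ → ℕ) (n i p : ℕ) : ℕ :=
  ((Finset.range n).filter fun j => out j = i ∧ proc j = p).card

theorem placed_succ (out proc : ℕ → ℕ) (n i p : ℕ) : placed out proc (n + 1) i p =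
    placed out proc n i p + if i = out n ∧ p = proc n then 1 else 0 := by
  rw [placed, Finset.range_add_one, Finset.filter_insert]
  by_cases h : out n = i ∧ proc n = p
  · rw [if_pos h, Finset.card_insert_of_notMem (by simp), if_pos ⟨h.1.symm, h.2.symm⟩, placed]
  · rw [if_neg h, if_neg fun h' => h ⟨h'.1.symm, h'.2.symm⟩, placed, add_zero]

theorem placed_congr {out out' proc : ℕ → ℕ} {n : ℕ} (h : ∀ j < n, out j = out' j) (i p : ℕ) :
    placed out proc n i p = placed out' proc n i p := by
  unfold placed
  congr 1
  refine Finset.filter_congr fun j hj => ?_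
  rw [h j (Finset.mem_range.1 hj)]

theorem sum_placed {out proc : ℕ → ℕ} {m n : ℕ} (h : ∀ j < n, out j < m) (p : ℕ) :
    ∑ i ∈ Finset.range m, placed out proc n i p = typeCount proc n p := by
  rw [typeCount, Finset.card_eq_sum_card_fiberwise (f := out) (t := Finset.range m)]
  · refine Finset.sum_congr rfl fun i _ => ?_
    rw [placed, Finset.filter_filter]
    congr 1
    exact Finset.filter_congr fun j _ => and_comm
  · intro j hj
    have := Finset.mem_filter.1 (Finset.mem_coe.1 hj)
    exact Finset.mem_coe.2 (Finset.mem_range.2 (h j (Finset.mem_range.1 this.1)))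

theorem typeCount_mono (proc : ℕ → ℕ) (p : ℕ) : Monotone fun n => typeCount proc n p :=
  fun _ _ h => Finset.card_le_card (Finset.filter_subset_filter _ (Finset.range_mono h))

section Distribute

variable {V : ℕ} {β : Vr → ℕ} {m Q n : ℕ} {proc : ℕ → ℕ} {h : Mem}

/-- The first `j` jobs are on machines, in accordance with the schedule `x`, and the array `wit`
holds the rest of this schedule in the row `c`. -/
structure Distributed (m Q : ℕ) (proc : ℕ → ℕ) (c : ℕ) (x : ℕ → ℕ) (j : ℕ) (g : Mem) : Prop where
  lt : ∀ j' < j, g.arr .out j' < m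
  rest : ∀ i < m, ∀ p < Q,
    rowOf m Q (g.arr .wit) c (i * Q + p) + placed (g.arr .out) proc j i p = x (i * Q + p)

theorem distribute_spec (hV : Fits V β m Q) (hE : Env m Q h) (hb : h.Bounded V)
    (hβ : n ≤ β .jj) (hjobs : h.var .jobs = n) (hproc : h.arr .proc = proc)
    (hQ : ∀ j < n, proc j < Q)
    (hcol : ∀ p < Q, colsum m Q p (rowOf m Q (h.arr .wit) (h.var .centre)) = typeCount proc n p) :
    Tri V β (distribute m) h
      (Distributed m Q proc (h.var .centre) (rowOf m Q (h.arr .wit) (h.var .centre)) n) := by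
  set c := h.var .centre with hc
  set x := rowOf m Q (h.arr .wit) c with hx
  have hn : (var Vr.jobs).eval h = n := hjobs
  refine tri_loop_bounded hV.le hb (Distributed m Q proc c x) (by rw [hn]; exact hβ)
    ⟨by simp, by simp [placed, hx]⟩ ?_ fun g _ _ hI => by rwa [hn] at hI
  intro j g hj hf hbg hD
  rw [hn] at hj
  have hp := hQ j hj
  rw [tri_seq, tri_assign]
  refine ⟨Nat.zero_le _, ?_⟩
  have hb₁ : ((g.setVar .jj j).setVar .used 0).Bounded V := hbg.setVar _ (Nat.zero_le _)
  -- some machine still needs a job of the type of `j`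
  have hpos : 0 < colsum m Q (proc j) (rowOf m Q (g.arr .wit) c) := by
    have h1 := Finset.sum_congr rfl fun i hi =>
      hD.rest i (Finset.mem_range.1 hi) (proc j) hp
    rw [Finset.sum_add_distrib, sum_placed hD.lt] at h1
    have h2 := hcol _ hp
    have h3 := typeCount_succ proc j (proc j)
    have h4 : typeCount proc (j + 1) (proc j) ≤ typeCount proc n (proc j) :=
      typeCount_mono proc _ hj
    rw [if_pos rfl] at h3
    simp only [colsum] at h2 ⊢
    omega
  refine tri_loop_bounded hV.le hb₁ (fun i k =>
    (k.var .used = 0 ∧ k.arr .out = g.arr .out ∧ k.arr .wit = g.arr .wit ∧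
      ∀ i' < i, rowOf m Q (g.arr .wit) c (i' * Q + proc j) = 0) ∨
    (k.var .used = 1 ∧ Distributed m Q proc c x (j + 1) k)) hV.ii ?_ ?_ ?_
  · exact Or.inl ⟨by simp, rfl, rfl, by simp⟩
  · intro i k hi hk hbk hI
    rw [eval_lit] at hi
    have e1 : k.var .jj = j := by simp [hk.var .jj rfl]
    have e2 : k.var .centre = c := by simp [hk.var .centre rfl, hf.var .centre rfl, hc]
    have e3 : k.var .row = m * Q := by simp [hk.var .row rfl, hf.var .row rfl, hE.row]
    have e4 : k.var .types = Q := by simp [hk.var .types rfl, hf.var .types rfl, hE.types]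
    have e5 : k.arr .proc = proc := by
      rw [hk.arr .proc rfl]
      exact (hf.arr .proc rfl).trans hproc
    have hentry : eEntry.eval (k.setVar .ii i) = c * (m * Q) + (i * Q + proc j) := by
      simp [eEntry, e1, e2, e3, e4, e5]
    have hiV : i ≤ V := hi.le.trans (hV.ii.trans (hV.le _))
    have hentry' : ∀ v, eEntry.eval ((k.setVar .ii i).setArr .out j v) =
        c * (m * Q) + (i * Q + proc j) := by
      intro v
      simp [eEntry, e1, e2, e3, e4, e5]
    simp only [tri_ite, tri_seq, tri_put, tri_assign, tri_skip, eval_get, eval_var, eval_lit,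
      eval_sub, hentry, hentry', Mem.setVar_var, Mem.setVar_arr, Mem.setArr_arr, reduceCtorEq,
      if_true, if_false, false_and, e1]
    split_ifs with c1 c2
    · obtain ⟨_, h2, h3, _⟩ | ⟨h1, _⟩ := hI
      swap
      · omega
      refine ⟨hiV, (Nat.sub_le _ _).trans (hbk.2 _ _), hV.one, Or.inr ⟨trivial, ?_, ?_⟩⟩
      · intro j' hj'
        simp only [Mem.setVar_arr, Mem.setArr_arr, reduceCtorEq, false_and, if_false, true_and]
        split_ifs with hjj
        · exact hi
        · rw [h2]
          exact hD.lt j' (by omega)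
      · intro i' hi' p hp'
        have hrest := hD.rest i' hi' p hp'
        rw [placed_succ, placed_congr (out' := g.arr .out)]
        · rw [h3] at c2
          simp only [rowOf, Mem.setVar_arr, Mem.setArr_arr, reduceCtorEq, false_and, if_false,
            true_and, if_true, add_right_inj, mul_add_inj hp' hp, h3] at hrest ⊢
          split_ifs with h5
          · obtain ⟨rfl, rfl⟩ := h5
            omega
          · omega
        · intro j' hj'
          simp [h2, hj'.ne]
    · obtain ⟨h1, h2, h3, h4⟩ | ⟨h1, _⟩ := hI
      swap
      · omega
      refine Or.inl ⟨h1, h2, h3, fun i' hi' => ?_⟩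
      rcases Nat.lt_succ_iff_lt_or_eq.1 hi' with hi' | rfl
      · exact h4 i' hi'
      · rw [h3] at c2
        exact Nat.eq_zero_of_not_pos c2
    · obtain ⟨h1, _⟩ | ⟨h1, h2⟩ := hI
      · omega
      · exact Or.inr ⟨h1, h2.1, h2.2⟩
  · intro k _ _ hI
    rw [eval_lit] at hI
    obtain ⟨_, _, _, h4⟩ | ⟨_, h2⟩ := hI
    · rw [colsum, Finset.sum_eq_zero fun i hi => h4 i (Finset.mem_range.1 hi)] at hpos
      omega
    · exact h2

end Distribute

/-! ### The program -/

/-- Find a schedule of minimum makespan. -/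
def main (m : ℕ) : Stmt :=
  readInput ;;
  setParams m ;;
  search m ;;
  ite (lit 0) (var .found)
    (.mach ::= var .bestMach ;;
      .query ::= var .bestLoad ;;
      decideLoad m ;;
      distribute m ;;
      .io ::= lit 1)
    (.io ::= lit 0)

/-- The memory holds an instance with `n` jobs. -/
structure Holds (n : ℕ) (proc cap num den : ℕ → ℕ) (h : Mem) : Prop where
  io : h.var .io = n
  proc : h.arr .proc = proc
  cap : h.arr .cap = cap
  num : h.arr .num = num
  den : h.arr .den = den
  cnt : ∀ p, h.arr .cnt p = 0

/-- What the program computes. Loads below `B` are considered. Either no machine has a load for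
which there is a schedule, or the program finds a machine and a load that takes the least time on
it, and a schedule for them. -/
def Solved (m n Q B : ℕ) (proc cap num den : ℕ → ℕ) (g : Mem) : Prop :=
  (g.var .io = 1 ∧ (∀ j < n, g.arr .out j < m) ∧ ∃ i < m, ∃ L x,
    IsWit m Q (typeCount proc n) (target m num den cap i L) x ∧
    (∀ i' < m, ∀ p < Q, placed (g.arr .out) proc n i' p ≤ x (i' * Q + p)) ∧
    ∀ i' < m, ∀ L' < B, Feas m Q (typeCount proc n) num den cap i' L' →
      L * den i * num i' ≤ L' * den i' * num i) ∨
  (g.var .io = 0 ∧ ∀ i < m, ∀ L < B, ¬ Feas m Q (typeCount proc n) num den cap i L)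

theorem main_spec {V : ℕ} {β : Vr → ℕ} {m n pm : ℕ} {proc cap num den : ℕ → ℕ} {h : Mem}
    (hm : 0 < m) (hn : 0 < n) (hpm : (Finset.range n).sup proc = pm) (hnum : ∀ i < m, 0 < num i)
    (hβ : n + pm ≤ β .jj) (hV : 2 * (n + pm) + 1 ≤ V)
    (hfits : ∀ K, n + pm < 2 ^ K → 2 ^ K ≤ 2 * (n + pm) →
      SearchFits V β m (pm + 1) K (typeCount proc n) num den)
    (hb : h.Bounded V) (hh : Holds n proc cap num den h) :
    Tri V β (main m) h fun g =>
      ∃ K, n + pm < 2 ^ K ∧ Solved m n (pm + 1) (2 ^ K * 2 ^ K) proc cap num den g := by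
  have hβV : ∀ x, β x ≤ V := by
    have h1 : n + pm < 2 ^ (Nat.log 2 (n + pm) + 1) := Nat.lt_pow_succ_log_self one_lt_two _
    have h2 : 2 ^ Nat.log 2 (n + pm) ≤ n + pm := Nat.pow_log_le_self 2 (by omega)
    exact (hfits _ h1 (by rw [pow_succ]; omega)).fits.le
  rw [main, tri_seq]
  refine ((readInput_spec hβ hV hn hh.io hh.proc hpm hh.cnt).bounded hβV hb).mono ?_
  rintro h₁ hf₁ ⟨hb₁, hjobs, htypes, hcnt, hpow, hlow, hup⟩
  set K := h₁.var .levels with hK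
  rw [hpow] at hlow hup
  have hS := hfits K hlow hup
  rw [tri_seq]
  refine ((setParams_spec (Nat.succ_pos _) hS.fits htypes).bounded hβV hb₁).mono ?_
  rintro h₂ hf₂ ⟨hb₂, hE₂⟩
  have hR : Ready m (pm + 1) K (typeCount proc n) num den cap h₂ :=
    ⟨hE₂, hf₂.var .levels rfl, (hf₂.var .pow rfl).trans hpow,
      (hf₂.arr .cnt rfl).trans (funext hcnt),
      (hf₂.arr .num rfl).trans ((hf₁.arr .num rfl).trans hh.num),
      (hf₂.arr .den rfl).trans ((hf₁.arr .den rfl).trans hh.den),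
      (hf₂.arr .cap rfl).trans ((hf₁.arr .cap rfl).trans hh.cap)⟩
  rw [tri_seq]
  refine ((search_spec hm (Nat.succ_pos _) hS hnum hR hb₂).bounded hβV hb₂).mono ?_
  rintro h₃ hf₃ ⟨hb₃, hI⟩
  have hR₃ := hR.frame hf₃ ⟨rfl, rfl⟩
  rw [tri_ite]
  by_cases hfound : (lit 0).eval h₃ < (var Vr.found).eval h₃
  · rw [if_pos hfound]
    rw [eval_lit, eval_var] at hfound
    obtain ⟨h0, _⟩ | ⟨_, hbm, hbl, hF, hbest⟩ := hI
    · omega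
    simp only [tri_seq, tri_assign, eval_var, eval_lit, Mem.setVar_var, reduceCtorEq, if_false]
    refine ⟨hb₃.1 _, hb₃.1 _, ?_⟩
    set i := h₃.var .bestMach with hi
    set L := h₃.var .bestLoad with hL
    have hR₄ : Ready m (pm + 1) K (typeCount proc n) num den cap
        ((h₃.setVar .mach i).setVar .query L) :=
      ⟨(hR₃.env.setVar _ (by decide)).setVar _ (by decide), by simp [hR₃.levels],
        by simp [hR₃.pow], hR₃.cnt, hR₃.num, hR₃.den, hR₃.cap⟩
    have hb₄ : ((h₃.setVar .mach i).setVar .query L).Bounded V :=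
      (hb₃.setVar _ (hb₃.1 _)).setVar _ (hb₃.1 _)
    refine ((decideLoad_spec hm (Nat.succ_pos _) hS hR₄ hb₄ hbm hbl (by simp)
      (by simp)).bounded hβV hb₄).mono ?_
    rintro h₅ hf₅ ⟨hb₅, hdec⟩
    have hR₅ := hR₄.frame hf₅ ⟨rfl, rfl⟩
    obtain ⟨_, hx⟩ | ⟨_, hnot⟩ := hdec
    swap
    · exact absurd hF hnot
    refine (distribute_spec hS.fits hR₅.env hb₅ (by omega : n ≤ β .jj) ?_ ?_ ?_
      hx.col).mono ?_
    · rw [hf₅.var .jobs rfl]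
      simp [hf₃.var .jobs rfl, hf₂.var .jobs rfl, hjobs]
    · rw [hf₅.arr .proc rfl]
      exact (hf₃.arr .proc rfl).trans ((hf₂.arr .proc rfl).trans
        ((hf₁.arr .proc rfl).trans hh.proc))
    · intro j hj
      have : proc j ≤ pm := hpm ▸ Finset.le_sup (f := proc) (Finset.mem_range.2 hj)
      omega
    · intro g hg hD
      refine ⟨hS.fits.one, K, hlow, Or.inl ⟨by simp, hD.lt, i, hbm, L, _, hx, ?_, hbest⟩⟩
      intro i' hi' p hp
      exact (Nat.le_add_left _ _).trans (hD.rest i' hi' p hp).le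
  · rw [if_neg hfound]
    rw [eval_lit, eval_var] at hfound
    obtain ⟨_, hnone⟩ | ⟨h1, _⟩ := hI
    · rw [tri_assign]
      exact ⟨Nat.zero_le _, K, hlow, Or.inr ⟨by simp, hnone⟩⟩
    · omega

/-! ### The schedules of an instance -/

section Schedules

variable {m n Q : ℕ} {proc out : ℕ → ℕ}

/-- The sum of the contributions of the jobs on a machine, grouped by types. -/
theorem sum_contrib_placed (hQ : ∀ j < n, proc j < Q) (f : ℕ → ℕ) (i : ℕ) :
    ∑ p ∈ Finset.range Q, f p * placed out proc n i p =
      ∑ j ∈ Finset.range n, if out j = i then f (proc j) else 0 := by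
  induction n with
  | zero => simp [placed]
  | succ n ih =>
    rw [Finset.sum_range_succ, ← ih fun j hj => hQ j (by omega)]
    simp only [placed_succ, mul_add, Finset.sum_add_distrib]
    congr 1
    by_cases h : out n = i
    · simp [h, hQ n (by omega)]
    · simp [h, Ne.symm h]

variable (I : CapInstance m)

/-- The total processing time of the jobs on the machine `i`. -/
def load (σ : Fin I.n → Fin m) (i : Fin m) : ℕ := ∑ j with σ j = i, I.p j

theorem completion_eq (σ : Fin I.n → Fin m) (i : Fin m) :
    I.completion σ i = load I σ i / I.speed i := by
  rw [CapInstance.completion, load, Nat.cast_sum, Finset.sum_div]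

theorem load_le (σ : Fin I.n → Fin m) (i : Fin m) : load I σ i ≤ I.n * I.pmax := by
  calc load I σ i ≤ ∑ j, I.p j := Finset.sum_le_sum_of_subset (Finset.filter_subset _ _)
    _ ≤ ∑ _j : Fin I.n, I.pmax :=
      Finset.sum_le_sum fun j _ => Finset.le_sup (f := I.p) (Finset.mem_univ j)
    _ = _ := by simp

/-- Times are compared by cross-multiplication. -/
theorem div_le_div_speed {q r : ℚ≥0} (hq : 0 < q) (hr : 0 < r) (a b : ℕ) :
    (a : ℚ≥0) / q ≤ b / r ↔ a * q.den * r.num ≤ b * r.den * q.num := by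
  have h1 : (q : ℚ≥0) = q.num / q.den := (NNRat.num_div_den q).symm
  have h2 : (r : ℚ≥0) = r.num / r.den := (NNRat.num_div_den r).symm
  have hq' : 0 < (q.num : ℚ≥0) := by exact_mod_cast NNRat.num_pos.2 hq
  have hr' : 0 < (r.num : ℚ≥0) := by exact_mod_cast NNRat.num_pos.2 hr
  have e1 : (a : ℚ≥0) / q = (a * q.den : ℕ) / (q.num : ℚ≥0) := by
    conv_lhs => rw [h1]
    rw [div_div_eq_mul_div, Nat.cast_mul]
  have e2 : (b : ℚ≥0) / r = (b * r.den : ℕ) / (r.num : ℚ≥0) := by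
    conv_lhs => rw [h2]
    rw [div_div_eq_mul_div, Nat.cast_mul]
  rw [e1, e2, div_le_div_iff₀ hq' hr']
  exact_mod_cast Iff.rfl

open CapInstance (toArr)

theorem toArr_fin {k : ℕ} (f : Fin k → ℕ) (j : Fin k) : toArr f j = f j := by
  rw [toArr, dif_pos j.2]

theorem toArr_lt (j : ℕ) (hj : j < I.n) : toArr I.p j < I.pmax + 1 := by
  rw [toArr, dif_pos hj]
  exact Nat.lt_succ_of_le (Finset.le_sup (f := I.p) (Finset.mem_univ _))

theorem sum_contrib_schedule {σ : Fin I.n → Fin m} (hout : ∀ j : Fin I.n, out j = σ j) (f : ℕ → ℕ)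
    (i : Fin m) : ∑ p ∈ Finset.range (I.pmax + 1), f p * placed out (toArr I.p) I.n i p =
      ∑ j with σ j = i, f (I.p j) := by
  rw [sum_contrib_placed (toArr_lt I), Finset.sum_range, Finset.sum_filter]
  refine Finset.sum_congr rfl fun j _ => ?_
  simp only [hout, toArr_fin, Fin.val_inj]

theorem load_eq {σ : Fin I.n → Fin m} (hout : ∀ j : Fin I.n, out j = σ j) (i : Fin m) :
    ∑ p ∈ Finset.range (I.pmax + 1), contrib m i p * placed out (toArr I.p) I.n i p =
      load I σ i := by
  rw [sum_contrib_schedule I hout, load]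
  exact Finset.sum_congr rfl fun j _ => if_pos i.2

theorem card_eq {σ : Fin I.n → Fin m} (hout : ∀ j : Fin I.n, out j = σ j) (i : Fin m) :
    ∑ p ∈ Finset.range (I.pmax + 1), contrib m (m + i) p * placed out (toArr I.p) I.n i p =
      (Finset.univ.filter fun j => σ j = i).card := by
  rw [sum_contrib_schedule I hout, Finset.card_eq_sum_ones]
  exact Finset.sum_congr rfl fun j _ => if_neg (by omega)

/-- If the makespan of a feasible schedule is attained on the machine `i`, then the schedule is a
witness for the load of this machine. -/
theorem feas_of_feasible {σ : Fin I.n → Fin m} (hσ : I.Feasible σ) {i : Fin m}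
    (hi : ∀ i', I.completion σ i' ≤ I.completion σ i) :
    Feas m (I.pmax + 1) (typeCount (toArr I.p) I.n) (toArr fun i => (I.speed i).num)
      (toArr fun i => (I.speed i).den) (toArr I.cap) i (load I σ i) := by
  set Q := I.pmax + 1 with hQ
  set out := toArr fun j => (σ j : ℕ) with hout
  have hout' : ∀ j : Fin I.n, out j = σ j := toArr_fin _
  have hlt : ∀ j < I.n, out j < m := fun j hj => by
    rw [hout' ⟨j, hj⟩]
    exact (σ _).2
  set x : ℕ → ℕ := fun q => placed out (toArr I.p) I.n (q / Q) (q % Q) with hx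
  have hentry : ∀ i' p, p < Q → x (i' * Q + p) = placed out (toArr I.p) I.n i' p := by
    intro i' p hp
    simp only [hx]
    rw [mul_comm, Nat.mul_add_div (by omega), Nat.div_eq_of_lt hp, Nat.mul_add_mod,
      Nat.mod_eq_of_lt hp, add_zero]
  have hcoord : ∀ j, coord m Q j x =
      ∑ p ∈ Finset.range Q, contrib m j p * placed out (toArr I.p) I.n (j % m) p := fun j =>
    Finset.sum_congr rfl fun p hp => by rw [hentry _ _ (Finset.mem_range.1 hp)]
  refine ⟨x, fun p hp => ?_, fun j hj => ?_⟩
  · rw [← sum_placed hlt]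
    exact Finset.sum_congr rfl fun i' _ => hentry i' p hp
  · rw [hcoord, target]
    split_ifs with hjm
    · rw [Nat.mod_eq_of_lt hjm]
      have h1 := load_eq I hout' ⟨j, hjm⟩
      simp only at h1
      rw [h1, toArr_fin (fun i => (I.speed i).num) i, toArr_fin (fun i => (I.speed i).den) i,
        toArr_fin (fun i => (I.speed i).num) ⟨j, hjm⟩,
        toArr_fin (fun i => (I.speed i).den) ⟨j, hjm⟩]
      have h2 := hi ⟨j, hjm⟩
      rw [completion_eq, completion_eq, div_le_div_speed (I.speed_pos _) (I.speed_pos _)] at h2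
      rw [Nat.le_div_iff_mul_le (Nat.mul_pos (NNRat.num_pos.2 (I.speed_pos _))
        (NNRat.den_pos _))]
      calc _ = load I σ ⟨j, hjm⟩ * (I.speed ⟨j, hjm⟩).den * (I.speed i).num := by ring
        _ ≤ _ := h2
    · have hjm' : j - m < m := by omega
      have h1 := card_eq I hout' ⟨j - m, hjm'⟩
      simp only [Nat.add_sub_cancel' (not_lt.1 hjm)] at h1
      rw [Nat.mod_eq_sub_mod (not_lt.1 hjm), Nat.mod_eq_of_lt hjm', h1,
        toArr_fin I.cap ⟨j - m, hjm'⟩]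
      exact hσ _

/-- A schedule that the program computes for the load `L` of the machine `i` is feasible, and no
machine needs more time than the machine `i` needs for the load `L`. -/
theorem feasible_of_isWit {σ : Fin I.n → Fin m} (hout : ∀ j : Fin I.n, out j = σ j) {i : Fin m}
    {L : ℕ} {N x : ℕ → ℕ}
    (hx : IsWit m (I.pmax + 1) N (target m (toArr fun i => (I.speed i).num)
      (toArr fun i => (I.speed i).den) (toArr I.cap) i L) x)
    (hle : ∀ i' < m, ∀ p < I.pmax + 1,
      placed out (toArr I.p) I.n i' p ≤ x (i' * (I.pmax + 1) + p)) :
    I.Feasible σ ∧ ∀ i', I.completion σ i' ≤ L / I.speed i := by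
  have hcoord : ∀ (i' : Fin m) (c : ℕ), c % m = i' →
      ∑ p ∈ Finset.range (I.pmax + 1), contrib m c p * placed out (toArr I.p) I.n i' p ≤
        coord m (I.pmax + 1) c x := by
    intro i' c hc
    rw [coord, hc]
    exact Finset.sum_le_sum fun p hp =>
      Nat.mul_le_mul_left _ (hle _ i'.2 _ (Finset.mem_range.1 hp))
  refine ⟨fun i' => ?_, fun i' => ?_⟩
  · rw [← card_eq I hout]
    refine (hcoord i' (m + i') (by simp [Nat.mod_eq_of_lt i'.2])).trans
      ((hx.le _ (by omega)).trans ?_)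
    rw [target, if_neg (by omega), Nat.add_sub_cancel_left, toArr_fin]
  · rw [completion_eq, div_le_div_speed (I.speed_pos _) (I.speed_pos _)]
    have h1 := (hcoord i' i' (Nat.mod_eq_of_lt i'.2)).trans (hx.le _ (by omega))
    rw [load_eq I hout, target, if_pos i'.2, toArr_fin (fun i => (I.speed i).num) i,
      toArr_fin (fun i => (I.speed i).den) i, toArr_fin (fun i => (I.speed i).num) i',
      toArr_fin (fun i => (I.speed i).den) i',
      Nat.le_div_iff_mul_le (Nat.mul_pos (NNRat.num_pos.2 (I.speed_pos _))
        (NNRat.den_pos _))] at h1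
    calc _ = load I σ i' * ((I.speed i).num * (I.speed i').den) := by ring
      _ ≤ _ := h1

theorem exists_makespan_eq (hm : 0 < m) (σ : Fin I.n → Fin m) :
    ∃ i, I.makespan σ = I.completion σ i ∧ ∀ i', I.completion σ i' ≤ I.completion σ i := by
  have : Nonempty (Fin m) := ⟨⟨0, hm⟩⟩
  obtain ⟨i, _, hi⟩ := Finset.exists_mem_eq_sup Finset.univ Finset.univ_nonempty (I.completion σ)
  exact ⟨i, hi, fun i' => hi ▸ Finset.le_sup (f := I.completion σ) (Finset.mem_univ i')⟩

/-- The makespan of every feasible schedule is the time that some machine takes for an integral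
load, so that it suffices to consider the machines and their loads. -/
theorem answered_of_solved (hm : 0 < m) {B : ℕ} (hB : I.n * I.pmax < B) {s : WordRAM.State}
    (hs : Solved m I.n (I.pmax + 1) B (toArr I.p) (toArr I.cap) (toArr fun i => (I.speed i).num)
      (toArr fun i => (I.speed i).den) (view s)) : I.Answered s := by
  have hfeas : ∀ τ, I.Feasible τ → ∃ i, I.makespan τ = load I τ i / I.speed i ∧
      Feas m (I.pmax + 1) (typeCount (toArr I.p) I.n) (toArr fun i => (I.speed i).num)
        (toArr fun i => (I.speed i).den) (toArr I.cap) i (load I τ i) := by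
    intro τ hτ
    obtain ⟨i, h1, h2⟩ := exists_makespan_eq I hm τ
    exact ⟨i, h1.trans (completion_eq I τ i), feas_of_feasible I hτ h2⟩
  obtain ⟨hio, hlt, i, hi, L, x, hx, hle, hbest⟩ | ⟨hio, hnone⟩ := hs
  · refine Or.inl ⟨hio, fun j => ⟨(view s).arr .out j, hlt j j.2⟩, ⟨?_, fun τ hτ => ?_⟩,
      fun j => rfl⟩
    · exact (feasible_of_isWit I (i := ⟨i, hi⟩) (fun j => rfl) hx hle).1
    · obtain ⟨i', h1, h2⟩ := hfeas τ hτ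
      have h3 := hbest i' i'.2 _ ((load_le I τ i').trans_lt hB) h2
      rw [toArr_fin (fun i => (I.speed i).num) i', toArr_fin (fun i => (I.speed i).den) i',
        toArr_fin (fun i => (I.speed i).num) ⟨i, hi⟩,
        toArr_fin (fun i => (I.speed i).den) ⟨i, hi⟩,
        ← div_le_div_speed (I.speed_pos _) (I.speed_pos _), ← h1] at h3
      exact (Finset.sup_le fun k _ =>
        (feasible_of_isWit I (i := ⟨i, hi⟩) (fun j => rfl) hx hle).2 k).trans h3
  · refine Or.inr ⟨hio, fun τ hτ => ?_⟩
    obtain ⟨i', _, h2⟩ := hfeas τ hτ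
    exact hnone i' i'.2 _ ((load_le I τ i').trans_lt hB) h2

end Schedules

/-! ### The running time -/

/-- The cost of `P` is at most a constant multiple of `G`, where the loop bounds `β` and the
function `G` depend on a parameter. -/
def InTime {ι : Type} (β : ι → Vr → ℕ) (G : ι → ℕ) (P : Stmt) : Prop :=
  ∃ c, ∀ i, P.cost (β i) ≤ c * G i

section InTime

variable {ι : Type} {β : ι → Vr → ℕ} {F G : ι → ℕ} {P R : Stmt}

theorem inTime_const (hG : ∀ i, 1 ≤ G i) {k : ℕ} (h : ∀ i, P.cost (β i) = k) : InTime β G P :=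
  ⟨k, fun i => by rw [h]; exact Nat.le_mul_of_pos_right _ (hG i)⟩

theorem inTime_assign (hG : ∀ i, 1 ≤ G i) {x : Vr} {e : Exp} : InTime β G (x ::= e) :=
  inTime_const hG fun _ => rfl

theorem inTime_put (hG : ∀ i, 1 ≤ G i) {a : Ar} {e f : Exp} : InTime β G (put a e f) :=
  inTime_const hG fun _ => rfl

theorem inTime_skip (hG : ∀ i, 1 ≤ G i) : InTime β G skip := inTime_const hG fun _ => rfl

theorem InTime.seq (hP : InTime β G P) (hR : InTime β G R) : InTime β G (P ;; R) := by
  obtain ⟨c, hc⟩ := hP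
  obtain ⟨d, hd⟩ := hR
  exact ⟨c + d, fun i => by rw [Stmt.cost, add_mul]; exact add_le_add (hc i) (hd i)⟩

theorem InTime.ite (hG : ∀ i, 1 ≤ G i) (hP : InTime β G P) (hR : InTime β G R) {e f : Exp} :
    InTime β G (ite e f P R) := by
  obtain ⟨c, hc⟩ := hP.seq hR
  refine ⟨e.cost + f.cost + 1 + c, fun i => ?_⟩
  rw [Stmt.cost, add_mul]
  exact add_le_add (Nat.le_mul_of_pos_right _ (hG i)) (hc i)

theorem InTime.loop (hF : ∀ i, 1 ≤ F i) (hG : ∀ i, 1 ≤ G i) (hP : InTime β F P) {x : Vr} {e : Exp}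
    (hx : ∃ k, ∀ i, β i x * F i ≤ k * G i) : InTime β G (loop x e P) := by
  obtain ⟨c, hc⟩ := hP
  obtain ⟨k, hk⟩ := hx
  refine ⟨e.cost + 2 + (c + 5) * k, fun i => ?_⟩
  rw [Stmt.cost, add_mul]
  refine add_le_add (Nat.le_mul_of_pos_right _ (hG i)) ?_
  calc β i x * (P.cost (β i) + 5) ≤ β i x * ((c + 5) * F i) :=
        Nat.mul_le_mul_left _ (by rw [add_mul]; exact add_le_add (hc i) (by have := hF i; omega))
    _ = (c + 5) * (β i x * F i) := by ring
    _ ≤ (c + 5) * (k * G i) := Nat.mul_le_mul_left _ (hk i)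
    _ = _ := by ring

theorem InTime.mono (hP : InTime β F P) (h : ∃ k, ∀ i, F i ≤ k * G i) : InTime β G P := by
  obtain ⟨c, hc⟩ := hP
  obtain ⟨k, hk⟩ := h
  exact ⟨c * k, fun i => (hc i).trans (by
    rw [mul_assoc]
    exact Nat.mul_le_mul_left _ (hk i))⟩

end InTime

theorem prod_unit (m Q : ℕ) : ∏ j ∈ Finset.range (2 * m), unit m Q j = Q ^ m := by
  have h1 : ∀ j ∈ Finset.range m, unit m Q j = Q := fun j hj => if_pos (Finset.mem_range.1 hj)
  have h2 : ∀ j ∈ Finset.range m, unit m Q (m + j) = 1 := fun j _ => if_neg (by omega)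
  rw [two_mul, Finset.prod_range_add, Finset.prod_congr rfl h1, Finset.prod_congr rfl h2]
  simp

theorem tableSize_eq (m Q : ℕ) : tableSize m Q = (4 * m + 6) ^ (2 * m) * Q ^ (3 * m) := by
  simp only [tableSize, stride, width, Finset.prod_mul_distrib, prod_unit, Finset.prod_const,
    Finset.card_range]
  rw [← pow_add]
  congr 2
  ring

theorem diffSize_eq (m Q : ℕ) : diffSize m Q = (4 * m + 3) ^ (2 * m) * Q ^ m := by
  simp only [diffSize, stride, dwidth, Finset.prod_mul_distrib, prod_unit, Finset.prod_const,
    Finset.card_range]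

/-- An upper bound for the number of levels for `n` jobs with processing times at most `pm`. -/
def maxLevels (n pm : ℕ) : ℕ := Nat.log 2 (n + pm) + 1

/-- The bounds on the numbers of rounds of the loops for `n` jobs with processing times at most
`pm`. -/
def rounds (m n pm : ℕ) : Vr → ℕ
  | .jj => n + pm
  | .zz => tableSize m (pm + 1)
  | .dd => diffSize m (pm + 1)
  | .qq => m * (pm + 1)
  | .pp => pm + 1
  | .cc => 2 * m
  | .ii => m
  | .ss => m
  | .kk => maxLevels n pm
  | .bb => 2 * maxLevels n pm
  | _ => 0

section Time

variable (m : ℕ)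

/-- `rounds` as a function of the pair of the number of jobs and the largest processing time. -/
def pairRounds (i : ℕ × ℕ) : Vr → ℕ := rounds m i.1 i.2

/-- The power `k` of the number of types. -/
def typesPow (k : ℕ) (i : ℕ × ℕ) : ℕ := (i.2 + 1) ^ k

theorem one_le_typesPow (k : ℕ) (i : ℕ × ℕ) : 1 ≤ typesPow k i := Nat.one_le_pow _ _ (by omega)

variable {m}

theorem InTime.loopPow {P : Stmt} {k l : ℕ} (hP : InTime (pairRounds m) (typesPow k) P) {x : Vr}
    {e : Exp} {c : ℕ} (hx : ∀ i, pairRounds m i x ≤ c * typesPow l i) :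
    InTime (pairRounds m) (typesPow (l + k)) (Stmt.loop x e P) :=
  hP.loop (one_le_typesPow _) (one_le_typesPow _) ⟨c, fun i => by
    rw [show typesPow (l + k) i = typesPow l i * typesPow k i from pow_add _ _ _, ← mul_assoc]
    exact Nat.mul_le_mul_right _ (hx i)⟩

theorem InTime.powMono {P : Stmt} {k l : ℕ} (hP : InTime (pairRounds m) (typesPow k) P)
    (h : k ≤ l) : InTime (pairRounds m) (typesPow l) P :=
  hP.mono ⟨1, fun i => by
    rw [one_mul]
    exact Nat.pow_le_pow_right (by omega) h⟩

theorem rounds_zz (i : ℕ × ℕ) :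
    pairRounds m i .zz ≤ (4 * m + 6) ^ (2 * m) * typesPow (3 * m) i := (tableSize_eq _ _).le

theorem rounds_dd (i : ℕ × ℕ) :
    pairRounds m i .dd ≤ (4 * m + 3) ^ (2 * m) * typesPow m i := (diffSize_eq _ _).le

theorem rounds_qq (i : ℕ × ℕ) : pairRounds m i .qq ≤ m * typesPow 1 i := by
  simp [typesPow, pairRounds, rounds]

theorem rounds_pp (i : ℕ × ℕ) : pairRounds m i .pp ≤ 1 * typesPow 1 i := by
  simp [typesPow, pairRounds, rounds]

theorem rounds_cc (i : ℕ × ℕ) : pairRounds m i .cc ≤ 2 * m * typesPow 0 i := by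
  simp [typesPow, pairRounds, rounds]

theorem rounds_ii (i : ℕ × ℕ) : pairRounds m i .ii ≤ m * typesPow 0 i := by
  simp [typesPow, pairRounds, rounds]

theorem inTime_pairCells : InTime (pairRounds m) (typesPow 0) (pairCells m) := by
  have h1 := one_le_typesPow 0
  refine .seq (inTime_assign h1) (.seq (inTime_assign h1) (.seq (inTime_assign h1)
    (.loopPow (k := 0) ?_ rounds_cc)))
  repeat' first
    | exact inTime_assign h1
    | refine .seq ?_ ?_
    | refine .ite h1 ?_ ?_

theorem inTime_fillRow (a : Ar) (z e : Exp) :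
    InTime (pairRounds m) (typesPow 1) (fillRow a z e) :=
  .loopPow (k := 0) (inTime_put (one_le_typesPow 0)) rounds_qq

theorem inTime_combineCell : InTime (pairRounds m) (typesPow (m + 1)) (combineCell m) := by
  have h1 := one_le_typesPow 1
  exact .loopPow (.seq (inTime_pairCells.powMono zero_le_one) (.ite h1 (.ite h1
    (.seq (inTime_put h1) (inTime_fillRow _ _ _)) (inTime_skip h1)) (inTime_skip h1))) rounds_dd

theorem inTime_clearFlags : InTime (pairRounds m) (typesPow (3 * m + 1)) clearFlags :=
  .loopPow (inTime_put (one_le_typesPow 1)) rounds_zz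

theorem inTime_copyTable : InTime (pairRounds m) (typesPow (3 * m + 1)) copyTable :=
  .loopPow (.seq (inTime_put (one_le_typesPow 1)) (inTime_fillRow _ _ _)) rounds_zz

theorem inTime_initTable : InTime (pairRounds m) (typesPow (3 * m + 1)) initTable :=
  .loopPow (.seq (inTime_put (one_le_typesPow 1)) (inTime_fillRow _ _ _)) rounds_zz

theorem inTime_double : InTime (pairRounds m) (typesPow (4 * m + 1)) (double m) := by
  have h1 := one_le_typesPow (m + 1)
  have h2 : InTime (pairRounds m) (typesPow (3 * m + (m + 1)))
      (loop .zz (var .size) (ite (lit 0) (get .flag (var .zz)) (combineCell m) skip)) :=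
    .loopPow (.ite h1 inTime_combineCell (inTime_skip h1)) rounds_zz
  exact .seq (inTime_clearFlags.powMono (by omega))
    (.seq (h2.powMono (by omega)) (inTime_copyTable.powMono (by omega)))

theorem inTime_addJobs : InTime (pairRounds m) (typesPow (3 * m + 1)) (addJobs m) := by
  have h1 := one_le_typesPow 1
  have hi : ∀ i, pairRounds m i .ii ≤ m * typesPow 0 i := rounds_ii
  refine .seq inTime_clearFlags (.seq (.loopPow (.ite h1 (InTime.powMono (k := 0 + 1)
    (.loopPow (.ite h1 (.ite h1 ?_ (inTime_skip h1)) (inTime_skip h1)) hi) le_rfl)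
    (inTime_skip h1)) rounds_zz) inTime_copyTable)
  exact .seq (inTime_assign h1) (.seq (inTime_put h1) (.seq (inTime_fillRow _ _ _) (inTime_put h1)))

theorem inTime_setBase : InTime (pairRounds m) (typesPow 0) (setBase m) :=
  .loopPow (.seq (inTime_put (one_le_typesPow 0)) (inTime_put (one_le_typesPow 0))) rounds_cc

theorem inTime_nextLevel (hm : 0 < m) :
    InTime (pairRounds m) (typesPow (4 * m + 2)) (nextLevel m) := by
  have h1 := one_le_typesPow (4 * m + 2)
  have h2 := one_le_typesPow (3 * m + 1)
  have h3 : InTime (pairRounds m) (typesPow (1 + (3 * m + 1))) (loop .pp (var .types)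
      (ite (lit 0) (get .cnt (var .pp) / var .lpow % lit 2) (addJobs m) skip)) :=
    .loopPow (.ite h2 inTime_addJobs (inTime_skip h2)) rounds_pp
  exact .seq (inTime_assign h1) (.seq (inTime_setBase.powMono (by omega))
    (.seq (inTime_double.powMono (by omega)) (h3.powMono (by omega))))

/-- The time for `k` nested loops over levels. -/
def levelsTime (m k : ℕ) (i : ℕ × ℕ) : ℕ := maxLevels i.1 i.2 ^ k * typesPow (4 * m + 2) i

theorem one_le_levelsTime (k : ℕ) (i : ℕ × ℕ) : 1 ≤ levelsTime m k i :=
  Nat.mul_pos (Nat.pow_pos (Nat.succ_pos _)) (one_le_typesPow _ i)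

theorem InTime.levels {P : Stmt} {l : ℕ} (hP : InTime (pairRounds m) (typesPow l) P)
    (hl : l ≤ 4 * m + 2) (k : ℕ) : InTime (pairRounds m) (levelsTime m k) P :=
  (hP.powMono hl).mono ⟨1, fun i => by
    rw [one_mul]
    exact Nat.le_mul_of_pos_left _ (Nat.pow_pos (Nat.succ_pos _))⟩

theorem InTime.loopLevels {P : Stmt} {k : ℕ} (hP : InTime (pairRounds m) (levelsTime m k) P)
    {x : Vr} {e : Exp} {c : ℕ} (hx : ∀ i, pairRounds m i x ≤ c * maxLevels i.1 i.2) :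
    InTime (pairRounds m) (levelsTime m (k + 1)) (Stmt.loop x e P) := by
  refine hP.loop (one_le_levelsTime k) (one_le_levelsTime (k + 1)) ⟨c, fun i => ?_⟩
  rw [levelsTime, levelsTime, pow_succ', mul_assoc, ← mul_assoc c]
  exact Nat.mul_le_mul_right _ (hx i)

theorem inTime_decideLoad (hm : 0 < m) : InTime (pairRounds m) (levelsTime m 1) (decideLoad m) := by
  have h0 := one_le_typesPow 0
  have h1 := one_le_levelsTime (m := m) 1
  have h2 : InTime (pairRounds m) (typesPow 0) (loop .cc (lit (2 * m))
      (.centre ::= var .centre +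
        (get .tgt (var .cc) - get .base (var .cc)) * get .str (var .cc))) :=
    .loopPow (k := 0) (inTime_assign h0) rounds_cc
  have h3 : InTime (pairRounds m) (levelsTime m 1) (loop .kk (var .levels) (nextLevel m)) :=
    ((inTime_nextLevel hm).levels le_rfl 0).loopLevels fun i => (one_mul _).ge
  have h4 : InTime (pairRounds m) (levelsTime m 1) (decideTarget m) :=
    .seq (inTime_assign h1) (.seq (inTime_setBase.levels (by omega) 1)
      (.seq (inTime_initTable.levels (by omega) 1) (.seq h3 (.seq (inTime_assign h1)
        (.seq (h2.levels (by omega) 1) (.ite h1 (inTime_assign h1) (inTime_assign h1)))))))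
  refine .seq (InTime.levels (l := 0) ?_ (by omega) 1) h4
  exact .loopPow (k := 0) (.seq (inTime_put h0) (inTime_put h0)) rounds_ii

theorem inTime_search (hm : 0 < m) : InTime (pairRounds m) (levelsTime m 2) (search m) := by
  have h1 := one_le_levelsTime (m := m) 1
  have h2 := one_le_levelsTime (m := m) 2
  have hdec := inTime_decideLoad hm
  have hdec' : InTime (pairRounds m) (levelsTime m 2) (decideLoad m) :=
    hdec.mono ⟨1, fun i => by
      rw [one_mul]
      exact Nat.mul_le_mul_right _ (Nat.pow_le_pow_right (Nat.succ_pos _) one_le_two)⟩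
  have hfind : InTime (pairRounds m) (levelsTime m 2) (findLoad m) :=
    .seq (inTime_assign h2) (.seq (inTime_assign h2) (.loopLevels (.seq (inTime_assign h1)
      (.seq (inTime_assign h1) (.seq hdec (.ite h1 (inTime_assign h1) (inTime_skip h1)))))
      fun i => le_rfl))
  have hset : InTime (pairRounds m) (levelsTime m 2) setBest :=
    .seq (inTime_assign h2) (.seq (inTime_assign h2) (inTime_assign h2))
  refine .seq (inTime_assign h2) (.loop h2 h2 ?_ ⟨m, fun i => le_rfl⟩)
  exact .seq (inTime_assign h2) (.seq hfind (.seq (inTime_assign h2) (.seq hdec' (.ite h2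
    (.ite h2 hset (.ite h2 hset (inTime_skip h2))) (inTime_skip h2)))))

variable (m) in
/-- The running time of the program up to a constant. -/
def totalTime (i : ℕ × ℕ) : ℕ := levelsTime m 2 i + (i.1 + i.2)

theorem inTime_main (hm : 0 < m) : InTime (pairRounds m) (totalTime m) (main m) := by
  have h0 := one_le_typesPow 0
  have ht : ∀ i, 1 ≤ totalTime m i := fun i => le_add_right (one_le_levelsTime 2 i)
  have hlev : ∀ {P}, InTime (pairRounds m) (levelsTime m 2) P →
      InTime (pairRounds m) (totalTime m) P := fun hP =>
    hP.mono ⟨1, fun i => by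
      rw [one_mul]
      exact Nat.le_add_right _ _⟩
  have hjobs : ∀ {P e}, InTime (pairRounds m) (typesPow 0) P →
      InTime (pairRounds m) (totalTime m) (loop .jj e P) := fun hP =>
    hP.loop h0 ht ⟨1, fun i => by
      rw [one_mul, typesPow, pow_zero, mul_one]
      exact Nat.le_add_left _ _⟩
  have hread : InTime (pairRounds m) (totalTime m) readInput :=
    .seq (inTime_assign ht) (.seq (inTime_assign ht)
      (.seq (hjobs (.ite h0 (inTime_assign h0) (inTime_skip h0))) (.seq (inTime_assign ht)
        (.seq (hjobs (inTime_put h0)) (.seq (inTime_assign ht) (.seq (inTime_assign ht)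
          (hjobs (.ite h0 (.seq (inTime_assign h0) (inTime_assign h0)) (inTime_skip h0)))))))))
  have hparams : InTime (pairRounds m) (totalTime m) (setParams m) := by
    refine .seq (inTime_assign ht) (.seq (inTime_assign ht) (.seq (inTime_assign ht)
      (hlev (InTime.levels (l := 0) (.loopPow (k := 0) ?_ rounds_cc) (by omega) 2))))
    exact .seq (.ite h0 (inTime_put h0) (inTime_put h0)) (.seq (inTime_put h0)
      (.seq (inTime_put h0) (.seq (inTime_assign h0) (inTime_assign h0))))
  have hdist : InTime (pairRounds m) (totalTime m) (distribute m) := by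
    refine hjobs (.seq (inTime_assign h0) (.loopPow (k := 0) ?_ rounds_ii))
    exact .ite h0 (.ite h0 (.seq (inTime_put h0) (.seq (inTime_put h0) (inTime_assign h0)))
      (inTime_skip h0)) (inTime_skip h0)
  have hdec : InTime (pairRounds m) (totalTime m) (decideLoad m) :=
    hlev ((inTime_decideLoad hm).mono ⟨1, fun i => by
      rw [one_mul]
      exact Nat.mul_le_mul_right _ (Nat.pow_le_pow_right (Nat.succ_pos _) one_le_two)⟩)
  exact .seq hread (.seq hparams (.seq (hlev (inTime_search hm)) (.ite ht
    (.seq (inTime_assign ht) (.seq (inTime_assign ht) (.seq hdec (.seq hdist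
      (inTime_assign ht))))) (inTime_assign ht))))

theorem totalTime_le {n pm : ℕ} (hn : 0 < n) :
    totalTime m (n, pm) ≤ softBound (2 ^ (4 * m + 2) + 1) 2 (pm ^ (4 * m + 2) + n) := by
  set f := pm ^ (4 * m + 2) + n with hf
  have h1 : n + pm ≤ f := by
    have : pm ≤ pm ^ (4 * m + 2) := Nat.le_self_pow (by omega) pm
    omega
  have h2 : maxLevels n pm ≤ Nat.log 2 f + 1 := Nat.add_le_add_right (Nat.log_mono_right h1) 1
  have h3 : (pm + 1) ^ (4 * m + 2) ≤ 2 ^ (4 * m + 2) * f := by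
    rcases Nat.eq_zero_or_pos pm with rfl | hpm
    · rw [zero_add, one_pow]
      exact Nat.mul_pos (by positivity) (by omega)
    · calc (pm + 1) ^ (4 * m + 2) ≤ (2 * pm) ^ (4 * m + 2) := Nat.pow_le_pow_left (by omega) _
        _ = 2 ^ (4 * m + 2) * pm ^ (4 * m + 2) := mul_pow _ _ _
        _ ≤ _ := Nat.mul_le_mul_left _ (Nat.le_add_right _ _)
  calc maxLevels n pm ^ 2 * (pm + 1) ^ (4 * m + 2) + (n + pm)
      ≤ (Nat.log 2 f + 1) ^ 2 * (2 ^ (4 * m + 2) * f) + f * (Nat.log 2 f + 1) ^ 2 :=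
        add_le_add (Nat.mul_le_mul (Nat.pow_le_pow_left h2 2) h3)
          (h1.trans (Nat.le_mul_of_pos_right _ (Nat.pow_pos (Nat.succ_pos _))))
    _ = _ := by
      rw [softBound]
      ring

end Time

/-! ### The size of the words -/

section Words

variable {m n pm N : ℕ}

/-- The loops have at most `(N + 2) ^ roundsExp m` rounds, where `N` is the largest number of the
instance. The first two summands account for the size of a table, the last one is large enough for
the products of loads, numerators and denominators. -/
def roundsExp (m : ℕ) : ℕ := (4 * m + 6) * (2 * m) + 3 * m + 9

theorem le_base_pow (N : ℕ) {k l : ℕ} (h : k ≤ l) : (N + 2) ^ k ≤ (N + 2) ^ l :=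
  Nat.pow_le_pow_right (by omega) h

theorem const_le_base_pow (N k : ℕ) : k ≤ (N + 2) ^ k := (Nat.lt_pow_self (by omega)).le

theorem tableSize_le (hpm : pm ≤ N) (m : ℕ) :
    tableSize m (pm + 1) ≤ (N + 2) ^ ((4 * m + 6) * (2 * m) + 3 * m) := by
  rw [tableSize_eq, pow_add, pow_mul (N + 2)]
  exact Nat.mul_le_mul (Nat.pow_le_pow_left (const_le_base_pow _ _) _)
    (Nat.pow_le_pow_left (by omega) _)

theorem diffSize_le_tableSize (m Q : ℕ) (hQ : 0 < Q) : diffSize m Q ≤ tableSize m Q := by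
  rw [diffSize_eq, tableSize_eq]
  exact Nat.mul_le_mul (Nat.pow_le_pow_left (by omega) _) (Nat.pow_le_pow_right hQ (by omega))

theorem rounds_le (hn : n ≤ N) (hpm : pm ≤ N) (x : Vr) :
    rounds m n pm x ≤ (N + 2) ^ roundsExp m := by
  have h1 : (N + 2) ^ (3 * m + 9) ≤ (N + 2) ^ roundsExp m :=
    le_base_pow N (by unfold roundsExp; omega)
  have hsq : 2 * (2 * N + 1) ≤ (N + 2) ^ 3 := by nlinarith [Nat.zero_le N, Nat.zero_le (N * N)]
  have h3 : (N + 2) ^ 3 ≤ (N + 2) ^ roundsExp m :=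
    le_base_pow N (by unfold roundsExp; omega)
  have hm : 2 * m ≤ (N + 2) ^ roundsExp m :=
    (const_le_base_pow N _).trans (le_base_pow N (by unfold roundsExp; nlinarith))
  have ht : tableSize m (pm + 1) ≤ (N + 2) ^ roundsExp m :=
    (tableSize_le hpm m).trans (le_base_pow N (by unfold roundsExp; omega))
  have hl : maxLevels n pm ≤ 2 * N + 1 := by
    have : Nat.log 2 (n + pm) ≤ n + pm := Nat.log_le_self _ _
    unfold maxLevels
    omega
  cases x
  case jj => exact le_trans (by simp only [rounds]; omega) h3
  case zz => exact ht
  case dd => exact (diffSize_le_tableSize m _ (Nat.succ_pos _)).trans ht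
  case qq =>
    calc m * (pm + 1) ≤ (N + 2) ^ m * (N + 2) ^ 1 :=
          Nat.mul_le_mul (const_le_base_pow _ _) (by rw [pow_one]; omega)
      _ = (N + 2) ^ (m + 1) := (pow_add _ _ _).symm
      _ ≤ _ := le_base_pow N (by unfold roundsExp; omega)
  case pp => exact le_trans (by simp only [rounds]; omega) h3
  case cc => exact hm
  case ii => exact le_trans (by simp only [rounds]; omega) hm
  case ss => exact le_trans (by simp only [rounds]; omega) hm
  case kk => exact le_trans (by simp only [rounds]; omega) h3
  case bb => exact le_trans (by simp only [rounds]; omega) h3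
  all_goals exact Nat.zero_le _

theorem searchFits {num den proc : ℕ → ℕ} (hm : 0 < m) (hn : n ≤ N) (hpm : pm ≤ N)
    (hnum : ∀ i, num i ≤ N) (hden : ∀ i, den i ≤ N) {K : ℕ} (hlow : n + pm < 2 ^ K)
    (hup : 2 ^ K ≤ 2 * (n + pm)) :
    SearchFits ((N + 2) ^ (roundsExp m + 1)) (rounds m n pm) m (pm + 1) K (typeCount proc n)
      num den := by
  have hV : (N + 2) ^ roundsExp m ≤ (N + 2) ^ (roundsExp m + 1) := le_base_pow N (Nat.le_succ _)
  have hlev : K ≤ maxLevels n pm := by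
    have h2 : 2 ^ (K - 1) ≤ n + pm := by
      rcases K with - | K
      · rw [pow_zero] at hlow
        simp
        omega
      · rw [pow_succ] at hup
        simp
        omega
    have := Nat.le_log_of_pow_le one_lt_two h2
    unfold maxLevels
    omega
  have hK : 2 ^ K ≤ (N + 2) ^ 3 := by nlinarith [Nat.zero_le N, Nat.zero_le (N * N)]
  have hKK : 2 ^ K * 2 ^ K ≤ (N + 2) ^ 6 := by
    calc 2 ^ K * 2 ^ K ≤ (N + 2) ^ 3 * (N + 2) ^ 3 := Nat.mul_le_mul hK hK
      _ = (N + 2) ^ 6 := by ring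
  have hle : ∀ k ≤ 9, (N + 2) ^ k ≤ (N + 2) ^ (roundsExp m + 1) := fun k hk =>
    le_base_pow N (by unfold roundsExp; omega)
  refine ⟨⟨le_rfl, le_rfl, le_rfl, le_rfl, le_rfl, le_rfl, fun x => (rounds_le hn hpm x).trans hV,
    Nat.one_le_pow _ _ (by omega), ?_⟩, hlev, Nat.mul_le_mul_left 2 hlev, le_rfl,
    hKK.trans (hle 6 (by omega)), fun p _ => ?_, fun i _ j _ L hL => ?_⟩
  · exact (rounds_le hn hpm .zz).trans hV
  · exact (typeCount_le _ _ _).trans_lt (by omega)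
  · calc L * den i * num j ≤ (N + 2) ^ 6 * (N + 2) * (N + 2) :=
          Nat.mul_le_mul (Nat.mul_le_mul (hL.le.trans hKK) ((hden i).trans (by omega)))
            ((hnum j).trans (by omega))
      _ = (N + 2) ^ 8 := by ring
      _ ≤ _ := hle 8 (by omega)

end Words

section Input

variable {m : ℕ} (I : CapInstance m)

open CapInstance (toArr)

theorem toArr_le {k N : ℕ} {f : Fin k → ℕ} (h : ∀ i, f i ≤ N) (i : ℕ) : toArr f i ≤ N := by
  unfold CapInstance.toArr
  split_ifs
  · exact h _
  · exact Nat.zero_le _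

theorem sup_toArr : (Finset.range I.n).sup (toArr I.p) = I.pmax := by
  refine le_antisymm (Finset.sup_le fun j hj => ?_) (Finset.sup_le fun j _ => ?_)
  · exact Nat.le_of_lt_succ (toArr_lt I j (Finset.mem_range.1 hj))
  · rw [← toArr_fin I.p j]
    exact Finset.le_sup (f := toArr I.p) (Finset.mem_range.2 j.2)

theorem magnitude_bounds : I.n ≤ I.magnitude ∧ I.pmax ≤ I.magnitude ∧
    (∀ i, I.cap i ≤ I.magnitude) ∧ (∀ i, (I.speed i).num ≤ I.magnitude) ∧
    ∀ i, (I.speed i).den ≤ I.magnitude := by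
  have h1 := le_refl I.magnitude
  conv at h1 => lhs; rw [CapInstance.magnitude]
  simp only [sup_le_iff, Finset.sup_le_iff, Finset.mem_univ, true_implies] at h1
  obtain ⟨⟨⟨⟨h1, h2⟩, h3⟩, h4⟩, h5⟩ := h1
  exact ⟨h1, h2, h3, h4, h5⟩

theorem holds_input : Holds I.n (toArr I.p) (toArr I.cap) (toArr fun i => (I.speed i).num)
    (toArr fun i => (I.speed i).den) (view I.input) :=
  ⟨rfl, rfl, rfl, rfl, rfl, fun _ => rfl⟩

theorem view_input_bounded : (view I.input).Bounded I.magnitude := by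
  obtain ⟨h1, h2, h3, h4, h5⟩ := magnitude_bounds I
  have hp : ∀ j, I.p j ≤ I.magnitude := fun j =>
    (Finset.le_sup (f := I.p) (Finset.mem_univ j)).trans h2
  constructor
  · intro x
    change (if _ then _ else _) ≤ _
    split_ifs
    · exact h1
    · exact Nat.zero_le _
  · intro a i
    cases a
    case proc => exact toArr_le hp i
    case cap => exact toArr_le h3 i
    case num => exact toArr_le h4 i
    case den => exact toArr_le h5 i
    all_goals exact Nat.zero_le _

theorem main_correct (hm : 0 < m) (hn : 0 < I.n) :
    ∃ (t : ℕ) (s : WordRAM.State),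
      WordRAM.Exec (I.wordBound ((roundsExp m + 1) * ((main m).weight + 1))) ((main m).code 0)
        I.input t s ∧ I.Answered s ∧ t ≤ (main m).cost (pairRounds m (I.n, I.pmax)) := by
  obtain ⟨h1, h2, h3, h4, h5⟩ := magnitude_bounds I
  set N := I.magnitude with hN
  set V := (N + 2) ^ (roundsExp m + 1) with hV
  have hVlow : 4 * N + 2 ≤ V := by
    calc 4 * N + 2 ≤ (N + 2) ^ 3 := by nlinarith [Nat.zero_le N, Nat.zero_le (N * N)]
      _ ≤ V := le_base_pow N (by unfold roundsExp; omega)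
  have hβ : ∀ x, pairRounds m (I.n, I.pmax) x < V := fun x =>
    (rounds_le h1 h2 x).trans_lt (Nat.pow_lt_pow_right (by omega) (Nat.lt_succ_self _))
  -- the words hold all numbers that arise in evaluating the expressions of the program
  have hword : ∀ k ≤ (main m).weight + 1,
      V ^ k < I.wordBound ((roundsExp m + 1) * ((main m).weight + 1)) := by
    intro k hk
    rw [hV, ← pow_mul]
    exact Nat.pow_lt_pow_right (by omega) (Nat.lt_succ_of_le (Nat.mul_le_mul_left _ hk))
  have hb : (view I.input).Bounded V :=
    have := view_input_bounded I
    ⟨fun x => (this.1 x).trans (by omega), fun a i => (this.2 a i).trans (by omega)⟩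
  obtain ⟨hok, K, hlow, hsolved⟩ := main_spec (V := V) (β := pairRounds m (I.n, I.pmax)) hm hn
    (sup_toArr I) (fun i hi => by
      rw [toArr_fin (fun i => (I.speed i).num) ⟨i, hi⟩]
      exact NNRat.num_pos.2 (I.speed_pos _)) le_rfl (by omega)
    (fun K hlow hup => searchFits hm h1 h2 (toArr_le h4) (toArr_le h5) hlow hup) hb (holds_input I)
  obtain ⟨t, s, hexec, ht, hs, -, -⟩ := Stmt.correct (by omega) hβ
    (by simpa using hword 1 (by omega)) (main m) (hword _ (Nat.le_succ _)) 0 I.input hb hok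
  refine ⟨t, s, hexec, answered_of_solved I hm (B := 2 ^ K * 2 ^ K) ?_ (hs ▸ hsolved), ht⟩
  exact Nat.mul_lt_mul'' (by omega) (by omega)

end Input

end CapScheduling

theorem mainTheorem2 (m : ℕ) (hm : 0 < m) :
    ∃ (P : WordRAM.Prog) (e c k : ℕ), ∀ I : CapInstance m, 0 < I.n →
      ∃ (t : ℕ) (s : WordRAM.State),
        WordRAM.Exec (I.wordBound e) P I.input t s ∧ I.Answered s ∧
          t ≤ softBound c k (I.pmax ^ (4 * m + 2) + I.n) := by
  obtain ⟨c, hc⟩ := CapScheduling.inTime_main hm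
  refine ⟨(CapScheduling.main m).code 0,
    (CapScheduling.roundsExp m + 1) * ((CapScheduling.main m).weight + 1),
    c * (2 ^ (4 * m + 2) + 1), 2, fun I hn => ?_⟩
  obtain ⟨t, s, hexec, hans, ht⟩ := CapScheduling.main_correct I hm hn
  refine ⟨t, s, hexec, hans, ht.trans ((hc _).trans
    ((Nat.mul_le_mul_left c (CapScheduling.totalTime_le hn)).trans_eq ?_))⟩
  simp only [softBound, mul_assoc]
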